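/- For $n \ge 0$ let $F_n$ be the free group on $n$ generators, and let $\mathrm{IA}_n$ be the Torelli subgroup of $\mathrm{Aut}(F_n)$, i.e. the kernel of the action of $\mathrm{Aut}(F_n)$ on the abelianization $F_n^{\mathrm{ab}} \cong \mathbb{Z}^n$. For a group $G$ let $G[1] = G$ and $G[k+1] = [G[k], G]$ for $k \ge 1$ be its lower central series. Let $k \ge 2$ and $n \ge 6k-4$. Then every subgroup $K$ of $\mathrm{IA}_n$ with $\mathrm{IA}_n[k] \subseteq K$ is finitely generated. In particular, $\mathrm{IA}_n[k]$ is finitely generated. -/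

import Mathlib

/-- The action of `Aut(G)` on the abelianization `G^ab`, as a group homomorphism
`Aut(G) → Aut(G^ab)`; it sends `φ` to the automorphism induced by `φ`. -/
def autAbelianization (G : Type*) [Group G] : MulAut G →* MulAut (Abelianization G) where
  toFun φ := MulEquiv.abelianizationCongr φ
  map_one' := by
    ext x
    induction x using QuotientGroup.induction_on with
    | H g => rfl
  map_mul' φ ψ := by
    ext x
    induction x using QuotientGroup.induction_on with
    | H g => rfl

/-- The Torelli subgroup `IA_n` of `Aut(F_n)`: the kernel of the action of `Aut(F_n)` on
`F_n^ab`, where `F_n` is the free group on `n` generators. -/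
def IA (n : ℕ) : Subgroup (MulAut (FreeGroup (Fin n))) :=
  (autAbelianization (FreeGroup (Fin n))).ker

/-- The `k`-th term `G[k]` of the lower central series of a group `G`, numbered from one:
`G[1] = G` and `G[k+1] = [G[k], G]` for `k ≥ 1`. (The value at `k = 0` is `G`.) -/
def lcsTerm (G : Type*) [Group G] (k : ℕ) : Subgroup G :=
  (⊤ : Subgroup G).lowerCentralSeries (k - 1)

/-! Write H for the Torelli group and H_j for its term `lowerCentralSeries j`, indexed from zero.
Every H_j with 6j + 1 ≤ n is finitely generated, by induction on j
(`AutFree.lowerCentralSeries_fg`). The quotients H_i / H_{i+1} are then finitely generated abelian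
groups for i < k - 1, so a subgroup containing H_{k-1} is assembled from finitely many finitely
generated pieces (`Subgroup.fg_of_lowerCentralSeries_le`).

The passage from H_j to H_{j+1} = [H_j, H] rests on `Pushing.fg_commutator`, a criterion in the
spirit of Bieri, Neumann and Strebel. Modulo torsion, H_j / H_{j+1} is a lattice in a Euclidean
space. A path in the Cayley graph of H_j joining two elements over the origin is pushed inwards
until it lies over a fixed ball, and the Reidemeister-Schreier method then leaves finitely many
generators. Pushing in the direction of a character χ needs a finite set of elements outside the
kernel of χ whose commutation graph is connected, such that each member of some generating set of H
commutes with one of them.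

`AutFree.exists_commuting_family` supplies these elements. A nonzero χ is nonzero on a left normed
commutator of Magnus's generators, which involves at most m = 3(j + 1) letters. Permuting letters
and changing signs gives, for every set J of m letters, an element y_J involving only J and an
automorphism a with χ(a y_J a⁻¹) ≠ 0. Transvections act unipotently on the real characters of H, so
g ↦ χ(g y_J g⁻¹) is polynomial along powers of transvections. As for nonzero polynomials on an
irreducible variety, one g avoids all the zero sets (`PolynomialAlong.exists_ne_zero`). The elements
g y_J g⁻¹ commute for disjoint J, and the Kneser graph of m-sets is connected because 2m + 1 ≤ n. A
conjugated Magnus generator involves three letters, up to conjugation by g, and so commutes with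
some g y_J g⁻¹.

The argument uses Magnus's finite generating set of H (`AutFree.ker_autAbelianization_eq`).
Nielsen's theorem (`AutFree.nielsenSubgroup_eq_top`) makes it possible to check that Magnus's
generators span a normal subgroup of Aut(F_n). The quotient satisfies the Steinberg-type relations
of GL_n(ℤ), and `ElementarySystem.faithful` shows that these relations already force it to act
faithfully on ℤ^n. That proof determines line stabilizers by induction on the rank, by means of a
Euclidean descent in a graph of lines. -/

set_option linter.unusedSectionVars false
set_option linter.unusedSimpArgs false


/-! ### Elementary automorphisms of a free group -/

namespace AutFree

variable {α : Type*} [DecidableEq α]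

open FreeGroup (of lift)

/-- The subgroup of the free group generated by all the letters other than `a`. -/
def away (a : α) : Subgroup (FreeGroup α) :=
  Subgroup.closure (FreeGroup.of '' {a}ᶜ)

theorem of_mem_away {a b : α} (h : b ≠ a) : of b ∈ away a :=
  Subgroup.subset_closure ⟨b, h, rfl⟩

theorem hom_ext_away {H : Type*} [Group H] {a : α} {f g : FreeGroup α →* H}
    (h : ∀ b ≠ a, f (of b) = g (of b)) {w : FreeGroup α} (hw : w ∈ away a) : f w = g w := by
  induction hw using Subgroup.closure_induction with
  | mem x hx => obtain ⟨b, hb, rfl⟩ := hx; exact h b hb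
  | one => simp
  | mul x y _ _ hx hy => simp [hx, hy]
  | inv x _ hx => simp [hx]

/-- The endomorphism replacing the letter `a` by `u a v` and fixing the other letters. -/
def transvHom (a : α) (u v : FreeGroup α) : FreeGroup α →* FreeGroup α :=
  lift fun b => if b = a then u * of a * v else of b

theorem transvHom_self (a : α) (u v : FreeGroup α) :
    transvHom a u v (of a) = u * of a * v := by simp [transvHom]

theorem transvHom_of_ne {a b : α} (h : b ≠ a) (u v : FreeGroup α) :
    transvHom a u v (of b) = of b := by simp [transvHom, h]

theorem transvHom_away {a : α} (u v : FreeGroup α) {w : FreeGroup α}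
    (hw : w ∈ away a) : transvHom a u v w = w :=
  hom_ext_away (g := MonoidHom.id _) (fun _ h => transvHom_of_ne h u v) hw

/-- The inner words `u'` and `v'` avoid `a`, so the outer substitution leaves them alone and only
unfolds the middle letter. This is why the left factors multiply in reversed order. -/
theorem transvHom_comp {a : α} {u v u' v' : FreeGroup α} (hu : u' ∈ away a)
    (hv : v' ∈ away a) :
    (transvHom a u v).comp (transvHom a u' v') = transvHom a (u' * u) (v * v') := by
  ext b
  by_cases h : b = a
  · subst h
    simp [transvHom_self, transvHom_away u v hu, transvHom_away u v hv, mul_assoc]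
  · simp [transvHom_of_ne h]

theorem transvHom_one (a : α) : transvHom a 1 1 = MonoidHom.id (FreeGroup α) := by
  ext b
  by_cases h : b = a
  · subst h; simp [transvHom_self]
  · simp [transvHom_of_ne h]

open Classical in
/-- The automorphism of the free group replacing the letter `a` by `u a v` and fixing the other
letters, where `u` and `v` are words not involving `a`
(the identity if `u` or `v` involves `a`). -/
noncomputable def transv (a : α) (u v : FreeGroup α) : MulAut (FreeGroup α) :=
  if h : u ∈ away a ∧ v ∈ away a then
    MonoidHom.toMulEquiv (transvHom a u v) (transvHom a u⁻¹ v⁻¹)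
      (by rw [transvHom_comp h.1 h.2]; simp [transvHom_one])
      (by rw [transvHom_comp (inv_mem h.1) (inv_mem h.2)]; simp [transvHom_one])
  else 1

theorem transv_self {a : α} {u v : FreeGroup α} (hu : u ∈ away a) (hv : v ∈ away a) :
    transv a u v (of a) = u * of a * v := by
  rw [transv, dif_pos ⟨hu, hv⟩]; exact transvHom_self a u v

theorem transv_of_ne {a b : α} (h : b ≠ a) (u v : FreeGroup α) :
    transv a u v (of b) = of b := by
  rw [transv]
  split_ifs with h'
  · exact transvHom_of_ne h u v
  · rfl

theorem transv_away {a : α} (u v : FreeGroup α) {w : FreeGroup α}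
    (hw : w ∈ away a) : transv a u v w = w :=
  hom_ext_away (f := (transv a u v).toMonoidHom) (g := MonoidHom.id _)
    (fun _ h => transv_of_ne h u v) hw

theorem mulAut_ext {φ ψ : MulAut (FreeGroup α)} (h : ∀ a, φ (of a) = ψ (of a)) :
    φ = ψ := by
  have : φ.toMonoidHom = ψ.toMonoidHom := by ext a; exact h a
  ext x
  exact DFunLike.congr_fun this x

theorem transv_mul {a : α} {u v u' v' : FreeGroup α} (hu : u ∈ away a)
    (hv : v ∈ away a) (hu' : u' ∈ away a) (hv' : v' ∈ away a) :
    transv a u v * transv a u' v' = transv a (u' * u) (v * v') := by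
  apply mulAut_ext
  intro b
  by_cases h : b = a
  · subst h
    simp [transv_self, transv_away, mul_mem, hu, hv, hu', hv', mul_assoc]
  · simp [transv_of_ne h]

theorem transv_one_one (a : α) : transv a 1 1 = 1 := by
  apply mulAut_ext
  intro b
  by_cases h : b = a
  · subst h; simp [transv_self]
  · simp [transv_of_ne h]

theorem transv_inv {a : α} {u v : FreeGroup α} (hu : u ∈ away a) (hv : v ∈ away a) :
    (transv a u v)⁻¹ = transv a u⁻¹ v⁻¹ := by
  rw [inv_eq_iff_mul_eq_one, transv_mul hu hv (inv_mem hu) (inv_mem hv)]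
  simp [transv_one_one]

/-- The Nielsen transvection `x_i ↦ x_i x_j`. -/
noncomputable def nielsen (i j : α) : MulAut (FreeGroup α) := transv i 1 (of j)

/-- The automorphism inverting the letter `i`. -/
def inversion (i : α) : MulAut (FreeGroup α) :=
  MonoidHom.toMulEquiv (lift fun b => if b = i then (of b)⁻¹ else of b)
    (lift fun b => if b = i then (of b)⁻¹ else of b)
    (by ext b; by_cases h : b = i <;> simp [h]) (by ext b; by_cases h : b = i <;> simp [h])

theorem inversion_self (i : α) : inversion i (of i) = (of i)⁻¹ := by
  simp [inversion]

theorem inversion_of_ne {i b : α} (h : b ≠ i) : inversion i (of b) = of b := by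
  simp [inversion, h]

theorem nielsen_self {i j : α} (h : j ≠ i) : nielsen i j (of i) = of i * of j := by
  simp [nielsen, transv_self, of_mem_away h, one_mem]

theorem nielsen_of_ne {i b : α} (j : α) (h : b ≠ i) : nielsen i j (of b) = of b :=
  transv_of_ne h _ _

theorem nielsen_inv {i j : α} (h : j ≠ i) :
    (nielsen i j)⁻¹ = transv i 1 (of j)⁻¹ := by
  rw [nielsen, transv_inv (one_mem _) (of_mem_away h), inv_one]

theorem nielsen_inv_self {i j : α} (h : j ≠ i) :
    (nielsen i j)⁻¹ (of i) = of i * (of j)⁻¹ := by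
  rw [nielsen_inv h, transv_self (one_mem _) (inv_mem (of_mem_away h)), one_mul]

theorem nielsen_inv_of_ne {i b : α} (j : α) (h : b ≠ i) :
    (nielsen i j)⁻¹ (of b) = of b := by
  rw [MulAut.inv_apply, MulEquiv.symm_apply_eq, nielsen_of_ne j h]

theorem inversion_mul_self (i : α) : inversion i * inversion i = 1 := by
  apply mulAut_ext
  intro b
  by_cases h : b = i
  · subst h; simp [inversion_self]
  · simp [inversion_of_ne h]

theorem inversion_inv (i : α) : (inversion i)⁻¹ = inversion i := by
  rw [inv_eq_iff_mul_eq_one, inversion_mul_self]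

/-- The automorphism permuting the letters. -/
def permAut : Equiv.Perm α →* MulAut (FreeGroup α) where
  toFun σ := FreeGroup.freeGroupCongr σ
  map_one' := by apply mulAut_ext; intro a; simp
  map_mul' σ τ := by apply mulAut_ext; intro a; simp

theorem permAut_of (σ : Equiv.Perm α) (a : α) : permAut σ (of a) = of (σ a) := by
  simp [permAut]

/-- The usual expression of a transposition by three row operations, corrected by signs. The same
word is the axiom `perm_swap` of `ElementarySystem`. -/
theorem permAut_swap {p q : α} (h : p ≠ q) : permAut (Equiv.swap p q) =
    nielsen q p * inversion q * nielsen p q * (nielsen q p)⁻¹ * inversion p * inversion q := by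
  apply mulAut_ext
  intro b
  have h' := h.symm
  rw [permAut_of]
  by_cases hp : b = p
  · subst hp
    simp only [MulAut.mul_apply, inversion_of_ne h, inversion_self, map_inv, nielsen_inv_of_ne _ h,
      nielsen_self h', map_mul, nielsen_of_ne _ h, nielsen_self h, Equiv.swap_apply_left]
    group
  by_cases hq : b = q
  · subst hq
    simp only [MulAut.mul_apply, inversion_of_ne h, inversion_of_ne h', inversion_self, map_inv,
      nielsen_inv_of_ne _ h, nielsen_inv_self h, nielsen_of_ne _ h',
      nielsen_self h', map_mul, nielsen_of_ne _ h, nielsen_self h, Equiv.swap_apply_right]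
    group
  · simp [inversion_of_ne, nielsen_of_ne, nielsen_inv_of_ne, hp, hq, Equiv.swap_apply_of_ne_of_ne,
      -MulAut.inv_apply]

/-- The subgroup of the automorphism group generated by the elementary Nielsen automorphisms
`x_i ↦ x_i x_j` and `x_i ↦ x_i⁻¹`. -/
def nielsenSubgroup (α : Type*) [DecidableEq α] : Subgroup (MulAut (FreeGroup α)) :=
  Subgroup.closure ({φ | ∃ i j, i ≠ j ∧ φ = nielsen i j} ∪ Set.range inversion)

theorem nielsen_mem {i j : α} (h : i ≠ j) : nielsen i j ∈ nielsenSubgroup α :=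
  Subgroup.subset_closure (Or.inl ⟨i, j, h, rfl⟩)

theorem inversion_mem (i : α) : inversion i ∈ nielsenSubgroup α :=
  Subgroup.subset_closure (Or.inr ⟨i, rfl⟩)

theorem permAut_mem [Finite α] (σ : Equiv.Perm α) : permAut σ ∈ nielsenSubgroup α := by
  induction σ using Equiv.Perm.swap_induction_on with
  | one => simp
  | swap_mul f x y hxy ih =>
    rw [map_mul]
    refine mul_mem ?_ ih
    rw [permAut_swap hxy]
    have h1 := nielsen_mem hxy
    have h2 := nielsen_mem hxy.symm
    exact mul_mem (mul_mem (mul_mem (mul_mem (mul_mem h2 (inversion_mem _)) h1) (inv_mem h2))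
      (inversion_mem _)) (inversion_mem _)

end AutFree


namespace AutFree

/-! ### Cancellation in free groups -/

section GromovProduct

variable {α : Type*} [DecidableEq α]

open FreeGroup (of norm invRev IsReduced mk)

/-- Strip equal initial letters from both words. At the first disagreement the two letters meeting
at the junction of `invRev a` and `b` do not cancel, and both sides are reduced. -/
theorem exists_cancellation (L₁ L₂ : List (α × Bool)) (h₁ : IsReduced L₁) (h₂ : IsReduced L₂) :
    ∃ p a b, L₁ = p ++ a ∧ L₂ = p ++ b ∧ IsReduced (invRev a ++ b) := by
  have hinv : ∀ {L : List (α × Bool)}, IsReduced L → IsReduced (invRev L) := by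
    intro L h
    rw [FreeGroup.isReduced_iff_reduce_eq] at h ⊢
    rw [FreeGroup.reduce_invRev, h]
  induction L₁ generalizing L₂ with
  | nil => exact ⟨[], [], L₂, rfl, rfl, by simpa using h₂⟩
  | cons x L₁ ih =>
    cases L₂ with
    | nil => exact ⟨[], x :: L₁, [], rfl, rfl, by simpa using hinv h₁⟩
    | cons y L₂ =>
      by_cases hxy : x = y
      · subst hxy
        obtain ⟨p, a, b, rfl, rfl, hab⟩ := ih L₂ (h₁.infix ⟨[x], [], by simp⟩)
          (h₂.infix ⟨[x], [], by simp⟩)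
        exact ⟨x :: p, a, b, rfl, rfl, hab⟩
      · refine ⟨[], x :: L₁, y :: L₂, rfl, rfl, ?_⟩
        have h3 := hinv h₁
        have e : invRev (x :: L₁) = invRev L₁ ++ [(x.1, !x.2)] := by simp [invRev]
        rw [e] at h3 ⊢
        refine IsReduced.append_overlap h3 (L₃ := y :: L₂) ?_ (by simp)
        rw [List.singleton_append, FreeGroup.isReduced_cons_cons]
        refine ⟨fun h => ?_, h₂⟩
        simp only at h ⊢
        by_contra h4
        exact hxy (Prod.ext h (by cases hx : x.2 <;> cases hy : y.2 <;> simp_all))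

/-- Twice the Gromov product of `x` and `y`, which is the length of the longest common prefix. -/
def gromov (x y : FreeGroup α) : ℤ := norm x + norm y - norm (x⁻¹ * y)

theorem norm_inv_mul_comm (x y : FreeGroup α) : norm (x⁻¹ * y) = norm (y⁻¹ * x) := by
  rw [← FreeGroup.norm_inv_eq (x := x⁻¹ * y)]
  simp

theorem gromov_comm (x y : FreeGroup α) : gromov x y = gromov y x := by
  rw [gromov, gromov, norm_inv_mul_comm]; ring

theorem exists_common_prefix (x y : FreeGroup α) : ∃ p a b, x.toWord = p ++ a ∧
    y.toWord = p ++ b ∧ norm (x⁻¹ * y) = a.length + b.length ∧ gromov x y = 2 * p.length := by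
  obtain ⟨p, a, b, ha, hb, hr⟩ := exists_cancellation x.toWord y.toWord
    FreeGroup.isReduced_toWord FreeGroup.isReduced_toWord
  have h : norm (x⁻¹ * y) = a.length + b.length := by
    have e : x⁻¹ * y = mk (invRev a ++ b) := by
      conv_lhs => rw [← FreeGroup.mk_toWord (x := x), ← FreeGroup.mk_toWord (x := y), ha, hb]
      rw [← FreeGroup.mul_mk, ← FreeGroup.mul_mk, ← FreeGroup.mul_mk, ← FreeGroup.inv_mk]
      group
    rw [e, FreeGroup.norm, FreeGroup.toWord_mk, hr.reduce_eq]
    simp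
  refine ⟨p, a, b, ha, hb, h, ?_⟩
  rw [gromov, h, FreeGroup.norm, FreeGroup.norm, ha, hb]
  simp only [List.length_append]
  push_cast
  ring

theorem le_gromov {x y : FreeGroup α} {p a b : List (α × Bool)} (hx : x.toWord = p ++ a)
    (hy : y.toWord = p ++ b) : 2 * (p.length : ℤ) ≤ gromov x y := by
  have e : x⁻¹ * y = mk (invRev a ++ b) := by
    conv_lhs => rw [← FreeGroup.mk_toWord (x := x), ← FreeGroup.mk_toWord (x := y), hx, hy]
    rw [← FreeGroup.mul_mk, ← FreeGroup.mul_mk, ← FreeGroup.mul_mk, ← FreeGroup.inv_mk]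
    group
  have h : norm (x⁻¹ * y) ≤ a.length + b.length := by
    rw [e]; exact FreeGroup.norm_mk_le.trans (by simp)
  rw [gromov, FreeGroup.norm, FreeGroup.norm, hx, hy]
  simp only [List.length_append]
  push_cast
  have : (norm (x⁻¹ * y) : ℤ) ≤ a.length + b.length := by exact_mod_cast h
  linarith

/-- The Cayley tree is 0-hyperbolic: two prefixes of `z` are comparable, and the shorter of them is
a common prefix of `x` and `y`. -/
theorem min_gromov_le (x y z : FreeGroup α) : min (gromov x z) (gromov z y) ≤ gromov x y := by
  obtain ⟨p, a, b, hx, hz, -, h⟩ := exists_common_prefix x z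
  obtain ⟨p', a', b', hz', hy, -, h'⟩ := exists_common_prefix z y
  rcases le_total p.length p'.length with hl | hl
  · obtain ⟨r, rfl⟩ := List.prefix_of_prefix_length_le (l₃ := z.toWord) ⟨b, hz.symm⟩
      ⟨a', hz'.symm⟩ hl
    refine (min_le_left _ _).trans ?_
    rw [h]
    exact le_gromov hx (by rw [hy, List.append_assoc])
  · obtain ⟨r, rfl⟩ := List.prefix_of_prefix_length_le (l₃ := z.toWord) ⟨a', hz'.symm⟩
      ⟨b, hz.symm⟩ hl
    refine (min_le_right _ _).trans ?_
    rw [h']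
    exact le_gromov (by rw [hx, List.append_assoc]) hy

/-- The ultrametric inequality in its isosceles form: among three Gromov products the two smallest
agree. -/
theorem gromov_eq_of_lt {x y z : FreeGroup α} (h : gromov x z < gromov z y) :
    gromov x y = gromov x z := by
  have h1 := min_gromov_le x y z
  have h2 := min_gromov_le x z y
  rw [gromov_comm y z] at h2
  rw [min_eq_left h.le] at h1
  rcases min_le_iff.1 h2 with h3 | h3
  · exact le_antisymm h3 h1
  · exact absurd h3 (not_le.2 h)

/-- The square of `x` is longer than `x` by the length of the cyclic reduction of `x`, which is
positive. Hence less than half of `x` cancels in `x * x`. -/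
theorem gromov_self_inv_lt {x : FreeGroup α} (hx : x ≠ 1) : gromov x⁻¹ x < norm x := by
  have h1 : x.toWord ≠ [] := by simpa using hx
  have h2 : norm (x ^ 2) = norm x + (FreeGroup.reduceCyclically x.toWord).length := by
    rw [FreeGroup.norm, FreeGroup.toWord_pow,
      FreeGroup.reduceCyclically.reduce_flatten_replicate_succ FreeGroup.isReduced_toWord 1, FreeGroup.norm]
    conv_rhs => rw [← FreeGroup.reduceCyclically.conj_conjugator_reduceCyclically x.toWord]
    simp
    have := FreeGroup.reduceCyclically.conj_conjugator_reduceCyclically x.toWord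
    rw [← List.append_assoc, this]
    ring
  have h3 : FreeGroup.reduceCyclically x.toWord ≠ [] := by
    intro h
    have := FreeGroup.reduceCyclically.conj_conjugator_reduceCyclically x.toWord
    rw [h] at this
    apply hx
    rw [← FreeGroup.mk_toWord (x := x), ← this, List.append_nil, ← FreeGroup.mul_mk,
      ← FreeGroup.inv_mk, mul_inv_cancel]
  have h4 := List.length_pos_of_ne_nil h3
  rw [gromov, inv_inv, FreeGroup.norm_inv_eq, ← sq, h2]
  push_cast
  omega

end GromovProduct

/-! ### A numerical order on words of equal length -/

section Code

variable {β : Type*} [Fintype β]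

/-- The value of a word read as a numeral in base `|β|`. -/
noncomputable def wordCode : List β → ℕ
  | [] => 0
  | x :: l => Fintype.equivFin β x * Fintype.card β ^ l.length + wordCode l

theorem wordCode_append (p r : List β) :
    wordCode (p ++ r) = wordCode p * Fintype.card β ^ r.length + wordCode r := by
  induction p with
  | nil => simp [wordCode]
  | cons x p ih => simp only [List.cons_append, wordCode, ih, List.length_append]; ring

theorem wordCode_lt (l : List β) : wordCode l < Fintype.card β ^ l.length := by
  induction l with
  | nil => simp [wordCode]
  | cons x l ih =>
    have := (Fintype.equivFin β x).2
    simp only [wordCode, List.length_cons, pow_succ']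
    calc _ < (Fintype.equivFin β x : ℕ) * Fintype.card β ^ l.length
            + Fintype.card β ^ l.length := by omega
      _ = ((Fintype.equivFin β x : ℕ) + 1) * Fintype.card β ^ l.length := by ring
      _ ≤ _ := Nat.mul_le_mul_right _ this

theorem wordCode_injective {l l' : List β} (hl : l.length = l'.length)
    (h : wordCode l = wordCode l') : l = l' := by
  induction l generalizing l' with
  | nil => exact (List.length_eq_zero_iff.1 hl.symm).symm
  | cons x l ih =>
    cases l' with
    | nil => simp at hl
    | cons y l' =>
      have hl' : l.length = l'.length := by simpa using hl
      have h1 := wordCode_lt l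
      have h2 := wordCode_lt l'
      simp only [wordCode, hl'] at h h1
      have hx : (Fintype.equivFin β x : ℕ) = Fintype.equivFin β y := by
        have e1 := Nat.add_mul_div_right (wordCode l) (Fintype.equivFin β x)
          (lt_of_le_of_lt (Nat.zero_le _) h1)
        have e2 := Nat.add_mul_div_right (wordCode l') (Fintype.equivFin β y)
          (lt_of_le_of_lt (Nat.zero_le _) h1)
        rw [Nat.div_eq_of_lt h1, zero_add] at e1
        rw [Nat.div_eq_of_lt h2, zero_add] at e2
        rw [← e1, ← e2, add_comm, h, add_comm]
      have hxy : x = y := (Fintype.equivFin β).injective (Fin.ext hx)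
      subst hxy
      rw [ih hl' (by omega)]

end Code

end AutFree


namespace AutFree

/-! ### Nielsen reduced families -/

section NielsenReduced

variable {α : Type*} [DecidableEq α]

open FreeGroup (of invRev IsReduced mk)

/-- The inverse of a letter. -/
def flipLetter (s : α × Bool) : α × Bool := (s.1, !s.2)

theorem flipLetter_flipLetter (s : α × Bool) : flipLetter (flipLetter s) = s := by
  simp [flipLetter]

theorem ne_flipLetter_iff {s t : α × Bool} :
    t ≠ flipLetter s ↔ (s.1 = t.1 → s.2 = t.2) := by
  rcases s with ⟨i, a⟩
  rcases t with ⟨j, b⟩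
  cases a <;> cases b <;> simp [flipLetter, eq_comm]

theorem mk_flipLetter (s : α × Bool) : mk [flipLetter s] = (mk [s])⁻¹ := by
  rw [FreeGroup.inv_mk]; rfl

/-- A family of group elements indexed by the letters is Nielsen reduced. -/
structure NielsenReduced (Y : α × Bool → FreeGroup α) : Prop where
  inv : ∀ s, Y (flipLetter s) = (Y s)⁻¹
  ne_one : ∀ s, Y s ≠ 1
  le : ∀ s t, t ≠ flipLetter s → gromov (Y s)⁻¹ (Y t) ≤ FreeGroup.norm (Y t)
  not_both : ∀ s t u, t ≠ flipLetter s → u ≠ flipLetter t →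
    ¬ (gromov (Y s)⁻¹ (Y t) = FreeGroup.norm (Y t) ∧
      gromov (Y t)⁻¹ (Y u) = FreeGroup.norm (Y t))

theorem NielsenReduced.le_left {Y : α × Bool → FreeGroup α} (h : NielsenReduced Y)
    (s t : α × Bool) (hst : t ≠ flipLetter s) :
    gromov (Y s)⁻¹ (Y t) ≤ FreeGroup.norm (Y s) := by
  have := h.le (flipLetter t) (flipLetter s) (by
    rw [flipLetter_flipLetter]; exact fun h' => hst h'.symm)
  rwa [h.inv, h.inv, inv_inv, gromov_comm, FreeGroup.norm_inv_eq] at this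

/-- Twice the cancellation in `Y r * Y t` is `gromov (Y r)⁻¹ (Y t)`. The conditions `le` and
`not_both` say that the two neighbours of a factor never consume it entirely. So what cancels on the
left of a reduced product depends only on its first factor, and lengths can be computed one factor
at a time. The bound two shows that an element of length one is a single member of the family. -/
theorem NielsenReduced.prod_aux {Y : α × Bool → FreeGroup α} (h : NielsenReduced Y)
    (l : List (α × Bool)) (t : α × Bool) (hl : IsReduced (t :: l)) :
    (∀ r, t ≠ flipLetter r →
      gromov (Y r)⁻¹ ((t :: l).map Y).prod = gromov (Y r)⁻¹ (Y t)) ∧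
    (l = [] ∨ 2 ≤ FreeGroup.norm ((t :: l).map Y).prod) := by
  induction l generalizing t with
  | nil => simp
  | cons s l ih =>
    rw [FreeGroup.isReduced_cons_cons] at hl
    obtain ⟨hts, hl⟩ := hl
    rw [← ne_flipLetter_iff] at hts
    obtain ⟨ih1, ih2⟩ := ih s hl
    set W' := ((s :: l).map Y).prod with hW'
    have hW : ((t :: s :: l).map Y).prod = Y t * W' := by simp [hW']
    rw [hW]
    have e1 := ih1 t hts
    have e2 : (FreeGroup.norm (Y t * W') : ℤ) =
        FreeGroup.norm (Y t) + FreeGroup.norm W' - gromov (Y t)⁻¹ (Y s) := by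
      rw [← e1, gromov, inv_inv, FreeGroup.norm_inv_eq]; ring
    have e3 : gromov (Y t * W') (Y t) = 2 * FreeGroup.norm (Y t) - gromov (Y t)⁻¹ (Y s) := by
      rw [gromov, e2, mul_inv_rev, inv_mul_cancel_right, FreeGroup.norm_inv_eq]; ring
    have a1 := h.le_left t s hts
    have a2 := h.le t s hts
    constructor
    · intro r hr
      rw [gromov_comm, gromov_comm _ (Y t)]
      have b1 := h.le r t hr
      have b2 := h.not_both r t s hr hts
      -- The product shares with `Y t` everything not cancelled by `W'`. Strictness is exactly the
      -- exclusion of both halves being cancelled.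
      have : gromov (Y r)⁻¹ (Y t) < gromov (Y t) (Y t * W') := by
        rw [gromov_comm (Y t), e3]
        by_contra hcon
        exact b2 ⟨by linarith, by linarith⟩
      rw [gromov_comm, gromov_comm (Y t)]
      exact gromov_eq_of_lt this
    · right
      rcases ih2 with rfl | ih2
      -- Parity matters here: `gromov` is even, so if it is not zero then it is at least two, and
      -- the length of `Y t * Y s` is at least that value.
      · obtain ⟨p, -, -, -, -, -, hp⟩ := exists_common_prefix (Y t)⁻¹ (Y s)
        have n1 : FreeGroup.norm (Y t) ≠ 0 := by simpa using h.ne_one t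
        have n2 : FreeGroup.norm (Y s) ≠ 0 := by simpa using h.ne_one s
        have : W' = Y s := by simp [hW']
        rw [this] at e2 ⊢
        omega
      · omega

theorem NielsenReduced.eq_singleton {Y : α × Bool → FreeGroup α} (h : NielsenReduced Y)
    {l : List (α × Bool)} (hl : IsReduced l) (h1 : FreeGroup.norm (l.map Y).prod = 1) :
    ∃ t, l = [t] := by
  cases l with
  | nil => simp at h1
  | cons t l =>
    rcases (h.prod_aux l t hl).2 with rfl | h2
    · exact ⟨t, rfl⟩
    · omega

end NielsenReduced

/-! ### Nielsen's theorem by minimal complexity -/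

section Minimal

variable {α : Type*} [DecidableEq α]

open FreeGroup (of invRev IsReduced mk)

theorem mk_true (i : α) : mk [(i, true)] = of i := rfl

theorem mk_false (i : α) : mk [(i, false)] = (of i)⁻¹ := by
  rw [FreeGroup.of, FreeGroup.inv_mk]; rfl

theorem mk_singleton_mem_away {s : α × Bool} {i : α} (h : s.1 ≠ i) : mk [s] ∈ away i := by
  rcases s with ⟨j, _ | _⟩
  · rw [mk_false]; exact inv_mem (of_mem_away h)
  · exact of_mem_away h

theorem transv_mk_right_mem {i : α} {t : α × Bool} (h : i ≠ t.1) :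
    transv i 1 (mk [t]) ∈ nielsenSubgroup α := by
  rcases t with ⟨j, _ | _⟩
  · rw [mk_false]
    have := inv_mem (nielsen_mem h)
    rwa [nielsen_inv (Ne.symm h)] at this
  · exact nielsen_mem h

theorem inversion_away {i : α} {w : FreeGroup α} (hw : w ∈ away i) : inversion i w = w :=
  hom_ext_away (f := (inversion i).toMonoidHom) (g := MonoidHom.id _)
    (fun _ h => inversion_of_ne h) hw

theorem inversion_conj_transv {i : α} {u v : FreeGroup α} (hu : u ∈ away i) (hv : v ∈ away i) :
    inversion i * transv i u v * inversion i = transv i v⁻¹ u⁻¹ := by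
  apply mulAut_ext
  intro b
  by_cases h : b = i
  · subst h
    simp [inversion_self, transv_self, inversion_away, hu, hv, mul_assoc]
  · simp [inversion_of_ne h, transv_of_ne h]

/-- Multiplying one letter by another on the left is a Nielsen automorphism. -/
theorem exists_nielsen_move {s t : α × Bool} (h : s.1 ≠ t.1) : ∃ ν ∈ nielsenSubgroup α,
    ν (mk [s]) = mk [t] * mk [s] ∧ ∀ k ≠ s.1, ν (of k) = of k := by
  have ht : mk [t] ∈ away s.1 := mk_singleton_mem_away h.symm
  have ht' : mk [flipLetter t] ∈ away s.1 := mk_singleton_mem_away h.symm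
  have hm : transv s.1 1 (mk [flipLetter t]) ∈ nielsenSubgroup α := transv_mk_right_mem h
  rcases s with ⟨i, _ | _⟩
  · refine ⟨_, hm, ?_, fun k hk => transv_of_ne hk _ _⟩
    rw [mk_false, map_inv, transv_self (one_mem _) ht', mk_flipLetter]
    simp
  · refine ⟨_, mul_mem (mul_mem (inversion_mem i) hm) (inversion_mem i), ?_, fun k hk => ?_⟩
    · rw [inversion_conj_transv (one_mem _) ht', mk_flipLetter, inv_inv, inv_one, mk_true,
        transv_self ht (one_mem _), mul_one]
    · rw [inversion_conj_transv (one_mem _) ht', transv_of_ne hk]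

variable [Fintype α]

/-- The code of the initial half of a word and of its inverse. -/
noncomputable def halfCode (y : FreeGroup α) : ℕ :=
  wordCode (y.toWord.take ((FreeGroup.norm y + 1) / 2)) +
    wordCode (y⁻¹.toWord.take ((FreeGroup.norm y + 1) / 2))

theorem halfCode_inv (y : FreeGroup α) : halfCode y⁻¹ = halfCode y := by
  rw [halfCode, halfCode, FreeGroup.norm_inv_eq, inv_inv, add_comm]

/-- The complexity of a basis of the free group. -/
noncomputable def complexity (φ : MulAut (FreeGroup α)) : ℕ ×ₗ ℕ :=
  toLex (∑ i, FreeGroup.norm (φ (of i)), ∑ i, halfCode (φ (of i)))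

/-- A Nielsen move changes one basis element only, and `f` does not see whether the letter `s`
carries an inverse. The identity is written additively to avoid subtraction in `ℕ`. -/
theorem sum_move (f : FreeGroup α → ℕ) (hf : ∀ y, f y⁻¹ = f y) (φ ν : MulAut (FreeGroup α))
    {s t : α × Bool} (h1 : ν (mk [s]) = mk [t] * mk [s]) (h2 : ∀ k ≠ s.1, ν (of k) = of k) :
    ∑ i, f ((φ * ν) (of i)) + f (φ (mk [s])) =
      ∑ i, f (φ (of i)) + f (φ (mk [t]) * φ (mk [s])) := by
  have hs : ∀ ψ : MulAut (FreeGroup α), f (ψ (mk [s])) = f (ψ (of s.1)) := by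
    intro ψ
    rcases s with ⟨i, _ | _⟩
    · rw [mk_false, map_inv, hf]
    · rfl
  rw [← Finset.add_sum_erase _ _ (Finset.mem_univ s.1),
    ← Finset.add_sum_erase _ (fun i => f (φ (of i))) (Finset.mem_univ s.1)]
  have e : ∑ x ∈ Finset.univ.erase s.1, f ((φ * ν) (of x)) =
      ∑ x ∈ Finset.univ.erase s.1, f (φ (of x)) := by
    refine Finset.sum_congr rfl fun x hx => ?_
    rw [MulAut.mul_apply, h2 x (Finset.ne_of_mem_erase hx)]
  rw [e, ← hs, ← hs, MulAut.mul_apply, h1, map_mul]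
  ring

theorem minimal_move {φ : MulAut (FreeGroup α)}
    (hφ : ∀ ν ∈ nielsenSubgroup α, ¬ complexity (φ * ν) < complexity φ) {s t : α × Bool}
    (h : s.1 ≠ t.1) :
    FreeGroup.norm (φ (mk [s])) ≤ FreeGroup.norm (φ (mk [t]) * φ (mk [s])) ∧
    (FreeGroup.norm (φ (mk [s])) = FreeGroup.norm (φ (mk [t]) * φ (mk [s])) →
      halfCode (φ (mk [s])) ≤ halfCode (φ (mk [t]) * φ (mk [s]))) := by
  obtain ⟨ν, hν, h1, h2⟩ := exists_nielsen_move h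
  have := hφ ν hν
  have e1 := sum_move FreeGroup.norm (fun _ => FreeGroup.norm_inv_eq) φ ν h1 h2
  have e2 := sum_move halfCode halfCode_inv φ ν h1 h2
  rw [complexity, complexity, Prod.Lex.toLex_lt_toLex] at this
  simp only [not_or, not_and, not_lt] at this
  refine ⟨by omega, fun h => ?_⟩
  have h3 := this.2 (by omega)
  omega

/-- Multiplying `q r` on the left by `p q⁻¹` replaces the initial segment `q` by `p`. Minimality of
the length prevents cancellation in `p r`, so the total length is unchanged, and minimality of the
second component of the complexity then compares `q` with `p`. -/
theorem minimal_code_le {φ : MulAut (FreeGroup α)}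
    (hφ : ∀ ν ∈ nielsenSubgroup α, ¬ complexity (φ * ν) < complexity φ) {t u : α × Bool}
    (h : u.1 ≠ t.1) {p q r : List (α × Bool)} (ht : (φ (mk [t])).toWord = p ++ invRev q)
    (hpq : p.length = q.length) (hu : (φ (mk [u])).toWord = q ++ r)
    (hq : 2 * q.length ≤ FreeGroup.norm (φ (mk [u]))) : wordCode q ≤ wordCode p := by
  obtain ⟨h1, h2⟩ := minimal_move hφ h
  set y := φ (mk [u])
  have hy : FreeGroup.norm y = q.length + r.length := by rw [FreeGroup.norm, hu]; simp
  have e : φ (mk [t]) * y = mk (p ++ r) := by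
    rw [← FreeGroup.mk_toWord (x := φ (mk [t])), ← FreeGroup.mk_toWord (x := y), ht, hu,
      ← FreeGroup.mul_mk, ← FreeGroup.mul_mk, ← FreeGroup.mul_mk, ← FreeGroup.inv_mk]
    group
  have hz : (φ (mk [t]) * y).toWord = p ++ r := by
    rw [e, FreeGroup.toWord_mk]
    have hs : (FreeGroup.reduce (p ++ r)).Sublist (p ++ r) := FreeGroup.reduce.red.sublist
    apply hs.eq_of_length_le
    have h3 : FreeGroup.norm (φ (mk [t]) * y) = (FreeGroup.reduce (p ++ r)).length := by
      rw [e, FreeGroup.norm, FreeGroup.toWord_mk]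
    rw [List.length_append]
    omega
  have hn : FreeGroup.norm (φ (mk [t]) * y) = FreeGroup.norm y := by
    rw [FreeGroup.norm, hz, List.length_append, hy, hpq]
  have h3 := h2 hn.symm
  rw [halfCode, halfCode, FreeGroup.toWord_inv, FreeGroup.toWord_inv, hn, hz, hu,
    FreeGroup.invRev_append, FreeGroup.invRev_append] at h3
  -- Since `q` fills at most half of the word, the initial half contains all of `q`, while the half
  -- read from the other end lies within `r` and is unaffected by the move.
  generalize hm : (FreeGroup.norm y + 1) / 2 = m at h3
  have hm1 : q.length ≤ m := by omega
  have hm2 : m ≤ r.length := by omega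
  rw [List.take_append_of_le_length (l₁ := invRev r) (by simpa using hm2),
    List.take_append_of_le_length (l₁ := invRev r) (by simpa using hm2), List.take_append, List.take_append,
    List.take_of_length_le hm1, List.take_of_length_le (hpq.trans_le hm1), hpq,
    wordCode_append, wordCode_append] at h3
  by_contra hcon
  push Not at hcon
  have : Nonempty (α × Bool) := ⟨u⟩
  have hB : 0 < Fintype.card (α × Bool) ^ (List.take (m - q.length) r).length :=
    pow_pos Fintype.card_pos _
  have := Nat.mul_lt_mul_of_pos_right hcon hB
  omega

/-- Length minimality bounds each cancellation by one half. If both halves of a member `p q⁻¹` were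
cancelled, moves on its two sides would give `wordCode q ≤ wordCode p` and the reverse inequality,
whence `p = q` and the member would be trivial. -/
theorem nielsenReduced_of_minimal {φ : MulAut (FreeGroup α)}
    (hφ : ∀ ν ∈ nielsenSubgroup α, ¬ complexity (φ * ν) < complexity φ) :
    NielsenReduced fun s : α × Bool => φ (mk [s]) := by
  have hinv : ∀ s, φ (mk [flipLetter s]) = (φ (mk [s]))⁻¹ := fun s => by
    rw [mk_flipLetter, map_inv]
  have hne : ∀ s : α × Bool, φ (mk [s]) ≠ 1 := by
    intro s hs
    rw [map_eq_one_iff φ φ.injective] at hs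
    rcases s with ⟨i, _ | _⟩
    · rw [mk_false, inv_eq_one] at hs; exact FreeGroup.of_ne_one _ hs
    · exact FreeGroup.of_ne_one _ hs
  have hfst : ∀ s t : α × Bool, t ≠ flipLetter s → s.1 = t.1 → s = t := fun s t h h' =>
    Prod.ext h' (ne_flipLetter_iff.1 h h')
  have hle : ∀ s t, t ≠ flipLetter s →
      gromov (φ (mk [s]))⁻¹ (φ (mk [t])) ≤ FreeGroup.norm (φ (mk [t])) := by
    intro s t hst
    by_cases h : s.1 = t.1
    · obtain rfl := hfst s t hst h
      exact (gromov_self_inv_lt (hne s)).le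
    · have := (minimal_move hφ (s := flipLetter s) (t := flipLetter t) h).1
      rw [hinv, hinv, FreeGroup.norm_inv_eq, ← mul_inv_rev, FreeGroup.norm_inv_eq] at this
      rw [gromov, inv_inv, FreeGroup.norm_inv_eq]
      omega
  refine ⟨hinv, hne, hle, ?_⟩
  rintro s t u hst htu ⟨h1, h2⟩
  by_cases hst' : s.1 = t.1
  · obtain rfl := hfst s t hst hst'
    exact (gromov_self_inv_lt (hne s)).ne h1
  by_cases htu' : t.1 = u.1
  · obtain rfl := hfst t u htu htu'
    exact (gromov_self_inv_lt (hne t)).ne h2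
  have hu := hle t u htu
  have hs := hle (flipLetter t) (flipLetter s) (by
    rw [flipLetter_flipLetter]; exact fun h' => hst h'.symm)
  simp only [hinv, inv_inv, FreeGroup.norm_inv_eq] at hs
  obtain ⟨q, a, r, hq1, hq2, -, hq3⟩ := exists_common_prefix (φ (mk [t]))⁻¹ (φ (mk [u]))
  obtain ⟨p, b, r', hp1, hp2, -, hp3⟩ := exists_common_prefix (φ (mk [t])) (φ (mk [s]))⁻¹
  rw [gromov_comm] at h1
  have ht : (φ (mk [t])).toWord = invRev a ++ invRev q := by
    rw [← FreeGroup.invRev_append, ← hq1, FreeGroup.toWord_inv, FreeGroup.invRev_invRev]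
  have hl1 : FreeGroup.norm (φ (mk [t])) = a.length + q.length := by
    rw [FreeGroup.norm, ht]; simp
  have hl2 : FreeGroup.norm (φ (mk [t])) = p.length + b.length := by
    rw [FreeGroup.norm, hp1]; simp
  obtain ⟨rfl, rfl⟩ := List.append_inj (hp1.symm.trans ht) (by simp; omega)
  simp only [FreeGroup.invRev_length] at *
  have c1 := minimal_code_le hφ (t := t) (u := u) (Ne.symm htu') (p := invRev a) ht
    (by simp; omega) hq2 (by omega)
  have c2 := minimal_code_le hφ (t := flipLetter t) (u := flipLetter s) hst' (p := q)
    (q := invRev a) (by rw [hinv, hq1, FreeGroup.invRev_invRev]) (by simp; omega)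
    (by rw [hinv]; exact hp2) (by rw [hinv, FreeGroup.norm_inv_eq]; simp; omega)
  have hpq := wordCode_injective (by simp; omega) (le_antisymm c1 c2)
  apply hne t
  rw [← FreeGroup.mk_toWord (x := φ (mk [t])), ht, ← FreeGroup.mul_mk, ← hpq,
    ← FreeGroup.inv_mk, mul_inv_cancel]

theorem mem_of_signed (ψ : MulAut (FreeGroup α))
    (h : ∀ i, ψ (of i) = of i ∨ ψ (of i) = (of i)⁻¹) : ψ ∈ nielsenSubgroup α := by
  classical
  induction hn : (Finset.univ.filter fun i => ψ (of i) ≠ of i).card generalizing ψ with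
  | zero =>
    rw [Finset.card_eq_zero, Finset.filter_eq_empty_iff] at hn
    have : ψ = 1 := mulAut_ext fun i => by simpa using hn (Finset.mem_univ i)
    rw [this]; exact one_mem _
  | succ n ih =>
    obtain ⟨i, hi⟩ := Finset.card_pos.1 (hn ▸ Nat.succ_pos n :
      0 < (Finset.univ.filter fun i => ψ (of i) ≠ of i).card)
    have hi' : ψ (of i) ≠ of i := by simpa using hi
    have hi2 := (h i).resolve_left hi'
    have key : (Finset.univ.filter fun j => (ψ * inversion i) (of j) ≠ of j) =
        (Finset.univ.filter fun j => ψ (of j) ≠ of j).erase i := by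
      ext j
      simp only [Finset.mem_filter, Finset.mem_univ, true_and, Finset.mem_erase]
      by_cases hj : j = i
      · subst hj; simp [inversion_self, hi2]
      · simp [inversion_of_ne hj, hj]
    have := ih (ψ * inversion i) (fun j => by
      by_cases hj : j = i
      · subst hj; simp [inversion_self, hi2]
      · simpa [inversion_of_ne hj] using h j) (by
        rw [key, Finset.card_erase_of_mem hi, hn]; rfl)
    have h3 := mul_mem this (inversion_mem i)
    rwa [mul_assoc, inversion_mul_self, mul_one] at h3

/-- **Nielsen's theorem**: the automorphism group of a free group of finite rank is generated by
the elementary Nielsen automorphisms. -/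
theorem nielsenSubgroup_eq_top : nielsenSubgroup α = ⊤ := by
  rw [eq_top_iff]
  rintro φ₀ -
  -- The lexicographic order on `ℕ ×ₗ ℕ` is a well-order, so the coset of `φ₀` contains a basis of
  -- least complexity.
  obtain ⟨ν₀, hν₀, hmin⟩ : ∃ ν₀ ∈ nielsenSubgroup α, ∀ ν ∈ nielsenSubgroup α,
      ¬ complexity (φ₀ * ν) < complexity (φ₀ * ν₀) := by
    obtain ⟨x, ⟨ν₀, hν₀, rfl⟩, hx⟩ := WellFounded.has_min
      (wellFounded_lt (α := ℕ ×ₗ ℕ)) ((fun ν => complexity (φ₀ * ν)) '' (nielsenSubgroup α))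
      ⟨_, 1, one_mem _, rfl⟩
    exact ⟨ν₀, hν₀, fun ν hν => hx _ ⟨ν, hν, rfl⟩⟩
  set φ := φ₀ * ν₀ with hφ
  have hmin' : ∀ ν ∈ nielsenSubgroup α, ¬ complexity (φ * ν) < complexity φ := fun ν hν => by
    rw [hφ, mul_assoc]; exact hmin _ (mul_mem hν₀ hν)
  have hN := nielsenReduced_of_minimal hmin'
  suffices hs : φ⁻¹ ∈ nielsenSubgroup α by
    have := mul_mem (inv_mem hs) (inv_mem hν₀)
    rwa [inv_inv, hφ, mul_inv_cancel_right] at this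
  have hprod : ∀ l : List (α × Bool), (l.map fun s => φ (mk [s])).prod = φ (mk l) := by
    intro l
    induction l with
    | nil => simp [← FreeGroup.one_eq_mk]
    | cons s l ih => rw [List.map_cons, List.prod_cons, ih, ← map_mul, FreeGroup.mul_mk]; rfl
  -- Written in the reduced basis, the letter `k` is a product of length one, hence a single basis
  -- element or its inverse. The automorphism is therefore a signed permutation.
  have key : ∀ k, ∃ t : α × Bool, φ⁻¹ (of k) = mk [t] := by
    intro k
    have h1 : FreeGroup.norm (((φ⁻¹ (of k)).toWord.map fun s => φ (mk [s])).prod) = 1 := by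
      rw [hprod, FreeGroup.mk_toWord, MulAut.apply_inv_self, FreeGroup.norm_of]
    obtain ⟨t, ht⟩ := hN.eq_singleton FreeGroup.isReduced_toWord h1
    exact ⟨t, by rw [← ht, FreeGroup.mk_toWord]⟩
  choose t ht using key
  have hinj : Function.Injective fun k => (t k).1 := by
    intro k l hkl
    have h2 : φ⁻¹ (of k) = φ⁻¹ (of l) ∨ φ⁻¹ (of k) = φ⁻¹ (of l)⁻¹ := by
      rw [map_inv, ht, ht]
      by_cases hf : t l = flipLetter (t k)
      · right; rw [hf, mk_flipLetter, inv_inv]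
      · left; rw [Prod.ext hkl (ne_flipLetter_iff.1 hf hkl)]
    rcases h2 with h2 | h2
    · exact FreeGroup.of_injective (φ⁻¹.injective h2)
    · have h3 := φ⁻¹.injective h2
      rw [← mk_false] at h3
      have := congrArg FreeGroup.toWord h3
      rw [FreeGroup.toWord_of, FreeGroup.toWord_mk, FreeGroup.reduce_singleton] at this
      simp at this
  let σ : Equiv.Perm α := Equiv.ofBijective _ (Finite.injective_iff_bijective.1 hinj)
  have hσ : ∀ k, σ k = (t k).1 := fun k => rfl
  have h4 : (permAut σ)⁻¹ * φ⁻¹ ∈ nielsenSubgroup α := by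
    apply mem_of_signed
    intro i
    rw [MulAut.mul_apply, ht, ← map_inv]
    have e : permAut σ⁻¹ (of (t i).1) = of i := by
      rw [permAut_of, ← hσ]; exact congrArg of (σ.symm_apply_apply i)
    rcases h5 : t i with ⟨j, _ | _⟩
    · rw [h5] at e
      right; rw [mk_false, map_inv, e]
    · rw [h5] at e
      left; exact e
  have := mul_mem (permAut_mem σ) h4
  rwa [mul_inv_cancel_left] at this

end Minimal

end AutFree


namespace AutFree

/-! ### Magnus's generators and the normality of their span -/

section Magnus

variable {α : Type*} [DecidableEq α]

open FreeGroup (of)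
open scoped commutatorElement

/-- The partial conjugation `x_a ↦ u⁻¹ x_a u`. -/
noncomputable def partialConj (a : α) (u : FreeGroup α) : MulAut (FreeGroup α) := transv a u⁻¹ u

/-- The right multiplication `x_a ↦ x_a w`. -/
noncomputable def rightMul (a : α) (w : FreeGroup α) : MulAut (FreeGroup α) := transv a 1 w

theorem partialConj_mul {a : α} {u v : FreeGroup α} (hu : u ∈ away a) (hv : v ∈ away a) :
    partialConj a (u * v) = partialConj a u * partialConj a v := by
  rw [partialConj, partialConj, partialConj, transv_mul (inv_mem hu) hu (inv_mem hv) hv,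
    mul_inv_rev]

theorem partialConj_inv {a : α} {u : FreeGroup α} (hu : u ∈ away a) :
    partialConj a u⁻¹ = (partialConj a u)⁻¹ := by
  rw [partialConj, partialConj, transv_inv (inv_mem hu) hu]

theorem rightMul_mul {a : α} {u v : FreeGroup α} (hu : u ∈ away a) (hv : v ∈ away a) :
    rightMul a (u * v) = rightMul a u * rightMul a v := by
  rw [rightMul, rightMul, rightMul, transv_mul (one_mem _) hu (one_mem _) hv, mul_one]

theorem rightMul_inv {a : α} {u : FreeGroup α} (hu : u ∈ away a) :
    rightMul a u⁻¹ = (rightMul a u)⁻¹ := by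
  rw [rightMul, rightMul, transv_inv (one_mem _) hu, inv_one]

theorem partialConj_conj_rightMul {a : α} {u w : FreeGroup α} (hu : u ∈ away a)
    (hw : w ∈ away a) :
    rightMul a (u * w * u⁻¹) = partialConj a u * rightMul a w * (partialConj a u)⁻¹ := by
  rw [partialConj, rightMul, rightMul, transv_inv (inv_mem hu) hu,
    transv_mul (inv_mem hu) hu (one_mem _) hw,
    transv_mul (mul_mem (one_mem _) (inv_mem hu)) (mul_mem hu hw) (inv_mem (inv_mem hu))
      (inv_mem hu)]
  congr 1
  group

theorem partialConj_self {a : α} {u : FreeGroup α} (hu : u ∈ away a) :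
    partialConj a u (of a) = u⁻¹ * of a * u := transv_self (inv_mem hu) hu

theorem partialConj_of_ne {a b : α} (h : b ≠ a) (u : FreeGroup α) :
    partialConj a u (of b) = of b := transv_of_ne h _ _

theorem rightMul_self {a : α} {u : FreeGroup α} (hu : u ∈ away a) :
    rightMul a u (of a) = of a * u := by
  rw [rightMul, transv_self (one_mem _) hu, one_mul]

theorem rightMul_of_ne {a b : α} (h : b ≠ a) (u : FreeGroup α) :
    rightMul a u (of b) = of b := transv_of_ne h _ _

theorem rightMul_away {a : α} (u : FreeGroup α) {w : FreeGroup α} (hw : w ∈ away a) :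
    rightMul a u w = w := transv_away _ _ hw

/-- Magnus's generators of the Torelli subgroup. -/
def magnusGens (α : Type*) [DecidableEq α] : Set (MulAut (FreeGroup α)) :=
  {φ | ∃ a b, b ≠ a ∧ φ = partialConj a (of b)} ∪
    {φ | ∃ a b c, b ≠ a ∧ c ≠ a ∧ b ≠ c ∧ φ = rightMul a ⁅of b, of c⁆}

/-- The subgroup generated by Magnus's generators. -/
def magnusSubgroup (α : Type*) [DecidableEq α] : Subgroup (MulAut (FreeGroup α)) :=
  Subgroup.closure (magnusGens α)

theorem commutator_mem_away {a : α} {u v : FreeGroup α} (hu : u ∈ away a) (hv : v ∈ away a) :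
    ⁅u, v⁆ ∈ away a :=
  mul_mem (mul_mem (mul_mem hu hv) (inv_mem hu)) (inv_mem hv)

theorem partialConj_mem {a : α} {u : FreeGroup α} (hu : u ∈ away a) :
    partialConj a u ∈ magnusSubgroup α := by
  induction hu using Subgroup.closure_induction with
  | mem x hx =>
    obtain ⟨b, hb, rfl⟩ := hx
    exact Subgroup.subset_closure (Or.inl ⟨a, b, hb, rfl⟩)
  | one => rw [partialConj, inv_one, transv_one_one]; exact one_mem _
  | mul x y hx hy h1 h2 => rw [partialConj_mul hx hy]; exact mul_mem h1 h2
  | inv x hx h => rw [partialConj_inv hx]; exact inv_mem h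

/-- The identity ⁅xy, v⁆ = x⁅y, v⁆x⁻¹⁅x, v⁆ reduces the first slot to letters. The conjugating
factor `x` costs nothing, because conjugating the word in `rightMul` is the same as conjugating by a
partial conjugation. -/
theorem rightMul_commutator_mem_of_left {a : α} {v : FreeGroup α} (hv : v ∈ away a)
    (h : ∀ b ≠ a, rightMul a ⁅of b, v⁆ ∈ magnusSubgroup α) {u : FreeGroup α}
    (hu : u ∈ away a) : rightMul a ⁅u, v⁆ ∈ magnusSubgroup α := by
  have hconj : ∀ u w : FreeGroup α, u ∈ away a → w ∈ away a →
      rightMul a w ∈ magnusSubgroup α → rightMul a (u * w * u⁻¹) ∈ magnusSubgroup α := by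
    intro u w hu hw hm
    rw [partialConj_conj_rightMul hu hw]
    exact mul_mem (mul_mem (partialConj_mem hu) hm) (inv_mem (partialConj_mem hu))
  induction hu using Subgroup.closure_induction with
  | mem x hx => obtain ⟨b, hb, rfl⟩ := hx; exact h b hb
  | one => rw [commutatorElement_one_left, rightMul, transv_one_one]; exact one_mem _
  | mul x y hx hy h1 h2 =>
    have e : ⁅x * y, v⁆ = x * ⁅y, v⁆ * x⁻¹ * ⁅x, v⁆ := by
      simp only [commutatorElement_def]; group
    have hy' := commutator_mem_away hy hv
    rw [e, rightMul_mul (mul_mem (mul_mem hx hy') (inv_mem hx)) (commutator_mem_away hx hv)]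
    exact mul_mem (hconj x _ hx hy' h2) h1
  | inv x hx h1 =>
    have e : ⁅x⁻¹, v⁆ = x⁻¹ * ⁅x, v⁆⁻¹ * x⁻¹⁻¹ := by
      simp only [commutatorElement_def]; group
    have hx' := commutator_mem_away hx hv
    rw [e]
    refine hconj _ _ (inv_mem hx) (inv_mem hx') ?_
    rw [rightMul_inv hx']
    exact inv_mem h1

theorem rightMul_commutator_mem {a : α} {u v : FreeGroup α} (hu : u ∈ away a)
    (hv : v ∈ away a) : rightMul a ⁅u, v⁆ ∈ magnusSubgroup α := by
  have hsymm : ∀ u v : FreeGroup α, u ∈ away a → v ∈ away a →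
      rightMul a ⁅u, v⁆ ∈ magnusSubgroup α → rightMul a ⁅v, u⁆ ∈ magnusSubgroup α := by
    intro u v hu hv h
    rw [← commutatorElement_inv, rightMul_inv (commutator_mem_away hu hv)]
    exact inv_mem h
  refine rightMul_commutator_mem_of_left hv (fun b hb => ?_) hu
  refine hsymm _ _ hv (of_mem_away hb) ?_
  refine rightMul_commutator_mem_of_left (of_mem_away hb) (fun c hc => ?_) hv
  by_cases hbc : c = b
  · rw [hbc, commutatorElement_self, rightMul, transv_one_one]; exact one_mem _
  · exact Subgroup.subset_closure (Or.inr ⟨a, c, b, hc, hb, hbc, rfl⟩)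

theorem conj_transv {a : α} {φ : MulAut (FreeGroup α)} (h : φ (of a) = of a)
    (h' : ∀ w ∈ away a, φ w ∈ away a) {u v : FreeGroup α} (hu : u ∈ away a) (hv : v ∈ away a) :
    φ * transv a u v = transv a (φ u) (φ v) * φ := by
  apply mulAut_ext
  intro b
  by_cases hb : b = a
  · subst hb
    simp [transv_self hu hv, h, transv_self (h' u hu) (h' v hv)]
  · simp only [MulAut.mul_apply, transv_of_ne hb]
    rw [transv_away _ _ (h' _ (of_mem_away hb))]

theorem map_mem_away {a : α} {φ : MulAut (FreeGroup α)} (h : ∀ b ≠ a, φ (of b) ∈ away a) :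
    ∀ w ∈ away a, φ w ∈ away a := by
  intro w hw
  induction hw using Subgroup.closure_induction with
  | mem x hx => obtain ⟨b, hb, rfl⟩ := hx; exact h b hb
  | one => rw [map_one]; exact one_mem _
  | mul x y _ _ hx hy => rw [map_mul]; exact mul_mem hx hy
  | inv x _ hx => rw [map_inv]; exact inv_mem hx

theorem inversion_map_away {a i : α} : ∀ w ∈ away a, inversion i w ∈ away a := by
  refine map_mem_away fun b hb => ?_
  by_cases h : b = i
  · subst h; rw [inversion_self]; exact inv_mem (of_mem_away hb)
  · rw [inversion_of_ne h]; exact of_mem_away hb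

theorem nielsen_map_away {a i j : α} (hij : j ≠ i) (hj : j ≠ a) :
    ∀ w ∈ away a, nielsen i j w ∈ away a := by
  refine map_mem_away fun b hb => ?_
  by_cases h : b = i
  · subst h; rw [nielsen_self hij]; exact mul_mem (of_mem_away hb) (of_mem_away hj)
  · rw [nielsen_of_ne _ h]; exact of_mem_away hb

theorem nielsen_mul_partialConj {a i j : α} (hij : j ≠ i) (hi : a ≠ i) (hj : j ≠ a)
    {u : FreeGroup α} (hu : u ∈ away a) :
    nielsen i j * partialConj a u = partialConj a (nielsen i j u) * nielsen i j := by
  rw [partialConj, conj_transv (nielsen_of_ne _ hi) (nielsen_map_away hij hj) (inv_mem hu) hu,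
    map_inv]; rfl

theorem nielsen_mul_rightMul {a i j : α} (hij : j ≠ i) (hi : a ≠ i) (hj : j ≠ a)
    {u : FreeGroup α} (hu : u ∈ away a) :
    nielsen i j * rightMul a u = rightMul a (nielsen i j u) * nielsen i j := by
  rw [rightMul, conj_transv (nielsen_of_ne _ hi) (nielsen_map_away hij hj) (one_mem _) hu,
    map_one]; rfl

theorem nielsen_mul_partialConj_self {i j : α} (hij : j ≠ i) {u : FreeGroup α}
    (hu : u ∈ away i) :
    nielsen i j * partialConj i u =
      partialConj i u * rightMul i ⁅u⁻¹, of j⁆ * nielsen i j := by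
  have hj := of_mem_away hij
  rw [partialConj, rightMul, nielsen, transv_mul (one_mem _) hj (inv_mem hu) hu,
    transv_mul (inv_mem hu) hu (one_mem _) (commutator_mem_away (inv_mem hu) hj),
    transv_mul (mul_mem (one_mem _) (inv_mem hu))
      (mul_mem hu (commutator_mem_away (inv_mem hu) hj)) (one_mem _) hj]
  congr 1
  · group
  · rw [commutatorElement_def]; group

theorem nielsen_mul_rightMul_self {i j : α} (hij : j ≠ i) {w : FreeGroup α}
    (hw : w ∈ away i) :
    nielsen i j * rightMul i w = rightMul i (of j * w * (of j)⁻¹) * nielsen i j := by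
  have hj := of_mem_away hij
  rw [rightMul, rightMul, nielsen, transv_mul (one_mem _) hj (one_mem _) hw,
    transv_mul (one_mem _) (mul_mem (mul_mem hj hw) (inv_mem hj)) (one_mem _) hj]
  congr 1
  group

theorem nielsen_away {i j : α} {w : FreeGroup α} (hw : w ∈ away i) : nielsen i j w = w :=
  transv_away _ _ hw

theorem nielsen_mul_transv_right {i j : α} (hij : j ≠ i) {u v : FreeGroup α}
    (hu : u ∈ away i) (hv : v ∈ away i) (hu' : u ∈ away j) (hv' : v ∈ away j) :
    nielsen i j * transv j u v =
      rightMul i (of j * v⁻¹ * (of j)⁻¹ * u⁻¹) * transv j u v * nielsen i j := by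
  have hj := of_mem_away hij
  have hm : of j * v⁻¹ * (of j)⁻¹ * u⁻¹ ∈ away i :=
    mul_mem (mul_mem (mul_mem hj (inv_mem hv)) (inv_mem hj)) (inv_mem hu)
  apply mulAut_ext
  intro b
  simp only [MulAut.mul_apply]
  by_cases hbi : b = i
  · subst hbi
    rw [nielsen_self hij, transv_of_ne hij.symm, nielsen_self hij, map_mul, map_mul,
      transv_self hu' hv', transv_of_ne hij.symm, rightMul_self hm, map_mul, map_mul,
      rightMul_away _ hu, rightMul_away _ hv, rightMul_away _ hj]
    group
  rw [nielsen_of_ne _ hbi]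
  by_cases hbj : b = j
  · subst hbj
    rw [transv_self hu' hv', map_mul, map_mul, map_mul, map_mul, nielsen_away hu,
      nielsen_away hv, nielsen_away hj, rightMul_away _ hu, rightMul_away _ hv,
      rightMul_away _ hj]
  · rw [transv_of_ne hbj, nielsen_of_ne _ hbi, rightMul_of_ne hbi]

theorem nielsen_mul_partialConj_swap {i j : α} (hij : j ≠ i) :
    nielsen i j * partialConj j (of i) =
      partialConj i (of j) * partialConj j (of i) * nielsen i j := by
  apply mulAut_ext
  intro b
  simp only [MulAut.mul_apply]
  have hj := of_mem_away hij
  have hi := of_mem_away hij.symm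
  by_cases hbi : b = i
  · subst hbi
    simp only [nielsen_self hij, partialConj_of_ne hij.symm, map_mul, partialConj_self hj,
      partialConj_self hi, map_inv, partialConj_of_ne hij]
    group
  by_cases hbj : b = j
  · subst hbj
    simp only [nielsen_self hij, partialConj_of_ne hij.symm, map_mul, partialConj_self hj,
      partialConj_self hi, map_inv, partialConj_of_ne hij, nielsen_of_ne _ hij]
    group
  · simp only [nielsen_of_ne _ hbi, partialConj_of_ne hbi, partialConj_of_ne hbj]

theorem mul_eq_of_conj_eq {G : Type*} [Group G] {n r p v : G} (h : r * n⁻¹ * p = n⁻¹ * v) :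
    n * r = v * p⁻¹ * n := by
  have : v = n * (r * n⁻¹ * p) := by rw [h]; group
  rw [this]; group

/-- The one difficult case of normality: the multiplier of `j` contains the letter `i` that is
itself being transvected. The right-hand side is a product of elements of the Magnus subgroup
followed by `nielsen i j`. The relation is rearranged so that it can be checked letter by letter as
an identity in the free group. -/
theorem nielsen_mul_rightMul_commutator {i j c : α} (hij : j ≠ i) (hci : c ≠ i) (hcj : c ≠ j) :
    nielsen i j * rightMul j ⁅of i, of c⁆ =
      partialConj i (of j) * partialConj j (of i) * partialConj j (of c) *
        (rightMul i ⁅of j, of c⁆)⁻¹ *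
      (partialConj i (of j) * partialConj i (of c) * partialConj j (of i) *
        rightMul j ⁅(of i)⁻¹, of c⁆)⁻¹ * nielsen i j := by
  have hj := of_mem_away hij
  have hi := of_mem_away hij.symm
  have hci' := of_mem_away hci
  have hcj' := of_mem_away hcj
  rw [← rightMul_inv (commutator_mem_away hj hci')]
  have key : rightMul j ⁅of i, of c⁆ * (nielsen i j)⁻¹ *
      (partialConj i (of j) * partialConj i (of c) * partialConj j (of i) *
        rightMul j ⁅(of i)⁻¹, of c⁆) = (nielsen i j)⁻¹ * (
      partialConj i (of j) * partialConj j (of i) * partialConj j (of c) *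
        rightMul i ⁅of j, of c⁆⁻¹) := by
    apply mulAut_ext
    intro b
    simp only [MulAut.mul_apply]
    have e1 := commutator_mem_away hi hcj'
    have e2 := commutator_mem_away (inv_mem hi) hcj'
    have e3 := inv_mem (commutator_mem_away hj hci')
    by_cases hbi : b = i
    · subst hbi
      simp only [map_commutatorElement, nielsen_inv_self hij, nielsen_inv_of_ne _ hij,
        nielsen_inv_of_ne _ hci,
        rightMul_self e1, rightMul_self e2, rightMul_self e3, rightMul_of_ne hij,
        rightMul_of_ne hij.symm, rightMul_of_ne hci, rightMul_of_ne hcj,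
        partialConj_self hj, partialConj_self hi, partialConj_self hci', partialConj_self hcj',
        partialConj_of_ne hij, partialConj_of_ne hij.symm, partialConj_of_ne hci,
        partialConj_of_ne hcj, _root_.map_mul, _root_.map_inv]
      simp only [commutatorElement_def]
      group
    by_cases hbj : b = j
    · subst hbj
      simp only [map_commutatorElement, nielsen_inv_self hij, nielsen_inv_of_ne _ hij,
        nielsen_inv_of_ne _ hci,
        rightMul_self e1, rightMul_self e2, rightMul_self e3, rightMul_of_ne hij,
        rightMul_of_ne hij.symm, rightMul_of_ne hci, rightMul_of_ne hcj,
        partialConj_self hj, partialConj_self hi, partialConj_self hci', partialConj_self hcj',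
        partialConj_of_ne hij, partialConj_of_ne hij.symm, partialConj_of_ne hci,
        partialConj_of_ne hcj, _root_.map_mul, _root_.map_inv]
      simp only [commutatorElement_def]
      group
    · simp only [nielsen_inv_of_ne _ hbi, partialConj_of_ne hbi, partialConj_of_ne hbj,
        rightMul_of_ne hbi, rightMul_of_ne hbj]
  exact mul_eq_of_conj_eq key

theorem inversion_mul_partialConj {i a : α} {u : FreeGroup α} (hu : u ∈ away a) :
    inversion i * partialConj a u * inversion i = partialConj a (inversion i u) := by
  by_cases h : a = i
  · subst h
    rw [partialConj, inversion_conj_transv (inv_mem hu) hu, inv_inv, inversion_away hu]; rfl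
  · rw [partialConj, conj_transv (inversion_of_ne h) inversion_map_away (inv_mem hu) hu, mul_assoc,
      inversion_mul_self, mul_one, map_inv]; rfl

theorem inversion_mul_rightMul {i : α} {u : FreeGroup α} (hu : u ∈ away i) :
    inversion i * rightMul i u * inversion i = partialConj i u * rightMul i u⁻¹ := by
  rw [rightMul, inversion_conj_transv (one_mem _) hu, partialConj, rightMul,
    transv_mul (inv_mem hu) hu (one_mem _) (inv_mem hu)]
  simp

theorem inversion_mul_rightMul_of_ne {i a : α} (h : a ≠ i) {u : FreeGroup α} (hu : u ∈ away a) :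
    inversion i * rightMul a u * inversion i = rightMul a (inversion i u) := by
  rw [rightMul, conj_transv (inversion_of_ne h) inversion_map_away (one_mem _) hu, mul_assoc,
      inversion_mul_self, mul_one, map_one]; rfl

theorem inversion_conj_nielsen {i j : α} (h : j ≠ i) :
    inversion j * nielsen i j * inversion j = (nielsen i j)⁻¹ := by
  rw [nielsen, conj_transv (inversion_of_ne h.symm) inversion_map_away (one_mem _)
    (of_mem_away h), mul_assoc, inversion_mul_self, mul_one, map_one, inversion_self,
    transv_inv (one_mem _) (of_mem_away h), inv_one]

theorem inversion_conj_mem (i : α) {φ : MulAut (FreeGroup α)} (h : φ ∈ magnusSubgroup α) :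
    inversion i * φ * (inversion i)⁻¹ ∈ magnusSubgroup α := by
  induction h using Subgroup.closure_induction with
  | mem x hx =>
    rw [inversion_inv]
    rcases hx with ⟨a, b, hab, rfl⟩ | ⟨a, b, c, hab, hac, -, rfl⟩
    · rw [inversion_mul_partialConj (of_mem_away hab)]
      exact partialConj_mem (inversion_map_away _ (of_mem_away hab))
    · have hb := of_mem_away hab
      have hc := of_mem_away hac
      by_cases h : a = i
      · subst h
        rw [inversion_mul_rightMul (commutator_mem_away hb hc),
          rightMul_inv (commutator_mem_away hb hc)]
        exact mul_mem (partialConj_mem (commutator_mem_away hb hc))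
          (inv_mem (rightMul_commutator_mem hb hc))
      · rw [inversion_mul_rightMul_of_ne h (commutator_mem_away hb hc), map_commutatorElement]
        exact rightMul_commutator_mem (inversion_map_away _ hb) (inversion_map_away _ hc)
  | one => simp
  | mul x y _ _ hx hy =>
    have : inversion i * (x * y) * (inversion i)⁻¹ =
      (inversion i * x * (inversion i)⁻¹) * (inversion i * y * (inversion i)⁻¹) := by group
    rw [this]; exact mul_mem hx hy
  | inv x _ hx =>
    have : inversion i * x⁻¹ * (inversion i)⁻¹ = (inversion i * x * (inversion i)⁻¹)⁻¹ := by group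
    rw [this]; exact inv_mem hx

theorem nielsen_conj_mem {i j : α} (hij : j ≠ i) {φ : MulAut (FreeGroup α)}
    (h : φ ∈ magnusSubgroup α) : nielsen i j * φ * (nielsen i j)⁻¹ ∈ magnusSubgroup α := by
  have hj := of_mem_away hij
  have hi := of_mem_away hij.symm
  induction h using Subgroup.closure_induction with
  | mem x hx =>
    rcases hx with ⟨a, b, hab, rfl⟩ | ⟨a, b, c, hab, hac, hbc, rfl⟩
    · have hb := of_mem_away hab
      by_cases hai : a = i
      · subst hai
        rw [nielsen_mul_partialConj_self hij hb, mul_inv_cancel_right]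
        exact mul_mem (partialConj_mem hb) (rightMul_commutator_mem (inv_mem hb) hj)
      by_cases haj : a = j
      · subst haj
        by_cases hbi : b = i
        · subst hbi
          rw [nielsen_mul_partialConj_swap hij, mul_inv_cancel_right]
          exact mul_mem (partialConj_mem hj) (partialConj_mem hi)
        · have hb' := of_mem_away hbi
          rw [partialConj, nielsen_mul_transv_right hij (inv_mem hb') hb' (inv_mem hb) hb,
            mul_inv_cancel_right]
          exact mul_mem (rightMul_commutator_mem hj (inv_mem hb')) (partialConj_mem hb)
      · rw [nielsen_mul_partialConj hij hai (Ne.symm haj) hb, mul_inv_cancel_right]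
        exact partialConj_mem (nielsen_map_away hij (Ne.symm haj) _ hb)
    · have hb := of_mem_away hab
      have hc := of_mem_away hac
      have hm := commutator_mem_away hb hc
      have key : ∀ u v : FreeGroup α, u ∈ away i → v ∈ away i →
          rightMul i (of j * ⁅u, v⁆ * (of j)⁻¹) ∈ magnusSubgroup α := by
        intro u v hu hv
        rw [partialConj_conj_rightMul hj (commutator_mem_away hu hv)]
        exact mul_mem (mul_mem (partialConj_mem hj) (rightMul_commutator_mem hu hv))
          (inv_mem (partialConj_mem hj))
      by_cases hai : a = i
      · subst hai
        rw [nielsen_mul_rightMul_self hij hm, mul_inv_cancel_right]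
        exact key _ _ hb hc
      by_cases haj : a = j
      · subst haj
        have main : ∀ c ≠ i, ∀ h : c ≠ a, nielsen i a * rightMul a ⁅of i, of c⁆ * (nielsen i a)⁻¹ ∈
            magnusSubgroup α := by
          intro c hci hca
          rw [nielsen_mul_rightMul_commutator hij hci hca, mul_inv_cancel_right]
          have hci' := of_mem_away hci
          have hca' := of_mem_away hca
          exact mul_mem (mul_mem (mul_mem (mul_mem (partialConj_mem hj) (partialConj_mem hi))
            (partialConj_mem hca')) (inv_mem (rightMul_commutator_mem hj hci')))
            (inv_mem (mul_mem (mul_mem (mul_mem (partialConj_mem hj) (partialConj_mem hci'))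
            (partialConj_mem hi)) (rightMul_commutator_mem (inv_mem hi) hca')))
        by_cases hbi : b = i
        · subst hbi
          exact main c (Ne.symm hbc) hac
        by_cases hci : c = i
        · subst hci
          have := inv_mem (main b hbc hab)
          rwa [mul_inv_rev, mul_inv_rev, inv_inv, ← rightMul_inv (commutator_mem_away hi hb),
            commutatorElement_inv, ← mul_assoc] at this
        · have hb' := of_mem_away hbi
          have hc' := of_mem_away hci
          rw [rightMul, nielsen_mul_transv_right hij (one_mem _) (commutator_mem_away hb' hc')
            (one_mem _) hm, mul_inv_cancel_right, inv_one, mul_one, commutatorElement_inv]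
          exact mul_mem (key _ _ hc' hb') (rightMul_commutator_mem hb hc)
      · rw [nielsen_mul_rightMul hij hai (Ne.symm haj) hm, mul_inv_cancel_right,
          map_commutatorElement]
        exact rightMul_commutator_mem (nielsen_map_away hij (Ne.symm haj) _ hb)
          (nielsen_map_away hij (Ne.symm haj) _ hc)
  | one => simp
  | mul x y _ _ hx hy =>
    have : nielsen i j * (x * y) * (nielsen i j)⁻¹ =
      (nielsen i j * x * (nielsen i j)⁻¹) * (nielsen i j * y * (nielsen i j)⁻¹) := by group
    rw [this]; exact mul_mem hx hy
  | inv x _ hx =>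
    have : nielsen i j * x⁻¹ * (nielsen i j)⁻¹ = (nielsen i j * x * (nielsen i j)⁻¹)⁻¹ := by group
    rw [this]; exact inv_mem hx

instance magnusSubgroup_normal [Fintype α] : (magnusSubgroup α).Normal := by
  rw [← Subgroup.normalizer_eq_top_iff, eq_top_iff, ← nielsenSubgroup_eq_top, nielsenSubgroup,
    Subgroup.closure_le]
  have hι : ∀ i : α, inversion i ∈ Subgroup.normalizer (magnusSubgroup α : Set _) := by
    intro i
    rw [Subgroup.mem_normalizer_iff]
    refine fun φ => ⟨inversion_conj_mem i, fun h => ?_⟩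
    have := inversion_conj_mem i h
    rw [inversion_inv] at this
    rwa [← mul_assoc, ← mul_assoc, inversion_mul_self, one_mul, mul_assoc, inversion_mul_self,
      mul_one] at this
  rintro x (⟨i, j, hij, rfl⟩ | ⟨i, rfl⟩)
  · rw [SetLike.mem_coe, Subgroup.mem_normalizer_iff]
    refine fun φ => ⟨nielsen_conj_mem hij.symm, fun h => ?_⟩
    -- Membership in the normalizer also needs conjugation by the inverse transvection. That inverse
    -- is the conjugate of the transvection by `inversion j`, so no second computation is required.
    have h2 := inversion_conj_mem j (nielsen_conj_mem hij.symm (inversion_conj_mem j h))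
    have h3 : (inversion j * nielsen i j * inversion j) * (nielsen i j * φ * (nielsen i j)⁻¹) *
        (inversion j * nielsen i j * inversion j)⁻¹ ∈ magnusSubgroup α := by
      convert h2 using 1
      simp only [mul_inv_rev, inversion_inv]
      group
    rw [inversion_conj_nielsen hij.symm] at h3
    convert h3 using 1
    group
  · exact hι i

end Magnus

end AutFree


/-! ### Groups satisfying the relations of GL_n(ℤ) -/

/-- Elements of a group acting on `ℤ^α` which satisfy the Steinberg relations together with the
relations between the elementary matrices, the sign changes and the permutation matrices. -/
structure ElementarySystem (α Q : Type*) [DecidableEq α] [Group Q] where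
  e : α → α → Q
  ι : α → Q
  perm : Equiv.Perm α →* Q
  ρ : Q →* Module.End ℤ (α → ℤ)
  e_comm : ∀ i j k l, i ≠ j → k ≠ l → j ≠ k → i ≠ l → Commute (e i j) (e k l)
  e_rel : ∀ i j k, i ≠ j → j ≠ k → i ≠ k → e j k * e i j = e i j * e j k * e i k
  ι_sq : ∀ i, ι i * ι i = 1
  ι_comm : ∀ i j, Commute (ι i) (ι j)
  ι_e_comm : ∀ i j k, i ≠ j → k ≠ i → k ≠ j → Commute (ι k) (e i j)
  ι_e_left : ∀ i j, i ≠ j → ι i * e i j * ι i = (e i j)⁻¹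
  ι_e_right : ∀ i j, i ≠ j → ι j * e i j * ι j = (e i j)⁻¹
  perm_e : ∀ (σ : Equiv.Perm α) i j, i ≠ j → perm σ * e i j = e (σ i) (σ j) * perm σ
  perm_ι : ∀ (σ : Equiv.Perm α) i, perm σ * ι i = ι (σ i) * perm σ
  perm_swap : ∀ p q, p ≠ q →
    perm (Equiv.swap p q) = e q p * ι q * e p q * (e q p)⁻¹ * ι p * ι q
  ρ_e : ∀ i j, i ≠ j → ∀ v, ρ (e i j) v = Function.update v j (v j + v i)
  ρ_ι : ∀ i v, ρ (ι i) v = Function.update v i (-v i)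
  ρ_perm : ∀ (σ : Equiv.Perm α) v, ρ (perm σ) v = v ∘ σ.symm

namespace ElementarySystem

variable {α Q : Type*} [DecidableEq α] [Group Q] (E : ElementarySystem α Q)

/-- The transposition of `p` and `q`. -/
def w (p q : α) : Q := E.perm (Equiv.swap p q)

/-- The subgroup generated by the elementary elements with indices in `I`. -/
def Γ (I : Finset α) : Subgroup Q :=
  Subgroup.closure ({x | ∃ i ∈ I, ∃ j ∈ I, i ≠ j ∧ x = E.e i j} ∪ {x | ∃ i ∈ I, x = E.ι i})

/-- The subgroup generated by the `e i p` with `i ∈ K`. -/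
def T (K : Finset α) (p : α) : Subgroup Q := Subgroup.closure {x | ∃ i ∈ K, x = E.e i p}

/-- The explicit subgroup of the stabilizer of the line spanned by the `p`-th basis vector. -/
def S (J : Finset α) (p : α) : Subgroup Q := E.Γ J ⊔ E.T J p ⊔ Subgroup.closure {E.ι p}

variable {E}

theorem e_mem_Γ {I : Finset α} {i j : α} (hi : i ∈ I) (hj : j ∈ I) (h : i ≠ j) :
    E.e i j ∈ E.Γ I := Subgroup.subset_closure (Or.inl ⟨i, hi, j, hj, h, rfl⟩)

theorem ι_mem_Γ {I : Finset α} {i : α} (hi : i ∈ I) : E.ι i ∈ E.Γ I :=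
  Subgroup.subset_closure (Or.inr ⟨i, hi, rfl⟩)

theorem e_mem_T {K : Finset α} {i p : α} (hi : i ∈ K) : E.e i p ∈ E.T K p :=
  Subgroup.subset_closure ⟨i, hi, rfl⟩

theorem Γ_le_S (J : Finset α) (p : α) : E.Γ J ≤ E.S J p := le_sup_left.trans le_sup_left

theorem T_le_S (J : Finset α) (p : α) : E.T J p ≤ E.S J p := le_sup_right.trans le_sup_left

theorem ι_mem_S (J : Finset α) (p : α) : E.ι p ∈ E.S J p :=
  (le_sup_right : _ ≤ E.S J p) (Subgroup.subset_closure rfl)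

theorem Γ_mono {I J : Finset α} (h : I ⊆ J) : E.Γ I ≤ E.Γ J := by
  rw [Γ, Subgroup.closure_le]
  rintro x (⟨i, hi, j, hj, hij, rfl⟩ | ⟨i, hi, rfl⟩)
  · exact e_mem_Γ (h hi) (h hj) hij
  · exact ι_mem_Γ (h hi)

theorem T_mono {I J : Finset α} (h : I ⊆ J) (p : α) : E.T I p ≤ E.T J p := by
  rw [T, Subgroup.closure_le]
  rintro x ⟨i, hi, rfl⟩
  exact e_mem_T (h hi)

theorem ι_inv (i : α) : (E.ι i)⁻¹ = E.ι i := inv_eq_of_mul_eq_one_left (E.ι_sq i)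

theorem w_mul_self (p q : α) : E.w p q * E.w p q = 1 := by
  rw [w, ← map_mul, Equiv.swap_mul_self, map_one]

theorem w_inv (p q : α) : (E.w p q)⁻¹ = E.w p q := inv_eq_of_mul_eq_one_left (w_mul_self p q)

theorem w_mem_Γ {I : Finset α} {p q : α} (hp : p ∈ I) (hq : q ∈ I) : E.w p q ∈ E.Γ I := by
  by_cases h : p = q
  · rw [w, h, Equiv.swap_self]
    exact (map_one E.perm) ▸ one_mem _
  · rw [w, E.perm_swap p q h]
    have h1 := e_mem_Γ (E := E) hp hq h
    have h2 := e_mem_Γ (E := E) hq hp (Ne.symm h)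
    exact mul_mem (mul_mem (mul_mem (mul_mem (mul_mem h2 (ι_mem_Γ hq)) h1) (inv_mem h2))
      (ι_mem_Γ hp)) (ι_mem_Γ hq)

theorem perm_conj_e (σ : Equiv.Perm α) {i j : α} (h : i ≠ j) :
    E.perm σ * E.e i j * (E.perm σ)⁻¹ = E.e (σ i) (σ j) := by
  rw [E.perm_e σ i j h, mul_inv_cancel_right]

theorem perm_conj_ι (σ : Equiv.Perm α) (i : α) :
    E.perm σ * E.ι i * (E.perm σ)⁻¹ = E.ι (σ i) := by
  rw [E.perm_ι σ i, mul_inv_cancel_right]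

theorem perm_conj_mem_Γ (σ : Equiv.Perm α) {I J : Finset α} (h : ∀ i ∈ I, σ i ∈ J) {x : Q}
    (hx : x ∈ E.Γ I) : E.perm σ * x * (E.perm σ)⁻¹ ∈ E.Γ J := by
  suffices E.Γ I ≤ (E.Γ J).comap (MulAut.conj (E.perm σ)).toMonoidHom from this hx
  rw [Γ, Subgroup.closure_le]
  rintro x (⟨i, hi, j, hj, hij, rfl⟩ | ⟨i, hi, rfl⟩)
  · change E.perm σ * E.e i j * (E.perm σ)⁻¹ ∈ E.Γ J
    rw [perm_conj_e σ hij]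
    exact e_mem_Γ (h i hi) (h j hj) (σ.injective.ne hij)
  · change E.perm σ * E.ι i * (E.perm σ)⁻¹ ∈ E.Γ J
    rw [perm_conj_ι]
    exact ι_mem_Γ (h i hi)

theorem perm_conj_mem_T (σ : Equiv.Perm α) {I J : Finset α} {p : α} (hp : p ∉ I)
    (h : ∀ i ∈ I, σ i ∈ J) {x : Q} (hx : x ∈ E.T I p) :
    E.perm σ * x * (E.perm σ)⁻¹ ∈ E.T J (σ p) := by
  suffices E.T I p ≤ (E.T J (σ p)).comap (MulAut.conj (E.perm σ)).toMonoidHom from this hx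
  rw [T, Subgroup.closure_le]
  rintro x ⟨i, hi, rfl⟩
  change E.perm σ * E.e i p * (E.perm σ)⁻¹ ∈ E.T J (σ p)
  rw [perm_conj_e σ (by rintro rfl; exact hp hi)]
  exact e_mem_T (h i hi)

theorem T_le_Γ {K J : Finset α} {p : α} (hK : K ⊆ J) (hp : p ∈ J) (hpK : p ∉ K) :
    E.T K p ≤ E.Γ J := by
  rw [T, Subgroup.closure_le]
  rintro x ⟨i, hi, rfl⟩
  exact e_mem_Γ (hK hi) hp (by rintro rfl; exact hpK hi)

section Action

theorem ρ_inv_apply_self (x : Q) (v : α → ℤ) : E.ρ x⁻¹ (E.ρ x v) = v := by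
  rw [← Module.End.mul_apply, ← map_mul, inv_mul_cancel, map_one, Module.End.one_apply]

theorem ρ_self_apply_inv (x : Q) (v : α → ℤ) : E.ρ x (E.ρ x⁻¹ v) = v := by
  rw [← Module.End.mul_apply, ← map_mul, mul_inv_cancel, map_one, Module.End.one_apply]

theorem ρ_mul_apply (x y : Q) (v : α → ℤ) : E.ρ (x * y) v = E.ρ x (E.ρ y v) := by
  rw [map_mul, Module.End.mul_apply]

theorem ρ_injective (x : Q) : Function.Injective (E.ρ x) :=
  Function.LeftInverse.injective (ρ_inv_apply_self x)

/-- The standard basis vectors. -/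
abbrev b (i : α) : α → ℤ := Pi.single i 1

theorem ρ_Γ_apply_of_notMem {K : Finset α} {x : Q} (hx : x ∈ E.Γ K) (v : α → ℤ) {k : α}
    (hk : k ∉ K) : E.ρ x v k = v k := by
  induction hx using Subgroup.closure_induction generalizing v with
  | mem x hx =>
    rcases hx with ⟨i, hi, j, hj, hij, rfl⟩ | ⟨i, hi, rfl⟩
    · rw [E.ρ_e i j hij, Function.update_of_ne (by rintro rfl; exact hk hj)]
    · rw [E.ρ_ι, Function.update_of_ne (by rintro rfl; exact hk hi)]
  | one => simp
  | mul x y _ _ hx hy => rw [ρ_mul_apply, hx, hy]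
  | inv x _ hx => rw [← hx (E.ρ x⁻¹ v), ρ_self_apply_inv]

theorem ρ_Γ_fix {K : Finset α} {x : Q} (hx : x ∈ E.Γ K) {v : α → ℤ} (hv : ∀ k ∈ K, v k = 0) :
    E.ρ x v = v := by
  induction hx using Subgroup.closure_induction with
  | mem x hx =>
    rcases hx with ⟨i, hi, j, hj, hij, rfl⟩ | ⟨i, hi, rfl⟩
    · rw [E.ρ_e i j hij, hv i hi, add_zero, Function.update_eq_self]
    · rw [E.ρ_ι, hv i hi, neg_zero, ← hv i hi, Function.update_eq_self]
  | one => simp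
  | mul x y _ _ hx hy => rw [ρ_mul_apply, hy, hx]
  | inv x _ hx => conv_lhs => rw [← hx, ρ_inv_apply_self]

theorem ρ_Γ_b {K : Finset α} {x : Q} (hx : x ∈ E.Γ K) {k : α} (hk : k ∉ K) :
    E.ρ x (b k) = b k :=
  ρ_Γ_fix hx fun i hi => Pi.single_eq_of_ne (by rintro rfl; exact hk hi) _

theorem ρ_T_apply_of_ne {K : Finset α} {p : α} (hp : p ∉ K) {x : Q} (hx : x ∈ E.T K p)
    (v : α → ℤ) {k : α} (hk : k ≠ p) : E.ρ x v k = v k := by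
  induction hx using Subgroup.closure_induction generalizing v with
  | mem x hx =>
    obtain ⟨i, hi, rfl⟩ := hx
    rw [E.ρ_e i p (by rintro rfl; exact hp hi), Function.update_of_ne hk]
  | one => simp
  | mul x y _ _ hx hy => rw [ρ_mul_apply, hx, hy]
  | inv x _ hx => rw [← hx (E.ρ x⁻¹ v), ρ_self_apply_inv]

theorem ρ_T_fix {K : Finset α} {p : α} (hp : p ∉ K) {x : Q} (hx : x ∈ E.T K p)
    {v : α → ℤ} (hv : ∀ k ∈ K, v k = 0) : E.ρ x v = v := by
  induction hx using Subgroup.closure_induction with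
  | mem x hx =>
    obtain ⟨i, hi, rfl⟩ := hx
    rw [E.ρ_e i p (by rintro rfl; exact hp hi), hv i hi, add_zero, Function.update_eq_self]
  | one => simp
  | mul x y _ _ hx hy => rw [ρ_mul_apply, hy, hx]
  | inv x _ hx => conv_lhs => rw [← hx, ρ_inv_apply_self]

theorem ρ_e_zpow {i j : α} (h : i ≠ j) (m : ℤ) (v : α → ℤ) :
    E.ρ (E.e i j ^ m) v = Function.update v j (v j + m * v i) := by
  have key : ∀ n : ℕ, ∀ v, E.ρ (E.e i j ^ n) v = Function.update v j (v j + n * v i) := by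
    intro n
    induction n with
    | zero => intro v; simp
    | succ n ih =>
      intro v
      rw [pow_succ, ρ_mul_apply, E.ρ_e i j h, ih, Function.update_self, Function.update_of_ne h,
        Function.update_idem]
      congr 1; push_cast; ring
  obtain ⟨n, rfl | rfl⟩ := m.eq_nat_or_neg
  · rw [zpow_natCast, key]
  · rw [zpow_neg, zpow_natCast]
    apply ρ_injective (E := E) (E.e i j ^ n)
    rw [ρ_self_apply_inv, key, Function.update_self, Function.update_of_ne h,
      Function.update_idem]
    conv_lhs => rw [← Function.update_eq_self j v]
    congr 1; ring

theorem ρ_e_zpow_b {i j : α} (h : i ≠ j) (m : ℤ) :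
    E.ρ (E.e i j ^ m) (b i) = b i + m • b j := by
  rw [ρ_e_zpow h]
  ext k
  by_cases hk : k = j
  · subst hk; simp [Pi.single_apply]
  · simp [Function.update_of_ne hk, Pi.single_apply, hk]

theorem ρ_w_b (p q : α) : E.ρ (E.w p q) (b p) = b q := by
  rw [w, E.ρ_perm]
  ext k
  simp only [Function.comp_apply, Pi.single_apply, Equiv.symm_swap, Equiv.swap_apply_def]
  split_ifs <;> simp_all

theorem ρ_S_b {J : Finset α} {p : α} (hp : p ∉ J) {x : Q} (hx : x ∈ E.S J p) :
    E.ρ x (b p) = b p ∨ E.ρ x (b p) = -b p := by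
  have : E.S J p = Subgroup.closure ((E.Γ J : Set Q) ∪ (E.T J p : Set Q) ∪ {E.ι p}) := by
    rw [S, Subgroup.closure_union, Subgroup.closure_union, Subgroup.closure_eq,
      Subgroup.closure_eq]
  rw [this] at hx
  induction hx using Subgroup.closure_induction with
  | mem x hx =>
    rcases hx with (hx | hx) | rfl
    · exact Or.inl (ρ_Γ_b hx hp)
    · exact Or.inl (ρ_T_fix hp hx fun i hi =>
        Pi.single_eq_of_ne (by rintro rfl; exact hp hi) _)
    · right
      rw [E.ρ_ι]
      ext k
      by_cases hk : k = p
      · subst hk; simp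
      · simp [Function.update_of_ne hk, Pi.single_apply, hk]
  | one => simp
  | mul x y _ _ hx hy =>
    rw [ρ_mul_apply]
    rcases hy with hy | hy <;> rcases hx with hx | hx <;> simp [hy, hx]
  | inv x _ hx =>
    rcases hx with hx | hx
    · left; conv_lhs => rw [← hx, ρ_inv_apply_self]
    · right
      apply ρ_injective (E := E) x
      rw [ρ_self_apply_inv, map_neg, hx, neg_neg]

/-- Every integral vector supported on `K` can be moved to a multiple of a basis vector. -/
theorem exists_reduce {K : Finset α} {v : α → ℤ} (hv : ∀ k ∉ K, v k = 0) (hv0 : v ≠ 0) :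
    ∃ x ∈ E.Γ K, ∃ q ∈ K, ∃ d : ℤ, E.ρ x v = d • b q := by
  classical
  -- Euclid's algorithm as a minimality argument: in the orbit choose a vector with the least sum of
  -- absolute values. Two nonzero coordinates would allow a further subtraction.
  obtain ⟨x, hx, hmin⟩ : ∃ x ∈ E.Γ K, ∀ y ∈ E.Γ K,
      ∑ k ∈ K, (E.ρ x v k).natAbs ≤ ∑ k ∈ K, (E.ρ y v k).natAbs := by
    obtain ⟨n, ⟨x, hx, rfl⟩, h⟩ := WellFounded.has_min (wellFounded_lt (α := ℕ))
      ((fun x => ∑ k ∈ K, (E.ρ x v k).natAbs) '' (E.Γ K)) ⟨_, 1, one_mem _, rfl⟩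
    exact ⟨x, hx, fun y hy => not_lt.1 (h _ ⟨y, hy, rfl⟩)⟩
  set u := E.ρ x v with hu
  have hu0 : u ≠ 0 := fun h => hv0 (ρ_injective (E := E) x (by rw [← hu, h, map_zero]))
  have hsupp : ∀ k ∉ K, u k = 0 := fun k hk => by rw [hu, ρ_Γ_apply_of_notMem hx v hk, hv k hk]
  obtain ⟨q, hq⟩ : ∃ q, u q ≠ 0 := by
    by_contra h
    push Not at h
    exact hu0 (funext h)
  have hqK : q ∈ K := by by_contra h; exact hq (hsupp q h)
  have hpair : ∀ i ∈ K, ∀ j ∈ K, i ≠ j → u i ≠ 0 → (u i).natAbs ≤ (u j).natAbs → False := by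
    intro i hi j hj hij hi0 hle
    have step : ∀ m : ℤ, (u j + m * u i).natAbs < (u j).natAbs → False := by
      intro m hm
      have h1 := hmin _ (mul_mem (zpow_mem (e_mem_Γ hi hj hij) m) hx)
      rw [ρ_mul_apply, ρ_e_zpow hij, ← hu] at h1
      refine absurd h1 (not_le.2 (Finset.sum_lt_sum (fun k _ => ?_) ⟨j, hj, ?_⟩))
      · by_cases hk : k = j
        · subst hk; rw [Function.update_self]; exact hm.le
        · rw [Function.update_of_ne hk]
      · rw [Function.update_self]; exact hm
    rcases le_total 0 (u i) with h1 | h1 <;> rcases le_total 0 (u j) with h2 | h2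
    · exact step (-1) (by omega)
    · exact step 1 (by omega)
    · exact step 1 (by omega)
    · exact step (-1) (by omega)
  refine ⟨x, hx, q, hqK, u q, ?_⟩
  rw [← hu]
  ext k
  by_cases hk : k = q
  · subst hk; simp
  · simp only [Pi.smul_apply, Pi.single_apply, hk, if_false, smul_zero]
    by_contra hk0
    have hkK : k ∈ K := by by_contra h; exact hk0 (hsupp k h)
    rcases le_total (u k).natAbs (u q).natAbs with h | h
    · exact hpair k hkK q hqK hk hk0 h
    · exact hpair q hqK k hkK (Ne.symm hk) hq h

/-- The group `Γ K` acts transitively on the lines spanned by unimodular vectors. -/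
theorem exists_unimodular {K : Finset α} {v : α → ℤ} (hv : ∀ k ∉ K, v k = 0)
    (f : (α → ℤ) →ₗ[ℤ] ℤ) (hf : f v = 1) :
    ∃ x ∈ E.Γ K, ∃ q ∈ K, E.ρ x (b q) = v ∨ E.ρ x (b q) = -v := by
  have hv0 : v ≠ 0 := by rintro rfl; simp at hf
  obtain ⟨x, hx, q, hq, d, hd⟩ := exists_reduce (E := E) hv hv0
  have h1 : v = d • E.ρ x⁻¹ (b q) := by rw [← map_smul, ← hd, ρ_inv_apply_self]
  have h2 : d * f (E.ρ x⁻¹ (b q)) = 1 := by rw [← hf]; conv_rhs => rw [h1, map_smul, smul_eq_mul]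
  refine ⟨x⁻¹, inv_mem hx, q, hq, ?_⟩
  rcases Int.eq_one_or_neg_one_of_mul_eq_one h2 with rfl | rfl
  · left; rw [h1, one_smul]
  · right; rw [h1, neg_smul, one_smul, neg_neg]

end Action

end ElementarySystem


namespace ElementarySystem

/-! ### Stabilizers of lines and adjacency of cosets -/

variable {α Q : Type*} [DecidableEq α] [Group Q] {E : ElementarySystem α Q}

theorem T_commute {K : Finset α} {p : α} (hp : p ∉ K) {x y : Q} (hx : x ∈ E.T K p)
    (hy : y ∈ E.T K p) : Commute x y := by
  have hne : ∀ i ∈ K, i ≠ p := by rintro i hi rfl; exact hp hi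
  induction hx using Subgroup.closure_induction with
  | mem x hx =>
    obtain ⟨i, hi, rfl⟩ := hx
    induction hy using Subgroup.closure_induction with
    | mem y hy =>
      obtain ⟨j, hj, rfl⟩ := hy
      exact E.e_comm i p j p (hne i hi) (hne j hj) (hne j hj).symm (hne i hi)
    | one => exact Commute.one_right _
    | mul a b _ _ ha hb => exact ha.mul_right hb
    | inv a _ ha => exact ha.inv_right
  | one => exact Commute.one_left _
  | mul a b _ _ ha hb => exact ha.mul_left hb
  | inv a _ ha => exact ha.inv_left

theorem T_split {K : Finset α} {p q : α} (hp : p ∉ K) (hq : q ∈ K) {x : Q} (hx : x ∈ E.T K p) :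
    ∃ m : ℤ, ∃ t ∈ E.T (K.erase q) p, x = E.e q p ^ m * t := by
  have hle : E.T (K.erase q) p ≤ E.T K p := T_mono (Finset.erase_subset q K) p
  induction hx using Subgroup.closure_induction with
  | mem x hx =>
    obtain ⟨i, hi, rfl⟩ := hx
    by_cases h : i = q
    · subst h; exact ⟨1, 1, one_mem _, by simp⟩
    · exact ⟨0, _, e_mem_T (Finset.mem_erase.2 ⟨h, hi⟩), by simp⟩
  | one => exact ⟨0, 1, one_mem _, by simp⟩
  | mul x y _ _ hx hy =>
    obtain ⟨m, t, ht, rfl⟩ := hx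
    obtain ⟨n, u, hu, rfl⟩ := hy
    refine ⟨m + n, t * u, mul_mem ht hu, ?_⟩
    have := (T_commute hp (hle ht) (zpow_mem (e_mem_T hq) n)).eq
    rw [zpow_add, mul_assoc, ← mul_assoc t, this]
    simp only [mul_assoc]
  | inv x _ hx =>
    obtain ⟨m, t, ht, rfl⟩ := hx
    refine ⟨-m, t⁻¹, inv_mem ht, ?_⟩
    have := (T_commute hp (inv_mem (hle ht)) (inv_mem (zpow_mem (e_mem_T hq) m))).eq
    rw [mul_inv_rev, this, zpow_neg]

/-- The Steinberg relation solved for a conjugate; it is what makes `T` invariant under `Γ`, as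
translations are under the linear group. -/
theorem e_conj_e {k l p : α} (hkl : k ≠ l) (hl : l ≠ p) (hk : k ≠ p) :
    (E.e k l)⁻¹ * E.e l p * E.e k l = E.e l p * E.e k p := by
  rw [mul_assoc, E.e_rel k l p hkl hl hk]; group

theorem Γ_conj_T {J : Finset α} {p : α} (hp : p ∉ J) {g t : Q} (hg : g ∈ E.Γ J)
    (ht : t ∈ E.T J p) : g * t * g⁻¹ ∈ E.T J p := by
  have hne : ∀ i ∈ J, i ≠ p := by rintro i hi rfl; exact hp hi
  suffices E.Γ J ≤ Subgroup.normalizer (E.T J p : Set Q) from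
    (Subgroup.mem_normalizer_iff.1 (this hg) t).1 ht
  have key : ∀ g : Q, (∀ i ∈ J, g * E.e i p * g⁻¹ ∈ E.T J p) →
      ∀ t ∈ E.T J p, g * t * g⁻¹ ∈ E.T J p := by
    intro g hg
    suffices E.T J p ≤ (E.T J p).comap (MulAut.conj g).toMonoidHom from fun t ht => this ht
    rw [T, Subgroup.closure_le]
    rintro x ⟨i, hi, rfl⟩
    exact hg i hi
  have key2 : ∀ g : Q, (∀ i ∈ J, g * E.e i p * g⁻¹ ∈ E.T J p) →
      (∀ i ∈ J, g⁻¹ * E.e i p * g ∈ E.T J p) → g ∈ Subgroup.normalizer (E.T J p : Set Q) := by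
    intro g h1 h2
    rw [Subgroup.mem_normalizer_iff]
    refine fun t => ⟨key g h1 t, fun h => ?_⟩
    have := key g⁻¹ (fun i hi => by rw [inv_inv]; exact h2 i hi) _ h
    have e : g⁻¹ * (g * t * g⁻¹) * g⁻¹⁻¹ = t := by group
    rwa [e] at this
  rw [Γ, Subgroup.closure_le]
  rintro x (⟨k, hk, l, hl, hkl, rfl⟩ | ⟨k, hk, rfl⟩)
  · apply key2
    · intro i hi
      by_cases hil : i = l
      · subst hil
        have h1 := e_conj_e (E := E) hkl (hne i hi) (hne k hk)
        have h2 := (E.e_comm k i k p hkl (hne k hk) hkl.symm (hne k hk)).eq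
        have : E.e k i * E.e i p * (E.e k i)⁻¹ = E.e i p * (E.e k p)⁻¹ := by
          rw [eq_mul_inv_iff_mul_eq, mul_assoc _ (E.e k i)⁻¹,
            ((E.e_comm k i k p hkl (hne k hk) hkl.symm (hne k hk)).inv_left).eq, ← mul_assoc,
            mul_assoc (E.e k i), ← h1]
          group
        rw [this]
        exact mul_mem (e_mem_T hi) (inv_mem (e_mem_T hk))
      · rw [(E.e_comm k l i p hkl (hne i hi) (Ne.symm hil) (hne k hk)).eq, mul_inv_cancel_right]
        exact e_mem_T hi
    · intro i hi
      by_cases hil : i = l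
      · subst hil
        rw [e_conj_e hkl (hne i hi) (hne k hk)]
        exact mul_mem (e_mem_T hi) (e_mem_T hk)
      · rw [mul_assoc, ← (E.e_comm k l i p hkl (hne i hi) (Ne.symm hil) (hne k hk)).eq,
          inv_mul_cancel_left]
        exact e_mem_T hi
  · have h : ∀ i ∈ J, E.ι k * E.e i p * E.ι k ∈ E.T J p := by
      intro i hi
      by_cases hik : i = k
      · subst hik
        rw [E.ι_e_left i p (hne i hi)]
        exact inv_mem (e_mem_T hi)
      · rw [(E.ι_e_comm i p k (hne i hi) (Ne.symm hik) (hne k hk)).eq, mul_assoc, E.ι_sq, mul_one]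
        exact e_mem_T hi
    apply key2 <;> intro i hi <;> rw [ι_inv] <;> exact h i hi

theorem ι_conj_T {J : Finset α} {p : α} (hp : p ∉ J) {t : Q} (ht : t ∈ E.T J p) :
    E.ι p * t * (E.ι p)⁻¹ ∈ E.T J p := by
  suffices E.T J p ≤ (E.T J p).comap (MulAut.conj (E.ι p)).toMonoidHom from this ht
  rw [T, Subgroup.closure_le]
  rintro x ⟨i, hi, rfl⟩
  change E.ι p * E.e i p * (E.ι p)⁻¹ ∈ E.T J p
  rw [ι_inv, E.ι_e_right i p (by rintro rfl; exact hp hi)]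
  exact inv_mem (e_mem_T hi)

theorem ι_commute_Γ {J : Finset α} {p : α} (hp : p ∉ J) {g : Q} (hg : g ∈ E.Γ J) :
    Commute (E.ι p) g := by
  have hne : ∀ i ∈ J, p ≠ i := by rintro i hi rfl; exact hp hi
  induction hg using Subgroup.closure_induction with
  | mem x hx =>
    rcases hx with ⟨i, hi, j, hj, hij, rfl⟩ | ⟨i, hi, rfl⟩
    · exact E.ι_e_comm i j p hij (hne i hi) (hne j hj)
    · exact E.ι_comm p i
  | one => exact Commute.one_right _
  | mul a b _ _ ha hb => exact ha.mul_right hb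
  | inv a _ ha => exact ha.inv_right

theorem S_eq_closure (J : Finset α) (p : α) :
    E.S J p = Subgroup.closure ((E.Γ J : Set Q) ∪ (E.T J p : Set Q) ∪ {E.ι p}) := by
  rw [S, Subgroup.closure_union, Subgroup.closure_union, Subgroup.closure_eq,
    Subgroup.closure_eq]

/-- Normal form for the elements of `S`. -/
theorem S_normal_form {J : Finset α} {p : α} (hp : p ∉ J) {x : Q} (hx : x ∈ E.S J p) :
    ∃ t ∈ E.T J p, ∃ g ∈ E.Γ J, ∃ ε : Q, (ε = 1 ∨ ε = E.ι p) ∧ x = t * g * ε := by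
  have hι : ∀ y : Q, (∃ t ∈ E.T J p, ∃ g ∈ E.Γ J, ∃ ε : Q, (ε = 1 ∨ ε = E.ι p) ∧
      y = t * g * ε) → ∃ t ∈ E.T J p, ∃ g ∈ E.Γ J, ∃ ε : Q, (ε = 1 ∨ ε = E.ι p) ∧
      E.ι p * y = t * g * ε := by
    rintro y ⟨t, ht, g, hg, ε, hε, rfl⟩
    refine ⟨_, ι_conj_T hp ht, g, hg, E.ι p * ε, ?_, ?_⟩
    · rcases hε with rfl | rfl
      · right; simp
      · left; exact E.ι_sq p
    · calc _ = E.ι p * t * (E.ι p)⁻¹ * (E.ι p * g) * ε := by group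
        _ = _ := by rw [(ι_commute_Γ hp hg).eq]; group
  have hΓ : ∀ h ∈ E.Γ J, ∀ y : Q, (∃ t ∈ E.T J p, ∃ g ∈ E.Γ J, ∃ ε : Q, (ε = 1 ∨ ε = E.ι p) ∧
      y = t * g * ε) → ∃ t ∈ E.T J p, ∃ g ∈ E.Γ J, ∃ ε : Q, (ε = 1 ∨ ε = E.ι p) ∧
      h * y = t * g * ε := by
    rintro h hh y ⟨t, ht, g, hg, ε, hε, rfl⟩
    exact ⟨_, Γ_conj_T hp hh ht, h * g, mul_mem hh hg, ε, hε, by group⟩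
  have hT : ∀ h ∈ E.T J p, ∀ y : Q, (∃ t ∈ E.T J p, ∃ g ∈ E.Γ J, ∃ ε : Q, (ε = 1 ∨ ε = E.ι p) ∧
      y = t * g * ε) → ∃ t ∈ E.T J p, ∃ g ∈ E.Γ J, ∃ ε : Q, (ε = 1 ∨ ε = E.ι p) ∧
      h * y = t * g * ε := by
    rintro h hh y ⟨t, ht, g, hg, ε, hε, rfl⟩
    exact ⟨_, mul_mem hh ht, g, hg, ε, hε, by group⟩
  rw [S_eq_closure] at hx
  induction hx using Subgroup.closure_induction_left with
  | one => exact ⟨1, one_mem _, 1, one_mem _, 1, Or.inl rfl, by simp⟩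
  | mul_left x hx y _ ih =>
    rcases hx with (hx | hx) | rfl
    · exact hΓ x hx y ih
    · exact hT x hx y ih
    · exact hι y ih
  | inv_mul_cancel x hx y _ ih =>
    rcases hx with (hx | hx) | rfl
    · exact hΓ _ (inv_mem hx) y ih
    · exact hT _ (inv_mem hx) y ih
    · rw [ι_inv]; exact hι y ih

/-- Two vectors span the same line. -/
def SameLine (v w : α → ℤ) : Prop := v = w ∨ v = -w

theorem SameLine.symm {v w : α → ℤ} (h : SameLine v w) : SameLine w v := by
  rcases h with rfl | rfl
  · exact Or.inl rfl
  · exact Or.inr (neg_neg w).symm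

theorem SameLine.trans {u v w : α → ℤ} (h : SameLine u v) (h' : SameLine v w) : SameLine u w := by
  rcases h with rfl | rfl <;> rcases h' with rfl | rfl
  · exact Or.inl rfl
  · exact Or.inr rfl
  · exact Or.inr rfl
  · exact Or.inl (neg_neg w)

theorem SameLine.map {v w : α → ℤ} (h : SameLine v w) (x : Q) :
    SameLine (E.ρ x v) (E.ρ x w) := by
  rcases h with rfl | rfl
  · exact Or.inl rfl
  · exact Or.inr (map_neg _ _)

theorem SameLine.of_map {v w : α → ℤ} (x : Q) (h : SameLine (E.ρ x v) (E.ρ x w)) :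
    SameLine v w := by
  have := h.map (E := E) x⁻¹
  rwa [ρ_inv_apply_self, ρ_inv_apply_self] at this

theorem SameLine.natAbs {v w : α → ℤ} (h : SameLine v w) (k : α) :
    (v k).natAbs = (w k).natAbs := by
  rcases h with rfl | rfl <;> simp

theorem sameLine_S {J : Finset α} {p : α} (hp : p ∉ J) {s : Q} (hs : s ∈ E.S J p) (x : Q) :
    SameLine (E.ρ (x * s) (b p)) (E.ρ x (b p)) := by
  rw [ρ_mul_apply]
  exact SameLine.map (ρ_S_b hp hs) x

theorem b_of_ne {q k : α} (h : k ≠ q) : (b q : α → ℤ) k = 0 := Pi.single_eq_of_ne h _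

theorem ρ_ι_b_of_ne {p q : α} (h : q ≠ p) : E.ρ (E.ι p) (b q) = b q := by
  have : (b q : α → ℤ) p = 0 := Pi.single_eq_of_ne h.symm _
  rw [E.ρ_ι, this, neg_zero, ← this, Function.update_eq_self]

theorem w_conj_S {J : Finset α} {p q : α} (hp : p ∉ J) {x : Q}
    (hx : x ∈ E.S (J.erase q) q) : E.w p q * x * (E.w p q)⁻¹ ∈ E.S J p := by
  suffices E.S (J.erase q) q ≤ (E.S J p).comap (MulAut.conj (E.w p q)).toMonoidHom from this hx
  have hfix : ∀ i ∈ J.erase q, Equiv.swap p q i = i := fun i hi =>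
    Equiv.swap_apply_of_ne_of_ne (by rintro rfl; exact hp (Finset.mem_of_mem_erase hi))
      (Finset.ne_of_mem_erase hi)
  refine sup_le (sup_le ?_ ?_) ?_
  · intro y hy
    exact Γ_le_S J p (perm_conj_mem_Γ (E := E) (Equiv.swap p q) (J := J) (fun i hi => by
      rw [hfix i hi]; exact Finset.mem_of_mem_erase hi) hy)
  · intro y hy
    have := perm_conj_mem_T (E := E) (Equiv.swap p q) (J := J) (Finset.notMem_erase q J)
      (fun i hi => by rw [hfix i hi]; exact Finset.mem_of_mem_erase hi) hy
    rw [Equiv.swap_apply_right] at this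
    exact T_le_S J p this
  · rw [Subgroup.closure_le, Set.singleton_subset_iff]
    change E.perm (Equiv.swap p q) * E.ι q * (E.perm (Equiv.swap p q))⁻¹ ∈ E.S J p
    rw [perm_conj_ι, Equiv.swap_apply_right]
    exact ι_mem_S J p

theorem w_conj_T {J K : Finset α} {p q : α} (hp : p ∉ J) (hq : q ∈ J) (hK : K ⊆ J.erase q) {x : Q}
    (hx : x ∈ E.T K p) : E.w p q * x * (E.w p q)⁻¹ ∈ E.Γ J := by
  have hpK : p ∉ K := fun h => hp (Finset.mem_of_mem_erase (hK h))
  have := perm_conj_mem_T (E := E) (Equiv.swap p q) (J := K) hpK (fun i hi => by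
    rwa [Equiv.swap_apply_of_ne_of_ne (by rintro rfl; exact hpK hi)
      (Finset.ne_of_mem_erase (hK hi))]) hx
  rw [Equiv.swap_apply_left] at this
  exact T_le_Γ (hK.trans (Finset.erase_subset q J)) hq
    (fun h => Finset.notMem_erase q J (hK h)) this

theorem w_conj_ι (p q : α) : E.w p q * E.ι p * (E.w p q)⁻¹ = E.ι q := by
  rw [w, perm_conj_ι, Equiv.swap_apply_left]

/-- The stabilizer hypothesis for all proper index sets obtained from `J`. -/
def StabilizerHyp (E : ElementarySystem α Q) (J : Finset α) : Prop :=
  ∀ q ∈ J, ∀ x ∈ E.Γ J, SameLine (E.ρ x (b q)) (b q) → x ∈ E.S (J.erase q) q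

/-- In the normal form `t * g * ε` the factor `g` fixes the line of `b q`, so the induction
hypothesis puts it in the smaller stabilizer at `q`; the part of `t` along `e q p` vanishes.
Conjugation by `w p q` exchanges the roles of `p` and `q` and sends each remaining factor into `S`.
-/
theorem w_conj_mem_S {J : Finset α} {p q : α} (hp : p ∉ J) (hq : q ∈ J)
    (IH : E.StabilizerHyp J) {x : Q} (hx : x ∈ E.S J p)
    (hl : SameLine (E.ρ x (b q)) (b q)) : E.w p q * x * (E.w p q)⁻¹ ∈ E.S J p := by
  have hqp : q ≠ p := by rintro rfl; exact hp hq
  obtain ⟨t, ht, g, hg, ε, hε, rfl⟩ := S_normal_form hp hx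
  have hεb : E.ρ ε (b q) = b q := by
    rcases hε with rfl | rfl
    · simp
    · exact ρ_ι_b_of_ne hqp
  rw [ρ_mul_apply, hεb, ρ_mul_apply] at hl
  have hgp : E.ρ g (b q) p = 0 := by
    rw [ρ_Γ_apply_of_notMem hg _ hp]; exact Pi.single_eq_of_ne hqp.symm _
  have hgl : SameLine (E.ρ g (b q)) (b q) := by
    rcases hl with hl | hl
    · left
      ext k
      by_cases hk : k = p
      · subst hk; rw [hgp, b_of_ne hqp.symm]
      · rw [← ρ_T_apply_of_ne hp ht (E.ρ g (b q)) hk, hl]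
    · right
      ext k
      by_cases hk : k = p
      · subst hk; rw [hgp, Pi.neg_apply, b_of_ne hqp.symm, neg_zero]
      · rw [← ρ_T_apply_of_ne hp ht (E.ρ g (b q)) hk, hl]
  obtain ⟨m, t', ht', rfl⟩ := T_split hp hq ht
  have htb : E.ρ t' (b q) = b q := ρ_T_fix (fun h => hp (Finset.mem_of_mem_erase h)) ht'
    fun k hk => Pi.single_eq_of_ne (Finset.ne_of_mem_erase hk) _
  -- The `p`-th coordinate of the image of `b q` is `m`, whereas that of `±b q` is zero.
  have hm : m = 0 := by
    have h1 : SameLine (E.ρ (E.e q p ^ m * t') (b q)) (b q) :=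
      (hgl.symm.map (E.e q p ^ m * t')).trans hl
    rw [ρ_mul_apply, htb, ρ_e_zpow_b hqp] at h1
    have h2 := h1.natAbs p
    simpa [Pi.single_apply, hqp.symm] using h2
  subst hm
  rw [zpow_zero, one_mul]
  have e : E.w p q * (t' * g * ε) * (E.w p q)⁻¹ = (E.w p q * t' * (E.w p q)⁻¹) *
      (E.w p q * g * (E.w p q)⁻¹) * (E.w p q * ε * (E.w p q)⁻¹) := by group
  rw [e]
  refine mul_mem (mul_mem (Γ_le_S J p (w_conj_T hp hq subset_rfl ht'))
    (w_conj_S hp (IH q hq g hg hgl))) ?_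
  rcases hε with rfl | rfl
  · simp
  · rw [w_conj_ι]; exact Γ_le_S J p (ι_mem_Γ hq)

/-- Adjacency of cosets of `S`: the corresponding lines form a partial basis. -/
def Adj (E : ElementarySystem α Q) (J : Finset α) (p : α) (x y : Q) : Prop :=
  ∃ q ∈ J, ∃ s ∈ E.S J p, ∃ s' ∈ E.S J p, y = x * s * E.w p q * s'

theorem Adj.symm {J : Finset α} {p : α} {x y : Q} (h : E.Adj J p x y) : E.Adj J p y x := by
  obtain ⟨q, hq, s, hs, s', hs', rfl⟩ := h
  refine ⟨q, hq, s'⁻¹, inv_mem hs', s⁻¹, inv_mem hs, ?_⟩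
  rw [mul_inv_cancel_right, mul_assoc (x * s), w_mul_self, mul_one, mul_inv_cancel_right]

theorem Adj.mul_right {J : Finset α} {p : α} {x y s : Q} (h : E.Adj J p x y)
    (hs : s ∈ E.S J p) : E.Adj J p x (y * s) := by
  obtain ⟨q, hq, t, ht, t', ht', rfl⟩ := h
  exact ⟨q, hq, t, ht, t' * s, mul_mem ht' hs, by simp only [mul_assoc]⟩

theorem Adj.mul_right_left {J : Finset α} {p : α} {x y s : Q} (h : E.Adj J p x y)
    (hs : s ∈ E.S J p) : E.Adj J p (x * s) y := (h.symm.mul_right hs).symm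

theorem Adj.mul_left {J : Finset α} {p : α} {x y : Q} (h : E.Adj J p x y) (g : Q) :
    E.Adj J p (g * x) (g * y) := by
  obtain ⟨q, hq, t, ht, t', ht', rfl⟩ := h
  exact ⟨q, hq, t, ht, t', ht', by simp only [mul_assoc]⟩

theorem w_mul_swap_mul_w {p q r : α} (hp : p ≠ q) (hr : p ≠ r) :
    E.w p q * E.w q r * E.w p r = E.w q r := by
  rw [w, w, w, ← map_mul, ← map_mul]
  congr 1
  ext k
  simp only [Equiv.Perm.coe_mul, Function.comp_apply, Equiv.swap_apply_def]
  split_ifs <;> simp_all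

/-- A line adjacent to a given one has at most one adjacent lift. -/
theorem Adj.unique {J : Finset α} {p : α} (hp : p ∉ J) (IH : E.StabilizerHyp J) {x y z : Q}
    (hy : E.Adj J p x y) (hz : E.Adj J p x z)
    (hl : SameLine (E.ρ y (b p)) (E.ρ z (b p))) : y⁻¹ * z ∈ E.S J p := by
  obtain ⟨q, hq, s, hs, s', hs', rfl⟩ := hy
  obtain ⟨r, hr, t, ht, t', ht', rfl⟩ := hz
  have hpq : p ≠ q := by rintro rfl; exact hp hq
  have hpr : p ≠ r := by rintro rfl; exact hp hr
  have hw : E.w q r ∈ E.S J p := Γ_le_S J p (w_mem_Γ hq hr)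
  have hu : s⁻¹ * t * E.w q r ∈ E.S J p := mul_mem (mul_mem (inv_mem hs) ht) hw
  have hline : SameLine (E.ρ (s⁻¹ * t * E.w q r) (b q)) (b q) := by
    have h1 := ((sameLine_S hp hs' (x * s * E.w p q)).symm.trans hl).trans
      (sameLine_S hp ht' (x * t * E.w p r))
    rw [ρ_mul_apply, ρ_mul_apply (x * t), ρ_w_b, ρ_w_b, ρ_mul_apply, ρ_mul_apply] at h1
    have h2 := (SameLine.of_map x h1).map (E := E) s⁻¹
    rw [ρ_inv_apply_self] at h2
    rw [ρ_mul_apply, ρ_w_b, ρ_mul_apply]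
    exact h2.symm
  have h3 := w_conj_mem_S hp hq IH hu hline
  have e : (x * s * E.w p q * s')⁻¹ * (x * t * E.w p r * t') =
      s'⁻¹ * (E.w p q * (s⁻¹ * t * E.w q r) * (E.w p q)⁻¹) * E.w q r * t' := by
    have h4 : (E.w p q)⁻¹ * E.w q r = (E.w q r)⁻¹ * E.w p r := by
      rw [w_inv, w_inv]
      have := w_mul_swap_mul_w (E := E) hpq hpr
      rw [← mul_right_inj (E.w q r), w_mul_self, ← mul_assoc, ← mul_assoc] at this
      rw [← mul_left_inj (E.w p r), mul_assoc (E.w q r), w_mul_self, mul_one]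
      exact w_mul_swap_mul_w hpq hpr
    rw [mul_assoc (s'⁻¹), mul_assoc (E.w p q * _), h4]
    simp only [mul_inv_rev, w_inv]
    group
    simp only [mul_assoc]
    rw [← mul_assoc (E.w q r) (E.w q r), w_mul_self, one_mul]
  rw [e]
  exact mul_mem (mul_mem (mul_mem (inv_mem hs') h3) hw) ht'

end ElementarySystem


namespace ElementarySystem

/-! ### Heights and the connectivity of lower links -/

variable {α Q : Type*} [DecidableEq α] [Group Q] {E : ElementarySystem α Q}

/-- The absolute value of the `p`-th coordinate of the image of the `p`-th basis vector. -/
def height (E : ElementarySystem α Q) (p : α) (x : Q) : ℕ := (E.ρ x (b p) p).natAbs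

/-- The standard representatives of the neighbours of `x`. -/
def nb (E : ElementarySystem α Q) (p : α) (x g : Q) (q : α) (m : ℤ) : Q :=
  x * g * E.e q p ^ m * E.w p q

theorem height_eq_of_sameLine {p : α} {x y : Q} (h : SameLine (E.ρ x (b p)) (E.ρ y (b p))) :
    E.height p x = E.height p y := h.natAbs p

theorem height_mul_right {J : Finset α} {p : α} (hp : p ∉ J) {s : Q} (hs : s ∈ E.S J p) (x : Q) :
    E.height p (x * s) = E.height p x := height_eq_of_sameLine (sameLine_S hp hs x)

theorem w_mul_w {p q r : α} (hp : p ≠ q) (hr : p ≠ r) (hqr : q ≠ r) :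
    E.w p q * E.w p r = E.w p r * E.w q r := by
  rw [w, w, w, ← map_mul, ← map_mul]
  congr 1
  ext k
  simp only [Equiv.Perm.coe_mul, Function.comp_apply, Equiv.swap_apply_def]
  split_ifs <;> simp_all

theorem w_conj_e_zpow {p q r : α} (hr : p ≠ r) (hq : r ≠ q) (m : ℤ) :
    E.w p q * E.e r p ^ m = E.e r q ^ m * E.w p q := by
  have h1 := perm_conj_e (E := E) (Equiv.swap p q) hr.symm
  rw [Equiv.swap_apply_left, Equiv.swap_apply_of_ne_of_ne hr.symm hq] at h1
  rw [← h1, conj_zpow, w]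
  group

theorem ι_mul_e_zpow {p q : α} (h : q ≠ p) (m : ℤ) :
    E.ι p * E.e q p ^ m = E.e q p ^ (-m) * E.ι p := by
  have h1 : E.ι p * E.e q p * (E.ι p)⁻¹ = (E.e q p)⁻¹ := by
    rw [ι_inv, E.ι_e_right q p h]
  rw [zpow_neg, ← inv_zpow, ← h1, conj_zpow]
  group

theorem ι_mul_e_zpow_left {p q : α} (h : q ≠ p) (m : ℤ) :
    E.ι q * E.e q p ^ m = E.e q p ^ (-m) * E.ι q := by
  have h1 : E.ι q * E.e q p * (E.ι q)⁻¹ = (E.e q p)⁻¹ := by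
    rw [ι_inv, E.ι_e_left q p h]
  rw [zpow_neg, ← inv_zpow, ← h1, conj_zpow]
  group

theorem ι_mul_w (p q : α) : E.ι p * E.w p q = E.w p q * E.ι q := by
  rw [w, E.perm_ι, Equiv.swap_apply_right]

theorem ι_mul_w' (p q : α) : E.ι q * E.w p q = E.w p q * E.ι p := by
  rw [w, E.perm_ι, Equiv.swap_apply_left]

section

variable {J : Finset α} {p : α} (hp : p ∉ J)
include hp

theorem adj_nb (x : Q) {g : Q} (hg : g ∈ E.Γ J) {q : α} (hq : q ∈ J) (m : ℤ) :
    E.Adj J p x (E.nb p x g q m) :=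
  ⟨q, hq, g * E.e q p ^ m, mul_mem (Γ_le_S J p hg) (T_le_S J p (zpow_mem (e_mem_T hq) m)), 1,
    one_mem _, by rw [nb, mul_one, mul_assoc x g]⟩

theorem exists_nb {x y : Q} (h : E.Adj J p x y) :
    ∃ g ∈ E.Γ J, ∃ q ∈ J, ∃ m : ℤ, ∃ s ∈ E.S J p, y = E.nb p x g q m * s := by
  obtain ⟨q, hq, s, hs, s', hs', rfl⟩ := h
  have hpq : q ≠ p := by rintro rfl; exact hp hq
  obtain ⟨t, ht, g, hg, ε, hε, e⟩ := S_normal_form hp (inv_mem hs)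
  obtain ⟨m, t', ht', e'⟩ := T_split hp hq (inv_mem ht)
  have hs2 : s = ε⁻¹ * g⁻¹ * E.e q p ^ m * t' := by
    rw [mul_assoc _ _ t', ← e', ← inv_inv s, e]; group
  have hw := w_conj_T (E := E) hp hq subset_rfl ht'
  have hw2 : t' * E.w p q = E.w p q * (E.w p q * t' * (E.w p q)⁻¹) := by
    rw [w_inv, ← mul_assoc, ← mul_assoc, w_mul_self, one_mul]
  rcases hε with rfl | rfl
  · refine ⟨g⁻¹, inv_mem hg, q, hq, m, _, mul_mem (Γ_le_S J p hw) hs', ?_⟩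
    rw [hs2, nb]
    calc _ = x * g⁻¹ * E.e q p ^ m * (t' * E.w p q) * s' := by group
      _ = _ := by rw [hw2]; simp only [mul_assoc]
  · refine ⟨g⁻¹, inv_mem hg, q, hq, -m, _, mul_mem (mul_mem (Γ_le_S J p (ι_mem_Γ hq))
      (Γ_le_S J p hw)) hs', ?_⟩
    rw [hs2, nb, ι_inv, (ι_commute_Γ hp (inv_mem hg)).eq]
    calc _ = x * g⁻¹ * (E.ι p * E.e q p ^ m) * (t' * E.w p q) * s' := by group
      _ = x * g⁻¹ * E.e q p ^ (-m) * (E.ι p * E.w p q) * (E.w p q * t' * (E.w p q)⁻¹) * s' := by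
        rw [hw2, ι_mul_e_zpow hpq]; simp only [mul_assoc]
      _ = _ := by rw [ι_mul_w]; simp only [mul_assoc]

theorem ρ_nb (x : Q) {g : Q} (hg : g ∈ E.Γ J) {q : α} (hq : q ∈ J) (m : ℤ) :
    E.ρ (E.nb p x g q m) (b p) = E.ρ x (E.ρ g (b q) + m • b p) := by
  rw [nb, ρ_mul_apply, ρ_w_b, ρ_mul_apply, ρ_e_zpow_b (by rintro rfl; exact hp hq), ρ_mul_apply,
    map_add, map_smul, ρ_Γ_b hg hp]

theorem height_nb (x : Q) {g : Q} (hg : g ∈ E.Γ J) {q : α} (hq : q ∈ J) (m : ℤ) :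
    E.height p (E.nb p x g q m) =
      (E.ρ x (E.ρ g (b q)) p + m * E.ρ x (b p) p).natAbs := by
  rw [height, ρ_nb hp x hg hq, map_add, map_smul]; rfl

/-- The relation `perm_swap`, solved for `e p q`, exhibits it as a transposition between two
elements of `S`. Geometrically, `b p + b q` and `b p` form part of a basis. -/
theorem adj_one_e {q : α} (hq : q ∈ J) : E.Adj J p 1 (E.e p q) := by
  have hpq : p ≠ q := by rintro rfl; exact hp hq
  refine ⟨q, hq, E.ι q * (E.e q p)⁻¹, mul_mem (Γ_le_S J p (ι_mem_Γ hq))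
    (T_le_S J p (inv_mem (e_mem_T hq))), E.ι q * E.ι p * E.e q p,
    mul_mem (mul_mem (Γ_le_S J p (ι_mem_Γ hq)) (ι_mem_S J p)) (T_le_S J p (e_mem_T hq)), ?_⟩
  rw [w, E.perm_swap p q hpq]
  calc _ = E.ι q * E.ι q * E.e p q * (E.e q p)⁻¹ * (E.ι p * ((E.ι q * E.ι q) * E.ι p)) *
        E.e q p := by rw [E.ι_sq]; simp [E.ι_sq]
    _ = _ := by group

theorem adj_nb_succ (x g : Q) {q : α} (hq : q ∈ J) (m : ℤ) :
    E.Adj J p (E.nb p x g q m) (E.nb p x g q (m + 1)) := by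
  have hpq : p ≠ q := by rintro rfl; exact hp hq
  have h := (adj_one_e (E := E) hp hq).mul_left (E.nb p x g q m)
  rw [mul_one] at h
  convert h using 1
  have h1 := E.perm_e (Equiv.swap p q) q p hpq.symm
  rw [Equiv.swap_apply_left, Equiv.swap_apply_right] at h1
  have h2 : E.w p q * E.e p q = E.e q p * E.w p q := by
    have := E.perm_e (Equiv.swap p q) p q hpq
    rwa [Equiv.swap_apply_left, Equiv.swap_apply_right] at this
  rw [nb, nb, zpow_add, zpow_one, mul_assoc _ (E.w p q), h2]
  simp only [mul_assoc]

/-- Both cosets are represented from the common element `x * g * e q p ^ m * e r p ^ n`, one by `w p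
q` and the other by `w p r`, and these two differ by `w p r` and an element of `S`. -/
theorem adj_nb_of_ne (x g : Q) {q r : α} (hq : q ∈ J) (hr : r ∈ J) (hqr : q ≠ r) (m n : ℤ) :
    E.Adj J p (E.nb p x g q m) (E.nb p x g r n) := by
  have hpq : p ≠ q := by rintro rfl; exact hp hq
  have hpr : p ≠ r := by rintro rfl; exact hp hr
  have hc : Commute (E.e q p ^ m) (E.e r p ^ n) :=
    ((E.e_comm q p r p hpq.symm hpr.symm hpr hpq.symm).zpow_zpow m n)
  set y := x * g * E.e q p ^ m * E.e r p ^ n with hy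
  have h1 : E.nb p x g q m = y * E.w p q * E.e r q ^ (-n) := by
    have := w_conj_e_zpow (E := E) hpr hqr.symm n
    have h2 : E.e r p ^ n * E.w p q = E.w p q * E.e r q ^ n := by
      rw [← mul_right_inj (E.w p q), ← mul_assoc, this, mul_assoc, w_mul_self, mul_one,
        ← mul_assoc, w_mul_self, one_mul]
    rw [hy, mul_assoc _ (E.e r p ^ n), h2, nb, zpow_neg]
    group
  have h2 : E.nb p x g r n = y * E.w p r * E.e q r ^ (-m) := by
    have := w_conj_e_zpow (E := E) hpq hqr m
    have h2 : E.e q p ^ m * E.w p r = E.w p r * E.e q r ^ m := by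
      rw [← mul_right_inj (E.w p r), ← mul_assoc, this, mul_assoc, w_mul_self, mul_one,
        ← mul_assoc, w_mul_self, one_mul]
    rw [hy, mul_assoc (x * g), hc.eq, ← mul_assoc, mul_assoc _ (E.e q p ^ m), h2, nb, zpow_neg]
    group
  rw [h1, h2]
  refine Adj.mul_right_left (Adj.mul_right ?_ (Γ_le_S J p (zpow_mem (e_mem_Γ hq hr hqr) _)))
    (Γ_le_S J p (zpow_mem (e_mem_Γ hr hq hqr.symm) _))
  refine ⟨r, hr, 1, one_mem _, E.w q r, Γ_le_S J p (w_mem_Γ hq hr), ?_⟩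
  rw [mul_one, mul_assoc _ (E.w p r), ← w_mul_w hpq hpr hqr, mul_assoc y, ← mul_assoc (E.w p q),
    w_mul_self, one_mul]

/-- A generator of `Γ J` preserves the line of at least one basis vector: `e k l` fixes `b l`, and
`ι k` negates `b k`. For that index the neighbour does not change, up to the sign `δ` of the
exponent, which links the families attached to `g` and `g * g₀`. -/
theorem nb_mul_gen {g₀ : Q} (hg₀ : g₀ ∈ ({x | ∃ i ∈ J, ∃ j ∈ J, i ≠ j ∧ x = E.e i j} ∪
      {x | ∃ i ∈ J, x = E.ι i} : Set Q)) :
    ∃ q ∈ J, ∃ δ : ℤ, δ * δ = 1 ∧ ∀ (m : ℤ) (x g : Q), ∃ s ∈ E.S J p,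
      E.nb p x (g * g₀) q m = E.nb p x g q (δ * m) * s := by
  have hne : ∀ i ∈ J, p ≠ i := by rintro i hi rfl; exact hp hi
  rcases hg₀ with ⟨k, hk, l, hl, hkl, rfl⟩ | ⟨k, hk, rfl⟩
  · refine ⟨l, hl, 1, by norm_num, fun m x g => ?_⟩
    refine ⟨E.e k p * E.e k l ^ (-m), mul_mem (T_le_S J p (e_mem_T hk))
      (Γ_le_S J p (zpow_mem (e_mem_Γ hk hl hkl) _)), ?_⟩
    have h1 := e_conj_e (E := E) hkl (hne l hl).symm (hne k hk).symm
    have hc := E.e_comm l p k p (hne l hl).symm (hne k hk).symm (hne k hk) (hne l hl).symm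
    have h2 : (E.e k l)⁻¹ * E.e l p ^ m * E.e k l = E.e l p ^ m * E.e k p ^ m := by
      have := conj_zpow (i := m) (a := (E.e k l)⁻¹) (b := E.e l p)
      rw [inv_inv, h1, hc.mul_zpow] at this
      exact this.symm
    have hc2 : Commute (E.e k l) (E.e k p) := E.e_comm k l k p hkl (hne k hk).symm hkl.symm
      (hne k hk).symm
    have h3 : E.e k l * E.e l p ^ m = E.e l p ^ m * (E.e k p ^ (-m) * E.e k l) := by
      have h4 : E.e l p ^ m * E.e k l = E.e k l * (E.e l p ^ m * E.e k p ^ m) := by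
        rw [← h2]; group
      have h5 : E.e k l * E.e l p ^ m = E.e l p ^ m * E.e k l * E.e k p ^ (-m) := by
        rw [h4]; group
      rw [h5, mul_assoc, (hc2.zpow_right (-m)).eq]
    have h6 : E.e k l * E.w p l = E.w p l * E.e k p := by
      have := E.perm_e (Equiv.swap p l) k p (hne k hk).symm
      rw [Equiv.swap_apply_left, Equiv.swap_apply_of_ne_of_ne (hne k hk).symm hkl] at this
      exact this.symm
    have h7 : E.e k p ^ (-m) * E.w p l = E.w p l * E.e k l ^ (-m) := by
      have := w_conj_e_zpow (E := E) (hne k hk) hkl (-m)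
      rw [← mul_right_inj (E.w p l), ← mul_assoc, this, mul_assoc, w_mul_self, mul_one,
        ← mul_assoc, w_mul_self, one_mul]
    calc _ = x * g * (E.e k l * E.e l p ^ m) * E.w p l := by rw [nb]; simp only [mul_assoc]
      _ = x * g * E.e l p ^ m * (E.e k l * (E.e k p ^ (-m) * E.w p l)) := by
        rw [h3, ← (hc2.zpow_right (-m)).eq]; simp only [mul_assoc]
      _ = x * g * E.e l p ^ m * ((E.e k l * E.w p l) * E.e k l ^ (-m)) := by
        rw [h7, mul_assoc (E.e k l)]
      _ = _ := by rw [h6, nb, one_mul]; simp only [mul_assoc]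
  · refine ⟨k, hk, -1, by norm_num, fun m x g => ⟨E.ι p, ι_mem_S J p, ?_⟩⟩
    rw [nb, nb, neg_one_mul, ← mul_assoc x g, mul_assoc (x * g), ι_mul_e_zpow_left (hne k hk).symm,
      mul_assoc _ (E.w p k), ← ι_mul_w']
    simp only [mul_assoc]

/-- The lower link of a vertex of positive height is connected. -/
theorem low_link {x y z : Q} (hx : 0 < E.height p x) (P : Q → Prop)
    (hPS : ∀ y, P y → ∀ s ∈ E.S J p, P (y * s))
    (hPA : ∀ y z, P y → E.Adj J p y z → E.height p z < E.height p x → P z)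
    (hy : E.Adj J p x y) (hyx : E.height p y < E.height p x) (hPy : P y)
    (hz : E.Adj J p x z) (hzx : E.height p z < E.height p x) : P z := by
  set M := E.ρ x (b p) p with hM
  have hxM : E.height p x = M.natAbs := rfl
  rw [hxM] at hx hyx hzx hPA
  have hreach : ∀ g ∈ E.Γ J, ∀ q₀ ∈ J, ∀ m₀, E.height p (E.nb p x g q₀ m₀) < M.natAbs →
      P (E.nb p x g q₀ m₀) → ∀ q ∈ J, ∀ m, E.height p (E.nb p x g q m) < M.natAbs →
      P (E.nb p x g q m) := by
    intro g hg q₀ hq₀ m₀ hlow hP q hq m hlow'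
    by_cases hqq : q₀ = q
    · subst hqq
      rw [height_nb hp x hg hq, ← hM] at hlow hlow'
      -- Two numbers of absolute value less than `|M|` that are congruent modulo `M` differ by at
      -- most one multiple of `M`, and consecutive neighbours are adjacent.
      have hcases : m = m₀ ∨ m = m₀ + 1 ∨ m₀ = m + 1 := by
        by_contra hcon
        push Not at hcon
        have h1 : 2 ≤ (m - m₀).natAbs := by omega
        have h2 : ((m - m₀) * M).natAbs < 2 * M.natAbs := by
          have : (m - m₀) * M = (E.ρ x (E.ρ g (b q₀)) p + m * M) -
            (E.ρ x (E.ρ g (b q₀)) p + m₀ * M) := by ring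
          omega
        rw [Int.natAbs_mul] at h2
        have := Nat.mul_le_mul_right M.natAbs h1
        omega
      rcases hcases with rfl | rfl | rfl
      · exact hP
      · exact hPA _ _ hP (adj_nb_succ hp x g hq m₀) (by rwa [height_nb hp x hg hq])
      · exact hPA _ _ hP (adj_nb_succ hp x g hq m).symm (by rwa [height_nb hp x hg hq])
    · exact hPA _ _ hP (adj_nb_of_ne hp x g hq₀ hq hqq m₀ m) hlow'
  -- Division with remainder by `M`: this is the Euclidean input of the descent.
  have exlow : ∀ g ∈ E.Γ J, ∀ q ∈ J, ∃ m, E.height p (E.nb p x g q m) < M.natAbs := by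
    intro g hg q hq
    refine ⟨-(E.ρ x (E.ρ g (b q)) p / M), ?_⟩
    rw [height_nb hp x hg hq, ← hM]
    have hM0 : M ≠ 0 := by omega
    have h1 := Int.emod_nonneg (E.ρ x (E.ρ g (b q)) p) hM0
    have h2 := Int.emod_lt_abs (E.ρ x (E.ρ g (b q)) p) hM0
    rw [Int.abs_eq_natAbs] at h2
    have h3 := Int.emod_add_mul_ediv (E.ρ x (E.ρ g (b q)) p) M
    have h4 : E.ρ x (E.ρ g (b q)) p + -(E.ρ x (E.ρ g (b q)) p / M) * M =
        E.ρ x (E.ρ g (b q)) p % M := by linarith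
    rw [h4]
    omega
  have hpair : ∀ g₁ ∈ E.Γ J, ∀ k ∈ E.Γ J,
      (∀ q ∈ J, ∀ m, E.height p (E.nb p x g₁ q m) < M.natAbs → P (E.nb p x g₁ q m)) →
      (∀ q ∈ J, ∀ m, E.height p (E.nb p x (g₁ * k) q m) < M.natAbs →
        P (E.nb p x (g₁ * k) q m)) := by
    intro g₁ hg₁ k hk hR
    induction hk using Subgroup.closure_induction_right with
    | one => rwa [mul_one]
    | mul_right k hk g₀ hg₀ ih =>
      have hk' : g₁ * k ∈ E.Γ J := mul_mem hg₁ hk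
      have hg' : g₁ * (k * g₀) ∈ E.Γ J := mul_mem hg₁ (mul_mem hk (Subgroup.subset_closure hg₀))
      obtain ⟨q, hq, δ, hδ, h⟩ := nb_mul_gen (E := E) hp hg₀
      obtain ⟨m, hm⟩ := exlow _ hg' q hq
      obtain ⟨s, hs, e⟩ := h m x (g₁ * k)
      rw [mul_assoc] at e
      refine hreach _ hg' q hq m hm ?_
      rw [e]
      refine hPS _ (ih q hq _ ?_) s hs
      rwa [e, height_mul_right hp hs] at hm
    | mul_inv_cancel k hk g₀ hg₀ ih =>
      have hk' : g₁ * k ∈ E.Γ J := mul_mem hg₁ hk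
      have hg' : g₁ * (k * g₀⁻¹) ∈ E.Γ J :=
        mul_mem hg₁ (mul_mem hk (inv_mem (Subgroup.subset_closure hg₀)))
      obtain ⟨q, hq, δ, hδ, h⟩ := nb_mul_gen (E := E) hp hg₀
      obtain ⟨m, hm⟩ := exlow _ hg' q hq
      obtain ⟨s, hs, e⟩ := h (δ * m) x (g₁ * (k * g₀⁻¹))
      have e1 : g₁ * (k * g₀⁻¹) * g₀ = g₁ * k := by group
      have e2 : δ * (δ * m) = m := by rw [← mul_assoc, hδ, one_mul]
      rw [e1, e2] at e
      have e' : E.nb p x (g₁ * (k * g₀⁻¹)) q m = E.nb p x (g₁ * k) q (δ * m) * s⁻¹ := by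
        rw [e, mul_inv_cancel_right]
      refine hreach _ hg' q hq m hm ?_
      rw [e']
      refine hPS _ (ih q hq _ ?_) _ (inv_mem hs)
      rwa [e', height_mul_right hp (inv_mem hs)] at hm
  obtain ⟨g, hg, q, hq, m, s, hs, rfl⟩ := exists_nb hp hy
  obtain ⟨g', hg', q', hq', m', s', hs', rfl⟩ := exists_nb hp hz
  rw [height_mul_right hp hs] at hyx
  rw [height_mul_right hp hs'] at hzx
  have hP : P (E.nb p x g q m) := by
    have := hPS _ hPy _ (inv_mem hs)
    rwa [mul_inv_cancel_right] at this
  have := hpair g hg (g⁻¹ * g') (mul_mem (inv_mem hg) hg') (hreach g hg q hq m hyx hP)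
  rw [mul_inv_cancel_left] at this
  exact hPS _ (this q' hq' m' hzx) s' hs'

/-- The height of the neighbour is the absolute value of a number a + mM. Equality with `|M|` means
that this number is M or -M, so changing `m` by one makes it zero, and consecutive neighbours are
adjacent. -/
theorem exists_common_low {x z : Q} (hx : 0 < E.height p x) (hz : E.Adj J p x z)
    (hzx : E.height p z = E.height p x) :
    ∃ u, E.Adj J p x u ∧ E.Adj J p z u ∧ E.height p u < E.height p x := by
  obtain ⟨g, hg, q, hq, m, s, hs, rfl⟩ := exists_nb hp hz
  rw [height_mul_right hp hs, height_nb hp x hg hq] at hzx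
  have hxM : E.height p x = (E.ρ x (b p) p).natAbs := rfl
  rw [hxM] at hx hzx ⊢
  set M := E.ρ x (b p) p with hM
  rcases Int.natAbs_eq_natAbs_iff.1 hzx with h | h
  · refine ⟨E.nb p x g q (m - 1), adj_nb hp x hg hq _, ?_, ?_⟩
    · have := (adj_nb_succ (E := E) hp x g hq (m - 1)).symm
      rw [sub_add_cancel] at this
      exact this.mul_right_left hs
    · rw [height_nb hp x hg hq, ← hM, sub_one_mul]; omega
  · refine ⟨E.nb p x g q (m + 1), adj_nb hp x hg hq _,
      (adj_nb_succ (E := E) hp x g hq m).mul_right_left hs, ?_⟩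
    rw [height_nb hp x hg hq, ← hM, add_one_mul]; omega

end

end ElementarySystem


namespace ElementarySystem

/-! ### Uniqueness of lifts of lines and faithfulness -/

variable {α Q : Type*} [DecidableEq α] [Group Q] {E : ElementarySystem α Q}

theorem SameLine.refl (v : α → ℤ) : SameLine v v := Or.inl rfl

/-- A vector supported on `insert p J` which has value one under a functional killing `b p` is,
up to sign, the image of the line of a standard neighbour. -/
theorem exists_nb_line {J K : Finset α} {p : α} (hp : p ∉ J) (hKJ : K ⊆ J) (x : Q) {u : α → ℤ}
    (hu : ∀ k ∉ insert p K, u k = 0)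
    (f : (α → ℤ) →ₗ[ℤ] ℤ) (hf : f u = 1) (hfp : f (b p) = 0) :
    ∃ h ∈ E.Γ K, ∃ r ∈ K, ∃ m : ℤ,
      SameLine (E.ρ (E.nb p x h r m) (b p)) (E.ρ x u) := by
  obtain ⟨h, hh, r, hr, hv⟩ := exists_unimodular (E := E) (K := K) (v := u - u p • b p)
    (fun k hk => by
      by_cases hkp : k = p
      · subst hkp; simp
      · simp [b_of_ne hkp, hu k (by simp [hkp, hk])]) f (by rw [map_sub, map_smul, hfp, hf]; simp)
  rcases hv with hv | hv
  · refine ⟨h, hh, r, hr, u p, Or.inl ?_⟩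
    rw [ρ_nb hp x (Γ_mono hKJ hh) (hKJ hr), hv, sub_add_cancel]
  · refine ⟨h, hh, r, hr, -u p, Or.inr ?_⟩
    rw [ρ_nb hp x (Γ_mono hKJ hh) (hKJ hr), hv, ← map_neg]
    congr 1
    rw [neg_smul]; abel

/-- Two cosets over the same line are not yet known to be equal, but they have neighbours over the
same lines. This is the path lifting needed for the induction on height. -/
theorem exists_adj_of_line {J : Finset α} {p : α} (hp : p ∉ J) {x x' y' : Q}
    (hx : x ∈ E.Γ (insert p J)) (hx' : x' ∈ E.Γ (insert p J))
    (hl : SameLine (E.ρ x (b p)) (E.ρ x' (b p))) (h : E.Adj J p x' y') :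
    ∃ z, E.Adj J p x z ∧ SameLine (E.ρ z (b p)) (E.ρ y' (b p)) := by
  obtain ⟨g, hg, q, hq, m, s, hs, rfl⟩ := exists_nb hp h
  have hpq : p ≠ q := by rintro rfl; exact hp hq
  set t := x⁻¹ * x' with ht
  have htl : SameLine (E.ρ t (b p)) (b p) := by
    have := hl.map (E := E) x⁻¹
    rw [ρ_inv_apply_self, ← ρ_mul_apply] at this
    exact this.symm
  have htl' : SameLine (E.ρ t⁻¹ (b p)) (b p) := by
    have := htl.map (E := E) t⁻¹
    rw [ρ_inv_apply_self] at this
    exact this.symm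
  have hgp : E.ρ g⁻¹ (b p) = b p := ρ_Γ_b (inv_mem hg) hp
  -- This functional is one on the target vector and zero on `b p`, which certifies that the vector
  -- remains unimodular modulo `b p`.
  set f : (α → ℤ) →ₗ[ℤ] ℤ := (LinearMap.proj q : (α → ℤ) →ₗ[ℤ] ℤ) ∘ₗ E.ρ (g⁻¹ * t⁻¹) with hf
  have hfa : ∀ v, f v = E.ρ g⁻¹ (E.ρ t⁻¹ v) q := fun v => by
    rw [← ρ_mul_apply]; rfl
  have hinsert : ∀ k ∉ insert p J, (E.ρ g (b q) + m • b p : α → ℤ) k = 0 := fun k hk => by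
    have hkp : k ≠ p := by rintro rfl; simp at hk
    have hkJ : k ∉ J := fun h => hk (Finset.mem_insert_of_mem h)
    have hkq : k ≠ q := by rintro rfl; exact hkJ hq
    simp [ρ_Γ_apply_of_notMem hg (b q) hkJ, b_of_ne hkp, b_of_ne hkq]
  obtain ⟨h, hh, r, hr, n, hz⟩ := exists_nb_line (E := E) hp subset_rfl x
    (u := E.ρ t (E.ρ g (b q) + m • b p)) (fun k hk => by
      rw [ρ_Γ_apply_of_notMem (mul_mem (inv_mem hx) hx') _ hk, hinsert k hk]) f
    (by
      rw [hfa, ρ_inv_apply_self, map_add, map_smul, ρ_inv_apply_self, hgp]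
      simp [b_of_ne hpq.symm])
    (by
      rw [hfa]
      rcases htl' with e | e <;> rw [e] <;> simp [hgp, b_of_ne hpq.symm])
  refine ⟨_, adj_nb hp x hh hr n, hz.trans ?_⟩
  refine SameLine.trans (Or.inl ?_) (sameLine_S hp hs _).symm
  rw [ρ_nb hp x' hg hq, ← ρ_mul_apply, ht, mul_inv_cancel_left]

section

variable {J : Finset α} {p : α} (hp : p ∉ J)
include hp

theorem mem_Γ_of_adj {x y : Q} (hx : x ∈ E.Γ (insert p J)) (h : E.Adj J p x y) :
    y ∈ E.Γ (insert p J) := by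
  have hS : E.S J p ≤ E.Γ (insert p J) := by
    refine sup_le (sup_le (Γ_mono (Finset.subset_insert _ _)) ?_) ?_
    · exact T_le_Γ (Finset.subset_insert _ _) (Finset.mem_insert_self _ _) hp
    · rw [Subgroup.closure_le]; rintro _ rfl; exact ι_mem_Γ (Finset.mem_insert_self _ _)
  obtain ⟨q, hq, s, hs, s', hs', rfl⟩ := h
  exact mul_mem (mul_mem (mul_mem hx (hS hs))
    (w_mem_Γ (Finset.mem_insert_self _ _) (Finset.mem_insert_of_mem hq))) (hS hs')

/-- The link of the base vertex is closed under moving to vertices of height zero. -/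
theorem base_closed (IH : E.StabilizerHyp J) {y z : Q} (hy : E.Adj J p 1 y)
    (hy0 : E.height p y = 0) (hyz : E.Adj J p y z) (hz0 : E.height p z = 0) :
    E.Adj J p 1 z := by
  obtain ⟨g, hg, q, hq, m, s, hs, rfl⟩ := exists_nb hp hy
  have hpq : p ≠ q := by rintro rfl; exact hp hq
  have hgp : E.ρ g (b q) p = 0 := by
    rw [ρ_Γ_apply_of_notMem hg _ hp, b_of_ne hpq]
  rw [height_mul_right hp hs, height_nb hp 1 hg hq, map_one, Module.End.one_apply,
    Module.End.one_apply, hgp] at hy0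
  have hm : m = 0 := by simpa using hy0
  subst hm
  have hyz' : E.Adj J p (g * E.w p q) z := by
    have := hyz.mul_right_left (inv_mem hs)
    rwa [mul_inv_cancel_right, nb, zpow_zero, mul_one, one_mul] at this
  obtain ⟨g', hg', r, hr, n, s', hs', rfl⟩ := exists_nb hp hyz'
  have hpr : p ≠ r := by rintro rfl; exact hp hr
  have hv0 : E.ρ g' (b r) p = 0 := by rw [ρ_Γ_apply_of_notMem hg' _ hp, b_of_ne hpr]
  -- Height zero of `z` kills the `q`-th coordinate, so its line can be reached using only the
  -- indices in `J.erase q`. That subgroup commutes with `w p q`, so the new neighbour can be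
  -- rewritten as a neighbour of `1`.
  have hvq : E.ρ g' (b r) q = 0 := by
    have h1 : E.height p (E.nb p (g * E.w p q) g' r n) = 0 := by
      rwa [height_mul_right hp hs'] at hz0
    rw [height, ρ_nb hp _ hg' hr, ρ_mul_apply, ρ_Γ_apply_of_notMem hg _ hp, w, E.ρ_perm] at h1
    simpa [b_of_ne hpq.symm] using h1
  obtain ⟨h, hh, r', hr', n', hl⟩ := exists_nb_line (E := E) hp (Finset.erase_subset q J)
    (g * E.w p q) (u := E.ρ g' (b r) + n • b p) (fun k hk => by
      simp only [Finset.mem_insert, Finset.mem_erase, not_or, not_and] at hk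
      by_cases hkq : k = q
      · subst hkq; simp [hvq, b_of_ne hpq.symm]
      · simp [b_of_ne hk.1, ρ_Γ_apply_of_notMem hg' _ (hk.2 hkq),
          b_of_ne (show k ≠ r by rintro rfl; exact hk.2 hkq hr)])
    ((LinearMap.proj r : (α → ℤ) →ₗ[ℤ] ℤ) ∘ₗ E.ρ g'⁻¹)
    (by
      simp only [LinearMap.comp_apply, map_add, ρ_inv_apply_self, map_smul,
        ρ_Γ_b (inv_mem hg') hp]
      simp [b_of_ne hpr.symm])
    (by simp [LinearMap.comp_apply, ρ_Γ_b (inv_mem hg') hp, b_of_ne hpr.symm])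
  have hr'J := Finset.mem_of_mem_erase hr'
  have hqr' : q ≠ r' := (Finset.ne_of_mem_erase hr').symm
  have hpr' : p ≠ r' := by rintro rfl; exact hp hr'J
  have hhJ := Γ_mono (E := E) (Finset.erase_subset q J) hh
  have hmem := Adj.unique hp IH (adj_nb hp (g * E.w p q) hhJ hr'J n')
    (adj_nb hp (g * E.w p q) hg' hr n) (hl.trans (Or.inl (by rw [ρ_nb hp _ hg' hr])))
  suffices E.Adj J p 1 (E.nb p (g * E.w p q) h r' n') by
    have h2 := this.mul_right (mul_mem hmem hs')
    rwa [← mul_assoc, mul_inv_cancel_left] at h2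
  have hwh : E.w p q * h * (E.w p q)⁻¹ = h := by
    suffices E.Γ (J.erase q) ≤ Subgroup.centralizer {E.w p q} by
      have := Subgroup.mem_centralizer_singleton_iff.1 (this hh)
      rw [← this, mul_inv_cancel_right]
    have hfix : ∀ i ∈ J.erase q, Equiv.swap p q i = i := fun i hi =>
      Equiv.swap_apply_of_ne_of_ne (by rintro rfl; exact hp (Finset.mem_of_mem_erase hi))
        (Finset.ne_of_mem_erase hi)
    rw [Γ, Subgroup.closure_le]
    rintro _ (⟨i, hi, j, hj, hij, rfl⟩ | ⟨i, hi, rfl⟩)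
    · rw [SetLike.mem_coe, Subgroup.mem_centralizer_singleton_iff, w, E.perm_e _ i j hij,
        hfix i hi, hfix j hj]
    · rw [SetLike.mem_coe, Subgroup.mem_centralizer_singleton_iff, w, E.perm_ι, hfix i hi]
  have hwe : E.w p q * E.e r' p ^ n' = E.e r' q ^ n' * E.w p q :=
    w_conj_e_zpow hpr' hqr'.symm n'
  have e : E.nb p (g * E.w p q) h r' n' =
      1 * (g * h * E.e r' q ^ n') * E.w p r' * E.w q r' := by
    calc _ = g * (E.w p q * h * (E.w p q)⁻¹) * (E.w p q * E.e r' p ^ n') * E.w p r' := by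
          rw [nb]; group
      _ = g * h * E.e r' q ^ n' * (E.w p q * E.w p r') := by
        rw [hwh, hwe]; simp only [mul_assoc]
      _ = _ := by rw [w_mul_w hpq hpr' hqr']; simp only [mul_assoc, one_mul]
  rw [e]
  exact ⟨r', hr'J, _, Γ_le_S J p (mul_mem (mul_mem hg hhJ)
    (zpow_mem (e_mem_Γ hr'J hq hqr'.symm) _)), _, Γ_le_S J p (w_mem_Γ hq hr'J), rfl⟩

omit hp in
/-- The increasing sequence of vertex sets reachable from the link of the base vertex with
bounded height. -/
def reach (E : ElementarySystem α Q) (J : Finset α) (p : α) : ℕ → Q → Prop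
  | 0, y => E.Adj J p 1 y ∧ E.height p y = 0
  | n + 1, y => reach E J p n y ∨ (E.height p y = n + 1 ∧ ∃ x, reach E J p n x ∧ E.Adj J p x y)

theorem reach_mul_right {n : ℕ} {y s : Q} (h : E.reach J p n y) (hs : s ∈ E.S J p) :
    E.reach J p n (y * s) := by
  induction n with
  | zero => exact ⟨h.1.mul_right hs, by rw [height_mul_right hp hs]; exact h.2⟩
  | succ n ih =>
    rcases h with h | ⟨h, x, hx, hxy⟩
    · exact Or.inl (ih h)
    · exact Or.inr ⟨by rw [height_mul_right hp hs, h], x, hx, hxy.mul_right hs⟩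

omit hp in
theorem reach_height {n : ℕ} {y : Q} (h : E.reach J p n y) : E.height p y ≤ n := by
  induction n with
  | zero => exact h.2.le
  | succ n ih =>
    rcases h with h | ⟨h, -⟩
    · exact (ih h).trans n.le_succ
    · exact h.le

theorem reach_mem {n : ℕ} {y : Q} (h : E.reach J p n y) : y ∈ E.Γ (insert p J) := by
  induction n generalizing y with
  | zero => exact mem_Γ_of_adj hp (one_mem _) h.1
  | succ n ih =>
    rcases h with h | ⟨h, x, hx, hxy⟩
    · exact ih h
    · exact mem_Γ_of_adj hp (ih hx) hxy

/-- The two properties support each other. Closure under adjacency comes from `low_link`. For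
injectivity at height `n + 1`, a lower neighbour of one coset is lifted to the other, identified by
the induction hypothesis, and `Adj.unique` is applied at that common neighbour. -/
theorem reach_spec (IH : E.StabilizerHyp J) (n : ℕ) :
    (∀ x y, E.reach J p n x → E.Adj J p x y → E.height p y ≤ n → E.reach J p n y) ∧
    (∀ x y, E.reach J p n x → E.reach J p n y → SameLine (E.ρ x (b p)) (E.ρ y (b p)) →
      x⁻¹ * y ∈ E.S J p) := by
  induction n with
  | zero =>
    refine ⟨fun x y hx hxy hy => ⟨base_closed hp IH hx.1 hx.2 hxy (Nat.le_zero.1 hy),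
      Nat.le_zero.1 hy⟩, fun x y hx hy h => Adj.unique hp IH hx.1 hy.1 h⟩
  | succ n ih =>
    obtain ⟨ih1, ih2⟩ := ih
    have low : ∀ x y, E.height p x = n + 1 → (∃ z, E.reach J p n z ∧ E.Adj J p z x) →
        E.Adj J p x y → E.height p y ≤ n → E.reach J p n y := by
      rintro x y hx ⟨z, hz, hzx⟩ hxy hy
      refine low_link hp (by omega) (E.reach J p n) (fun y hy s hs => reach_mul_right hp hy hs)
        (fun y z hy hyz hz => ih1 y z hy hyz (by omega)) hzx.symm ?_ hz hxy (by omega)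
      have := reach_height hz
      omega
    refine ⟨fun x y hx hxy hy => ?_, fun x y hx hy hl => ?_⟩
    · rcases Nat.lt_or_ge n (E.height p y) with hy' | hy'
      · have hy1 : E.height p y = n + 1 := by omega
        rcases hx with hx | ⟨hx, hz⟩
        · exact Or.inr ⟨hy1, x, hx, hxy⟩
        -- A horizontal edge is replaced by a detour through a lower vertex, because a new vertex
        -- must be adjacent to an old one.
        · obtain ⟨u, hxu, hyu, hu⟩ := exists_common_low hp (by omega) hxy (by omega)
          exact Or.inr ⟨hy1, u, low x u hx hz hxu (by omega), hyu.symm⟩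
      · rcases hx with hx | ⟨hx, hz⟩
        · exact Or.inl (ih1 x y hx hxy hy')
        · exact Or.inl (low x y hx hz hxy hy')
    · have hxy := height_eq_of_sameLine hl
      rcases hx with hx | ⟨hx, hz⟩
      · rcases hy with hy | ⟨hy, -⟩
        · exact ih2 x y hx hy hl
        · have := reach_height hx
          omega
      · rcases hy with hy | ⟨hy, z', hz', hzy⟩
        · have := reach_height hy
          omega
        · have hxm : x ∈ E.Γ (insert p J) := by
            obtain ⟨z, hz, hzx⟩ := hz
            exact mem_Γ_of_adj hp (reach_mem hp hz) hzx
          obtain ⟨u, hxu, hu⟩ := exists_adj_of_line hp hxm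
            (mem_Γ_of_adj hp (reach_mem hp hz') hzy) hl hzy.symm
          have hun : E.reach J p n u := by
            refine low x u hx hz hxu ?_
            rw [height_eq_of_sameLine hu]
            exact reach_height hz'
          have huz := ih2 u z' hun hz' hu
          have huy : E.Adj J p u y := by
            have := hzy.mul_right_left (inv_mem huz)
            rwa [mul_inv_rev, inv_inv, mul_inv_cancel_left] at this
          exact Adj.unique hp IH hxu.symm huy hl

omit hp in
theorem reach_mono {m n : ℕ} (h : m ≤ n) {x : Q} (hx : E.reach J p m x) : E.reach J p n x := by
  induction h with
  | refl => exact hx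
  | step _ ih => exact Or.inl ih

/-- Every generator of the larger group either lies in `S`, and preserves the coset, or is `e p j`,
and leads to an adjacent coset. The base coset itself has height one and enters through its
neighbour `w p q`. -/
theorem exists_reach (IH : E.StabilizerHyp J) (hJ : J.Nonempty) {x : Q}
    (hx : x ∈ E.Γ (insert p J)) : ∃ n, E.reach J p n x := by
  obtain ⟨q, hq⟩ := hJ
  have hpq : p ≠ q := by rintro rfl; exact hp hq
  have h1w : E.Adj J p 1 (E.w p q) :=
    ⟨q, hq, 1, one_mem _, 1, one_mem _, by rw [one_mul, one_mul, mul_one]⟩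
  have key : ∀ x ∈ E.Γ (insert p J), (∃ n, E.reach J p n x) →
      (∀ s ∈ E.S J p, ∃ n, E.reach J p n (x * s)) ∧
      (∀ y, E.Adj J p x y → ∃ n, E.reach J p n y) := by
    rintro x - ⟨n, hn⟩
    refine ⟨fun s hs => ⟨n, reach_mul_right hp hn hs⟩, fun y hy => ?_⟩
    exact ⟨max n (E.height p y), (reach_spec hp IH _).1 x y (reach_mono (le_max_left _ _) hn) hy
      (le_max_right _ _)⟩
  induction hx using Subgroup.closure_induction_right with
  | one =>
    refine ⟨1, Or.inr ⟨?_, E.w p q, ⟨h1w, ?_⟩, h1w.symm⟩⟩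
    · simp [height]
    · rw [height, ρ_w_b, b_of_ne hpq]; rfl
  | mul_right x hx g hg ih =>
    obtain ⟨k1, k2⟩ := key x hx ih
    rcases hg with ⟨i, hi, j, hj, hij, rfl⟩ | ⟨i, hi, rfl⟩
    · rcases Finset.mem_insert.1 hi with rfl | hi'
      · have hj' : j ∈ J := (Finset.mem_insert.1 hj).resolve_left hij.symm
        have := (adj_one_e (E := E) hp hj').mul_left x
        rw [mul_one] at this
        exact k2 _ this
      · refine k1 _ ?_
        rcases Finset.mem_insert.1 hj with rfl | hj'
        · exact T_le_S J _ (e_mem_T hi')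
        · exact Γ_le_S J p (e_mem_Γ hi' hj' hij)
    · refine k1 _ ?_
      rcases Finset.mem_insert.1 hi with rfl | hi'
      · exact ι_mem_S J _
      · exact Γ_le_S J p (ι_mem_Γ hi')
  | mul_inv_cancel x hx g hg ih =>
    obtain ⟨k1, k2⟩ := key x hx ih
    rcases hg with ⟨i, hi, j, hj, hij, rfl⟩ | ⟨i, hi, rfl⟩
    · rcases Finset.mem_insert.1 hi with rfl | hi'
      · have hj' : j ∈ J := (Finset.mem_insert.1 hj).resolve_left hij.symm
        have := ((adj_one_e (E := E) hp hj').mul_left (x * (E.e i j)⁻¹)).symm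
        rw [mul_one, inv_mul_cancel_right] at this
        exact k2 _ this
      · refine k1 _ (inv_mem ?_)
        rcases Finset.mem_insert.1 hj with rfl | hj'
        · exact T_le_S J _ (e_mem_T hi')
        · exact Γ_le_S J p (e_mem_Γ hi' hj' hij)
    · refine k1 _ (inv_mem ?_)
      rcases Finset.mem_insert.1 hi with rfl | hi'
      · exact ι_mem_S J _
      · exact Γ_le_S J p (ι_mem_Γ hi')

end

/-- An element preserving the line of `b p` lies over the same line as `1`. Both are reached at some
stage, and there the lift of a line is unique modulo `S`. With one index only, the group is
generated by `ι p`. -/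
theorem stabilizerHyp (E : ElementarySystem α Q) (I : Finset α) : E.StabilizerHyp I := by
  induction I using Finset.strongInduction with
  | H I ih =>
    intro p hpI x hx hl
    have hp : p ∉ I.erase p := Finset.notMem_erase p I
    have hI : insert p (I.erase p) = I := Finset.insert_erase hpI
    have IH := ih _ (Finset.erase_ssubset hpI)
    rcases (I.erase p).eq_empty_or_nonempty with hJ | hJ
    · have hs : I = {p} := by rw [← hI, hJ]; rfl
      suffices E.Γ I ≤ E.S (I.erase p) p from this hx
      rw [Γ, Subgroup.closure_le]
      rintro _ (⟨i, hi, j, hj, hij, rfl⟩ | ⟨i, hi, rfl⟩)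
      · rw [hs, Finset.mem_singleton] at hi hj
        exact absurd (hi.trans hj.symm) hij
      · rw [hs, Finset.mem_singleton] at hi
        exact hi ▸ ι_mem_S _ _
    · obtain ⟨m, hm⟩ := exists_reach hp IH hJ (x := x) (by rwa [hI])
      obtain ⟨n, hn⟩ := exists_reach hp IH hJ (x := 1) (one_mem _)
      have := (reach_spec hp IH (max m n)).2 1 x (reach_mono (le_max_right _ _) hn)
        (reach_mono (le_max_left _ _) hm) (by rw [map_one, Module.End.one_apply]; exact hl.symm)
      rwa [inv_one, one_mul] at this

theorem T_eq_one {K : Finset α} {p : α} (hp : p ∉ K) {t : Q} (ht : t ∈ E.T K p)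
    (h : ∀ q ∈ K, E.ρ t (b q) = b q) : t = 1 := by
  induction K using Finset.induction_on generalizing t with
  | empty =>
    have : E.T (∅ : Finset α) p = ⊥ := by
      rw [T, Subgroup.closure_eq_bot_iff]; rintro _ ⟨i, hi, -⟩; simp at hi
    rwa [this, Subgroup.mem_bot] at ht
  | insert a K ha ih =>
    have hap : a ≠ p := by rintro rfl; simp at hp
    have hpK : p ∉ K := fun h => hp (Finset.mem_insert_of_mem h)
    obtain ⟨m, t', ht', rfl⟩ := T_split hp (Finset.mem_insert_self a K) ht
    rw [Finset.erase_insert ha] at ht'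
    have h1 := h a (Finset.mem_insert_self a K)
    have h2 : E.ρ t' (b a) = b a :=
      ρ_T_fix hpK ht' fun k hk => b_of_ne (by rintro rfl; exact ha hk)
    rw [ρ_mul_apply, h2, ρ_e_zpow_b hap, add_eq_left] at h1
    have hm : m = 0 := by simpa using congrFun h1 p
    subst hm
    rw [zpow_zero, one_mul] at h ⊢
    exact ih hpK ht' fun q hq => h q (Finset.mem_insert_of_mem hq)

/-- The action on `ℤ^α` is faithful on the groups `Γ I`. -/
theorem faithful (E : ElementarySystem α Q) (I : Finset α) {x : Q} (hx : x ∈ E.Γ I)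
    (h : E.ρ x = 1) : x = 1 := by
  induction I using Finset.strongInduction generalizing x with
  | H I ih =>
    rcases I.eq_empty_or_nonempty with rfl | ⟨p, hpI⟩
    · have : E.Γ (∅ : Finset α) = ⊥ := by
        rw [Γ, Subgroup.closure_eq_bot_iff]
        rintro _ (⟨i, hi, -⟩ | ⟨i, hi, -⟩) <;> simp at hi
      rwa [this, Subgroup.mem_bot] at hx
    have hp : p ∉ I.erase p := Finset.notMem_erase p I
    have hS := E.stabilizerHyp I p hpI x hx (by rw [h]; exact SameLine.refl _)
    obtain ⟨t, ht, g, hg, ε, hε, rfl⟩ := S_normal_form hp hS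
    have hε1 : ε = 1 := by
      rcases hε with rfl | rfl
      · rfl
      · have h1 := LinearMap.congr_fun h (b p)
        have h2 : E.ρ (E.ι p) (b p) = -b p := by
          rw [E.ρ_ι]
          ext k
          by_cases hk : k = p
          · subst hk; simp
          · simp [hk]
        rw [ρ_mul_apply, h2, map_neg, ρ_mul_apply, ρ_Γ_b hg hp, ρ_T_fix hp ht
          (fun k hk => b_of_ne (by rintro rfl; exact hp hk)), Module.End.one_apply] at h1
        have := congrFun h1 p
        simp at this
    subst hε1
    rw [mul_one] at h ⊢
    -- The factor `t` alters only the `p`-th coordinate and `g` only the others, so each factor acts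
    -- trivially by itself.
    have hg1 : ∀ q ∈ I.erase p, E.ρ g (b q) = b q := by
      intro q hq
      have h1 := LinearMap.congr_fun h (b q)
      rw [ρ_mul_apply, Module.End.one_apply] at h1
      ext k
      by_cases hk : k = p
      · subst hk
        exact ρ_Γ_apply_of_notMem hg _ hp
      · rw [← congrFun h1 k, ρ_T_apply_of_ne hp ht _ hk]
    have ht1 : t = 1 := T_eq_one hp ht fun q hq => by
      have h1 := LinearMap.congr_fun h (b q)
      rwa [ρ_mul_apply, Module.End.one_apply, hg1 q hq] at h1
    subst ht1
    rw [one_mul] at h ⊢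
    exact ih _ (Finset.erase_ssubset hpI) hg h

end ElementarySystem


namespace AutFree

/-! ### Magnus's theorem -/

section Quotient

variable {α : Type*} [DecidableEq α]

open FreeGroup (of)
open scoped commutatorElement

theorem nielsen_comm_of_ne {i j k l : α} (hij : i ≠ j) (hkl : k ≠ l) (hjk : j ≠ k) (hil : i ≠ l)
    (hik : i ≠ k) : nielsen i j * nielsen k l = nielsen k l * nielsen i j := by
  apply mulAut_ext
  intro b
  simp only [MulAut.mul_apply]
  by_cases hb : b = i
  · subst hb
    rw [nielsen_of_ne _ hik, nielsen_self hij.symm, map_mul, nielsen_of_ne _ hik,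
      nielsen_of_ne _ hjk]
  · by_cases hb' : b = k
    · subst hb'
      rw [nielsen_self hkl.symm, nielsen_of_ne _ hb, nielsen_self hkl.symm, map_mul,
        nielsen_of_ne _ hb, nielsen_of_ne _ hil.symm]
    · simp only [nielsen_of_ne _ hb, nielsen_of_ne _ hb']

theorem nielsen_rel {i j k : α} (hij : i ≠ j) (hjk : j ≠ k) (hik : i ≠ k) :
    nielsen j k * nielsen i j = nielsen i j * nielsen j k * nielsen i k := by
  apply mulAut_ext
  intro b
  simp only [MulAut.mul_apply]
  by_cases hb : b = i
  · subst hb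
    rw [nielsen_self hij.symm, map_mul, nielsen_of_ne _ hij, nielsen_self hjk.symm,
      nielsen_self hik.symm]
    simp only [map_mul]
    rw [nielsen_of_ne _ hij, nielsen_self hij.symm, nielsen_of_ne _ hjk.symm,
      nielsen_of_ne _ hik.symm, mul_assoc]
  · by_cases hb' : b = j
    · subst hb'
      rw [nielsen_of_ne _ hb, nielsen_self hjk.symm, nielsen_of_ne _ hb, nielsen_self hjk.symm,
        map_mul, nielsen_of_ne _ hb, nielsen_of_ne _ hik.symm]
    · simp only [nielsen_of_ne _ hb, nielsen_of_ne _ hb']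

theorem inversion_comm (i j : α) : inversion i * inversion j = inversion j * inversion i := by
  by_cases hij : i = j
  · rw [hij]
  apply mulAut_ext
  intro b
  simp only [MulAut.mul_apply]
  by_cases hb : b = i
  · subst hb
    rw [inversion_of_ne hij, inversion_self, map_inv, inversion_of_ne hij]
  · by_cases hb' : b = j
    · subst hb'
      rw [inversion_of_ne hb, inversion_self, map_inv, inversion_of_ne hb]
    · simp only [inversion_of_ne hb, inversion_of_ne hb']

theorem inversion_comm_nielsen {i j k : α} (hij : i ≠ j) (hki : k ≠ i) (hkj : k ≠ j) :
    inversion k * nielsen i j = nielsen i j * inversion k := by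
  rw [nielsen, conj_transv (inversion_of_ne hki.symm) inversion_map_away (one_mem _)
    (of_mem_away hij.symm), map_one, inversion_of_ne hkj.symm]

theorem permAut_mul_nielsen (σ : Equiv.Perm α) {i j : α} (hij : i ≠ j) :
    permAut σ * nielsen i j = nielsen (σ i) (σ j) * permAut σ := by
  apply mulAut_ext
  intro b
  simp only [MulAut.mul_apply]
  by_cases hb : b = i
  · subst hb
    rw [nielsen_self hij.symm, map_mul, permAut_of, permAut_of,
      nielsen_self (σ.injective.ne hij.symm)]
  · rw [nielsen_of_ne _ hb, permAut_of, nielsen_of_ne _ (σ.injective.ne hb)]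

theorem permAut_mul_inversion (σ : Equiv.Perm α) (i : α) :
    permAut σ * inversion i = inversion (σ i) * permAut σ := by
  apply mulAut_ext
  intro b
  simp only [MulAut.mul_apply]
  by_cases hb : b = i
  · subst hb
    rw [inversion_self, map_inv, permAut_of, inversion_self]
  · rw [inversion_of_ne hb, permAut_of, inversion_of_ne (σ.injective.ne hb)]

/-- The exponent vector of a word. -/
def exponents : FreeGroup α →* Multiplicative (α → ℤ) :=
  FreeGroup.lift fun i => Multiplicative.ofAdd (Pi.single i 1)

theorem exponents_of (i : α) : exponents (of i) = Multiplicative.ofAdd (Pi.single i 1) := by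
  simp [exponents]

variable [Fintype α]

/-- The linear map of `ℤ^α` induced by an automorphism. -/
noncomputable def abAction : MulAut (FreeGroup α) →* Module.End ℤ (α → ℤ) :=
  let f : MulAut (FreeGroup α) → Module.End ℤ (α → ℤ) := fun φ =>
    (Pi.basisFun ℤ α).constr ℤ fun i => (exponents (φ (of i))).toAdd
  have hf : ∀ φ w, f φ (exponents w).toAdd = (exponents (φ w)).toAdd := by
    intro φ w
    have : (AddMonoidHom.toMultiplicative (f φ).toAddMonoidHom).comp exponents =
        exponents.comp φ.toMonoidHom := by
      ext1 i
      rw [MonoidHom.comp_apply, exponents_of]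
      have h1 := (Pi.basisFun ℤ α).constr_basis ℤ (fun i => (exponents (φ (of i))).toAdd) i
      rw [Pi.basisFun_apply] at h1
      exact congrArg Multiplicative.ofAdd h1
    exact congrArg Multiplicative.toAdd (DFunLike.congr_fun this w)
  have hb : ∀ f g : Module.End ℤ (α → ℤ), (∀ i, f (exponents (of i)).toAdd =
      g (exponents (of i)).toAdd) → f = g := by
    intro f g h
    refine (Pi.basisFun ℤ α).ext fun i => ?_
    have := h i
    rwa [exponents_of, toAdd_ofAdd, ← Pi.basisFun_apply] at this
  { toFun := f
    map_one' := hb _ _ fun i => by rw [hf]; rfl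
    map_mul' := fun φ ψ => hb _ _ fun i => by
      rw [Module.End.mul_apply, hf, hf, hf]; rfl }

theorem abAction_single (φ : MulAut (FreeGroup α)) (i : α) :
    abAction φ (Pi.single i 1) = (exponents (φ (of i))).toAdd := by
  have h1 := (Pi.basisFun ℤ α).constr_basis ℤ (fun i => (exponents (φ (of i))).toAdd) i
  rwa [Pi.basisFun_apply] at h1

theorem end_ext {f g : Module.End ℤ (α → ℤ)} (h : ∀ i, f (Pi.single i 1) = g (Pi.single i 1)) :
    f = g := (Pi.basisFun ℤ α).ext fun i => by rw [Pi.basisFun_apply, h]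

theorem exponents_commutator (u v : FreeGroup α) : exponents ⁅u, v⁆ = 1 := by
  rw [map_commutatorElement, commutatorElement_eq_one_iff_mul_comm, mul_comm]

theorem abAction_eq_one_of_mem {φ : MulAut (FreeGroup α)} (h : φ ∈ magnusSubgroup α) :
    abAction φ = 1 := by
  suffices magnusSubgroup α ≤ (abAction (α := α)).ker from this h
  rw [magnusSubgroup, Subgroup.closure_le]
  rintro _ (⟨a, b, hab, rfl⟩ | ⟨a, b, c, hab, hac, -, rfl⟩)
  · refine end_ext fun i => ?_
    rw [abAction_single, Module.End.one_apply]
    by_cases hi : i = a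
    · subst hi
      rw [partialConj_self (of_mem_away hab), map_mul exponents, map_mul exponents,
        map_inv exponents, mul_comm, mul_inv_cancel_left, exponents_of, toAdd_ofAdd]
    · rw [partialConj_of_ne hi, exponents_of, toAdd_ofAdd]
  · refine end_ext fun i => ?_
    rw [abAction_single, Module.End.one_apply]
    by_cases hi : i = a
    · subst hi
      rw [rightMul_self (commutator_mem_away (of_mem_away hab) (of_mem_away hac)), map_mul,
        exponents_commutator, mul_one, exponents_of, toAdd_ofAdd]
    · rw [rightMul_of_ne hi, exponents_of, toAdd_ofAdd]

theorem abAction_nielsen {i j : α} (h : i ≠ j) (v : α → ℤ) :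
    abAction (nielsen i j) v = Function.update v j (v j + v i) := by
  let f : Module.End ℤ (α → ℤ) :=
    { toFun := fun v => Function.update v j (v j + v i)
      map_add' := fun v w => by
        ext k
        by_cases hk : k = j
        · subst hk; simp; ring
        · simp [hk]
      map_smul' := fun c v => by
        ext k
        by_cases hk : k = j
        · subst hk; simp; ring
        · simp [hk] }
  suffices abAction (nielsen i j) = f from LinearMap.congr_fun this v
  refine end_ext fun a => ?_
  rw [abAction_single]
  change _ = Function.update _ _ _
  by_cases ha : a = i
  · subst ha
    rw [nielsen_self h.symm, map_mul, exponents_of, exponents_of]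
    ext k
    by_cases hk : k = j
    · subst hk; simp [h]
    · simp [hk]
  · rw [nielsen_of_ne _ ha, exponents_of]
    ext k
    by_cases hk : k = j
    · subst hk; simp [Ne.symm ha]
    · simp [hk]

theorem abAction_inversion (i : α) (v : α → ℤ) :
    abAction (inversion i) v = Function.update v i (-v i) := by
  let f : Module.End ℤ (α → ℤ) :=
    { toFun := fun v => Function.update v i (-v i)
      map_add' := fun v w => by
        ext k
        by_cases hk : k = i
        · subst hk; simp; ring
        · simp [hk]
      map_smul' := fun c v => by
        ext k
        by_cases hk : k = i
        · subst hk; simp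
        · simp [hk] }
  suffices abAction (inversion i) = f from LinearMap.congr_fun this v
  refine end_ext fun a => ?_
  rw [abAction_single]
  change _ = Function.update _ _ _
  by_cases ha : a = i
  · subst ha
    rw [inversion_self, map_inv, exponents_of]
    ext k
    by_cases hk : k = a
    · subst hk; simp
    · simp [hk]
  · rw [inversion_of_ne ha, exponents_of]
    ext k
    by_cases hk : k = i
    · subst hk; simp [Ne.symm ha]
    · simp [hk]

theorem abAction_permAut (σ : Equiv.Perm α) (v : α → ℤ) :
    abAction (permAut σ) v = v ∘ σ.symm := by
  suffices abAction (permAut σ) = LinearMap.funLeft ℤ ℤ σ.symm from LinearMap.congr_fun this v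
  refine end_ext fun a => ?_
  rw [abAction_single, permAut_of, exponents_of]
  ext k
  simp only [toAdd_ofAdd, LinearMap.funLeft_apply, Pi.single_apply, Equiv.symm_apply_eq]

/-- The elementary system of `Aut(F)` modulo the subgroup generated by Magnus's generators. -/
noncomputable def elementarySystem (α : Type*) [DecidableEq α] [Fintype α] :
    ElementarySystem α (MulAut (FreeGroup α) ⧸ magnusSubgroup α) :=
  let π := QuotientGroup.mk' (magnusSubgroup α)
  have hπ : ∀ {h x y : MulAut (FreeGroup α)}, h ∈ magnusSubgroup α → x = h * y → π x = π y := by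
    rintro h x y hh rfl
    have : π h = 1 := (QuotientGroup.eq_one_iff h).2 hh
    rw [map_mul, this, one_mul]
  { e := fun i j => π (nielsen i j)
    ι := fun i => π (inversion i)
    perm := π.comp permAut
    ρ := QuotientGroup.lift (magnusSubgroup α) abAction fun φ hφ => abAction_eq_one_of_mem hφ
    e_comm := by
      intro i j k l hij hkl hjk hil
      by_cases hik : i = k
      · subst hik
        by_cases hjl : j = l
        · rw [hjl]
        change _ * _ = _ * _
        rw [← map_mul, ← map_mul]
        have hj := of_mem_away hij.symm
        have hl := of_mem_away hkl.symm
        -- Two right multiplications of the same letter commute only modulo one of Magnus's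
        -- commutator generators.
        refine hπ (rightMul_commutator_mem hj hl) ?_
        change rightMul _ _ * rightMul _ _ = _ * (rightMul _ _ * rightMul _ _)
        rw [← rightMul_mul hj hl, ← rightMul_mul hl hj, ← rightMul_mul (commutator_mem_away hj hl)
          (mul_mem hl hj)]
        congr 1
        rw [commutatorElement_def]; group
      · change _ * _ = _ * _
        rw [← map_mul, ← map_mul, nielsen_comm_of_ne hij hkl hjk hil hik]
    e_rel := fun i j k hij hjk hik => by
      rw [← map_mul, ← map_mul, ← map_mul, nielsen_rel hij hjk hik]
    ι_sq := fun i => by rw [← map_mul, inversion_mul_self, map_one]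
    ι_comm := fun i j => by
      change _ * _ = _ * _
      rw [← map_mul, ← map_mul, inversion_comm]
    ι_e_comm := fun i j k hij hki hkj => by
      change _ * _ = _ * _
      rw [← map_mul, ← map_mul, inversion_comm_nielsen hij hki hkj]
    ι_e_left := fun i j hij => by
      have hj := of_mem_away hij.symm
      rw [← map_mul, ← map_mul, ← map_inv]
      -- Inverting the letter `i` turns a right multiplication into a left one; the discrepancy is a
      -- partial conjugation.
      refine hπ (partialConj_mem hj) ?_
      have := inversion_mul_rightMul hj
      rwa [rightMul_inv hj] at this
    ι_e_right := fun i j hij => by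
      rw [← map_mul, ← map_mul, ← map_inv, inversion_conj_nielsen hij.symm]
    perm_e := fun σ i j hij => by
      change π _ * _ = _ * π _
      rw [← map_mul, ← map_mul, permAut_mul_nielsen σ hij]
    perm_ι := fun σ i => by
      change π _ * _ = _ * π _
      rw [← map_mul, ← map_mul, permAut_mul_inversion]
    perm_swap := fun p q hpq => by
      change π _ = _
      rw [permAut_swap hpq]
      simp only [map_mul, map_inv]
    ρ_e := fun i j hij v => abAction_nielsen hij v
    ρ_ι := fun i v => abAction_inversion i v
    ρ_perm := fun σ v => abAction_permAut σ v }

/-- By Nielsen's theorem the whole quotient is the group `Γ` of all indices, on which the action on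
`ℤ^α` is faithful. -/
theorem mem_magnusSubgroup_of_abAction {φ : MulAut (FreeGroup α)} (h : abAction φ = 1) :
    φ ∈ magnusSubgroup α := by
  let E := elementarySystem α
  have hmem : ∀ φ : MulAut (FreeGroup α),
      QuotientGroup.mk' (magnusSubgroup α) φ ∈ E.Γ Finset.univ := by
    intro φ
    suffices nielsenSubgroup α ≤ (E.Γ Finset.univ).comap (QuotientGroup.mk' (magnusSubgroup α)) by
      rw [nielsenSubgroup_eq_top] at this
      exact this trivial
    rw [nielsenSubgroup, Subgroup.closure_le]
    rintro _ (⟨i, j, hij, rfl⟩ | ⟨i, rfl⟩)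
    · exact ElementarySystem.e_mem_Γ (E := E) (Finset.mem_univ i) (Finset.mem_univ j) hij
    · exact ElementarySystem.ι_mem_Γ (E := E) (Finset.mem_univ i)
  exact (QuotientGroup.eq_one_iff φ).1 (E.faithful Finset.univ (hmem φ) h)

theorem autAbelianization_eq_one_iff {G : Type*} [Group G] {φ : MulAut G} :
    φ ∈ (autAbelianization G).ker ↔ ∀ g, Abelianization.of (φ g) = Abelianization.of g := by
  rw [MonoidHom.mem_ker]
  constructor
  · intro h g
    exact DFunLike.congr_fun h (Abelianization.of g)
  · intro h
    ext x
    induction x using QuotientGroup.induction_on with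
    | H g => exact h g

/-- Magnus's theorem: the Torelli subgroup is generated by Magnus's generators. -/
theorem ker_autAbelianization_eq :
    (autAbelianization (FreeGroup α)).ker = magnusSubgroup α := by
  apply le_antisymm
  · intro φ hφ
    rw [autAbelianization_eq_one_iff] at hφ
    refine mem_magnusSubgroup_of_abAction (end_ext fun i => ?_)
    rw [abAction_single, Module.End.one_apply]
    have h1 : ∀ w : FreeGroup α, exponents w = Abelianization.lift exponents (Abelianization.of w) :=
      fun w => (Abelianization.lift_apply_of _ _).symm
    rw [h1, hφ, ← h1, exponents_of, toAdd_ofAdd]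
  · have hcomm : ∀ u v : FreeGroup α, Abelianization.of ⁅u, v⁆ = 1 := fun u v => by
      rw [map_commutatorElement, commutatorElement_eq_one_iff_mul_comm, mul_comm]
    have key : ∀ φ : MulAut (FreeGroup α),
        (∀ i, Abelianization.of (φ (of i)) = Abelianization.of (of i)) →
        φ ∈ (autAbelianization (FreeGroup α)).ker := by
      intro φ h
      rw [autAbelianization_eq_one_iff]
      have : Abelianization.of.comp φ.toMonoidHom = Abelianization.of := by ext1 i; exact h i
      exact fun g => DFunLike.congr_fun this g
    rw [magnusSubgroup, Subgroup.closure_le]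
    rintro _ (⟨a, b, hab, rfl⟩ | ⟨a, b, c, hab, hac, -, rfl⟩)
    · refine key _ fun i => ?_
      by_cases hi : i = a
      · subst hi
        rw [partialConj_self (of_mem_away hab), map_mul, map_mul, map_inv, mul_comm,
          mul_inv_cancel_left]
      · rw [partialConj_of_ne hi]
    · refine key _ fun i => ?_
      by_cases hi : i = a
      · subst hi
        rw [rightMul_self (commutator_mem_away (of_mem_away hab) (of_mem_away hac)), map_mul, hcomm,
          mul_one]
      · rw [rightMul_of_ne hi]

theorem magnusGens_finite : (magnusGens α).Finite := by
  refine Set.Finite.union ?_ ?_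
  · refine (Set.finite_range fun x : α × α => partialConj x.1 (of x.2)).subset ?_
    rintro _ ⟨a, b, -, rfl⟩
    exact ⟨(a, b), rfl⟩
  · refine (Set.finite_range fun x : α × α × α => rightMul x.1 ⁅of x.2.1, of x.2.2⁆).subset ?_
    rintro _ ⟨a, b, c, -, -, -, rfl⟩
    exact ⟨(a, b, c), rfl⟩

end Quotient

end AutFree


/-! ### Finite generation of kernels by pushing paths inwards -/

namespace Pushing

open Relation
open scoped RealInnerProductSpace

variable {N E : Type*} [Group N] [NormedAddCommGroup E] [InnerProductSpace ℝ E]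

/-- Steps of the Cayley graph of `N` with respect to `S` inside the ball of squared radius `n`. -/
def Step (S : Set N) (q : N → ℕ) (n : ℕ) (a b : N) : Prop :=
  (∃ s ∈ S, b = a * s) ∧ q a ≤ n ∧ q b ≤ n

/-- Connectedness in the ball of squared radius `n` of the Cayley graph. -/
def Conn (S : Set N) (q : N → ℕ) (n : ℕ) : N → N → Prop := ReflTransGen (Step S q n)

variable {S : Set N} {q : N → ℕ} {n : ℕ}

theorem Conn.symm (hS : ∀ s ∈ S, s⁻¹ ∈ S) {a b : N} (h : Conn S q n a b) : Conn S q n b a := by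
  have : Std.Symm (Step S q n) := ⟨by
    rintro a b ⟨⟨s, hs, rfl⟩, h1, h2⟩
    exact ⟨⟨s⁻¹, hS s hs, by rw [mul_inv_cancel_right]⟩, h2, h1⟩⟩
  exact Std.Symm.symm (r := ReflTransGen (Step S q n)) _ _ h

theorem Conn.trans {a b c : N} (h : Conn S q n a b) (h' : Conn S q n b c) : Conn S q n a c :=
  ReflTransGen.trans h h'

theorem Conn.refl (a : N) : Conn S q n a a := ReflTransGen.refl

theorem Conn.of_step {a s : N} (hs : s ∈ S) (h : q a ≤ n) (h' : q (a * s) ≤ n) :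
    Conn S q n a (a * s) := ReflTransGen.single ⟨⟨s, hs, rfl⟩, h, h'⟩

/-- Each vertex on the outer sphere is translated by a suitable `z`, and so are its neighbours. This
reroutes the path through the smaller ball. -/
theorem Conn.descend_step
    (hS : ∀ s ∈ S, s⁻¹ ∈ S)
    (hpush : ∀ v, q v = n + 1 → ∃ z ∈ S, ∀ s ∈ insert 1 S, q (v * s) ≤ n + 1 →
      q (v * s * z) ≤ n ∧ Conn S q n (v * z) (v * s * z))
    {a b : N} (ha : q a ≤ n) (hb : q b ≤ n) (h : Conn S q (n + 1) a b) : Conn S q n a b := by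
  have link : ∀ v, q v = n + 1 → ∀ s ∈ S, ∀ s' ∈ S, q (v * s) ≤ n → q (v * s') ≤ n →
      Conn S q n (v * s) (v * s') := by
    intro v hv s hs s' hs' h1 h2
    obtain ⟨z, hz, hp⟩ := hpush v hv
    obtain ⟨h3, h4⟩ := hp s (Or.inr hs) (h1.trans n.le_succ)
    obtain ⟨h5, h6⟩ := hp s' (Or.inr hs') (h2.trans n.le_succ)
    exact (((Conn.of_step hz h1 h3).trans (h4.symm hS)).trans h6).trans
      ((Conn.of_step hz h2 h5).symm hS)
  -- The invariant along the path: at an outer vertex, which cannot itself be reached in the smaller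
  -- ball, all of its inner neighbours are connected to `a`.
  have key : ∀ v, Conn S q (n + 1) a v → q v ≤ n + 1 ∧ (q v ≤ n → Conn S q n a v) ∧
      (q v = n + 1 → ∀ s ∈ S, q (v * s) ≤ n → Conn S q n a (v * s)) := by
    intro v hv
    induction hv with
    | refl => exact ⟨ha.trans n.le_succ, fun _ => Conn.refl a, fun h => by omega⟩
    | @tail v _ hc hstep ih =>
      obtain ⟨⟨s, hs, rfl⟩, hv1, hv2⟩ := hstep
      obtain ⟨-, ih1, ih2⟩ := ih
      refine ⟨hv2, fun hlow => ?_, fun hmax s' hs' hlow' => ?_⟩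
      · rcases Nat.lt_or_ge n (q v) with hv | hv
        · exact ih2 (by omega) s hs hlow
        · exact (ih1 hv).trans (Conn.of_step hs hv hlow)
      · rcases Nat.lt_or_ge n (q v) with hv | hv
        · obtain ⟨z, hz, hp⟩ := hpush v (by omega)
          obtain ⟨h3, h4⟩ := hp s (Or.inr hs) hv2
          have h5 := (hp 1 (Or.inl rfl) (by rwa [mul_one])).1
          rw [mul_one] at h5
          exact ((ih2 (by omega) z hz h5).trans h4).trans (link _ hmax z hz s' hs' h3 hlow')
        · refine (ih1 hv).trans ?_
          have := link (v * s) hmax s⁻¹ (hS s hs) s' hs' (by rwa [mul_inv_cancel_right]) hlow'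
          rwa [mul_inv_cancel_right] at this
  exact (key b h).2.1 hb

theorem Conn.descend (hS : ∀ s ∈ S, s⁻¹ ∈ S) {n₀ : ℕ}
    (hpush : ∀ n, n₀ ≤ n → ∀ v, q v = n + 1 → ∃ z ∈ S, ∀ s ∈ insert 1 S, q (v * s) ≤ n + 1 →
      q (v * s * z) ≤ n ∧ Conn S q n (v * z) (v * s * z))
    {a b : N} (ha : q a ≤ n₀) (hb : q b ≤ n₀) (hn : n₀ ≤ n) (h : Conn S q n a b) :
    Conn S q n₀ a b := by
  induction n, hn using Nat.le_induction with
  | base => exact h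
  | succ n hn ih =>
    exact ih (Conn.descend_step hS (hpush n hn) (ha.trans hn) (hb.trans hn) h)

section Additive

variable {Θ : N → E} (hΘ : ∀ x y, Θ (x * y) = Θ x + Θ y)
include hΘ

theorem map_one_eq_zero : Θ 1 = 0 := by
  have := hΘ 1 1
  rwa [mul_one, left_eq_add] at this

theorem map_inv_eq_neg (x : N) : Θ x⁻¹ = -Θ x := by
  have := hΘ x⁻¹ x
  rw [inv_mul_cancel, map_one_eq_zero hΘ] at this
  exact eq_neg_of_add_eq_zero_left this.symm

theorem map_pow_eq_smul (x : N) (i : ℕ) : Θ (x ^ i) = (i : ℝ) • Θ x := by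
  induction i with
  | zero => simp [map_one_eq_zero hΘ]
  | succ i ih => rw [pow_succ, hΘ, ih]; push_cast; rw [add_smul, one_smul]

theorem map_conj_eq (g x : N) : Θ (g * x * g⁻¹) = Θ x := by
  rw [hΘ, hΘ, map_inv_eq_neg hΘ]; abel

/-- Every element can be reached by a path staying at a bounded distance. -/
theorem exists_conn (hS : ∀ s ∈ S, s⁻¹ ∈ S) (hgen : Subgroup.closure S = ⊤) (y : N) :
    ∃ L : ℝ, ∀ v n, (∀ x, ‖Θ x - Θ v‖ ≤ L → q x ≤ n) → Conn S q n v (v * y) := by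
  have hy : y ∈ Subgroup.closure S := hgen ▸ Subgroup.mem_top y
  induction hy using Subgroup.closure_induction with
  | mem s hs =>
    refine ⟨‖Θ s‖, fun v n h => Conn.of_step hs (h _ ?_) (h _ ?_)⟩
    · rw [sub_self, norm_zero]; exact norm_nonneg _
    · rw [hΘ, add_sub_cancel_left]
  | one => exact ⟨0, fun v n _ => by rw [mul_one]; exact Conn.refl v⟩
  | mul x y _ _ hx hy =>
    obtain ⟨L, hL⟩ := hx
    obtain ⟨L', hL'⟩ := hy
    refine ⟨max L (L' + ‖Θ x‖), fun v n h => ?_⟩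
    rw [← mul_assoc]
    refine (hL v n fun a ha => h a (ha.trans (le_max_left _ _))).trans
      (hL' _ n fun a ha => h a (le_trans ?_ (le_max_right _ _)))
    rw [hΘ] at ha
    calc ‖Θ a - Θ v‖ = ‖(Θ a - (Θ v + Θ x)) + Θ x‖ := by congr 1; abel
      _ ≤ _ := (norm_add_le _ _).trans (by gcongr)
  | inv x _ hx =>
    obtain ⟨L, hL⟩ := hx
    refine ⟨L + ‖Θ x‖, fun v n h => ?_⟩
    have := (hL (v * x⁻¹) n fun a ha => h a ?_).symm hS
    · rwa [inv_mul_cancel_right] at this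
    · rw [hΘ, map_inv_eq_neg hΘ] at ha
      calc ‖Θ a - Θ v‖ = ‖(Θ a - (Θ v + -Θ x)) + -Θ x‖ := by congr 1; abel
        _ ≤ _ := (norm_add_le _ _).trans (by rw [norm_neg]; gcongr)

/-- Powers of the members of a chain of commuting elements are connected by paths staying close
to sums of two of them. -/
theorem exists_conn_pow (hS : ∀ s ∈ S, s⁻¹ ∈ S) (hgen : Subgroup.closure S = ⊤) {D : Set N}
    {z y : N} (h : ReflTransGen (fun a b => a ∈ D ∧ b ∈ D ∧ Commute a b) z y) :
    ∃ L : ℝ, ∀ v n (i : ℕ), (∀ x, ∀ y ∈ D, ∀ y' ∈ D, ∀ a ≤ i,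
      ‖Θ x - (Θ v + (i : ℝ) • Θ y + (a : ℝ) • Θ y')‖ ≤ L → q x ≤ n) →
      Conn S q n (v * z ^ i) (v * y ^ i) := by
  induction h with
  | refl => exact ⟨0, fun v n i _ => Conn.refl _⟩
  | @tail y y' _ hstep ih =>
    obtain ⟨hy, hy', hc⟩ := hstep
    obtain ⟨L, hL⟩ := ih
    have half : ∀ y ∈ D, ∀ y' ∈ D, ∃ L : ℝ, ∀ v n (i : ℕ), (∀ x, ∀ y ∈ D, ∀ y' ∈ D, ∀ a ≤ i,
        ‖Θ x - (Θ v + (i : ℝ) • Θ y + (a : ℝ) • Θ y')‖ ≤ L → q x ≤ n) →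
        Conn S q n (v * y ^ i) (v * y ^ i * y' ^ i) := by
      intro y hy y' hy'
      obtain ⟨L, hL⟩ := exists_conn (q := q) hΘ hS hgen y'
      refine ⟨L, fun v n i h => ?_⟩
      have : ∀ a ≤ i, Conn S q n (v * y ^ i) (v * y ^ i * y' ^ a) := by
        intro a
        induction a with
        | zero => intro _; rw [pow_zero, mul_one]; exact Conn.refl _
        | succ a iha =>
          intro ha
          refine (iha (Nat.le_of_succ_le ha)).trans ?_
          rw [pow_succ, ← mul_assoc]
          refine hL _ n fun x hx => h x y hy y' hy' a (Nat.le_of_succ_le ha) ?_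
          rwa [hΘ, hΘ, map_pow_eq_smul hΘ, map_pow_eq_smul hΘ] at hx
      exact this i le_rfl
    obtain ⟨L₁, hL₁⟩ := half y hy y' hy'
    obtain ⟨L₂, hL₂⟩ := half y' hy' y hy
    refine ⟨max L (max L₁ L₂), fun v n i h => ?_⟩
    have h1 := hL v n i fun x y hy y' hy' a ha hx => h x y hy y' hy' a ha (by grind)
    have h2 := hL₁ v n i fun x y hy y' hy' a ha hx => h x y hy y' hy' a ha (by grind)
    have h3 := hL₂ v n i fun x y hy y' hy' a ha hx => h x y hy y' hy' a ha (by grind)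
    rw [mul_assoc, ← (hc.pow_pow i i).eq, ← mul_assoc] at h3
    exact (h1.trans h2).trans (h3.symm hS)

end Additive

theorem exists_uniform {ι : Type*} {A : Set ι} (hA : A.Finite) (P : ι → ℝ → Prop)
    (hP : ∀ a x y, x ≤ y → P a x → P a y) (h : ∀ a ∈ A, ∃ x, P a x) : ∃ x, ∀ a ∈ A, P a x := by
  choose! f hf using h
  obtain ⟨x, hx⟩ := (hA.image f).bddAbove
  exact ⟨x, fun a ha => hP a _ _ (hx ⟨a, ha, rfl⟩) (hf a ha)⟩

/-- The Reidemeister-Schreier method: `c` chooses coset representatives of `M`, and a path over the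
ball meets finitely many cosets only, so finitely many Schreier generators suffice. -/
theorem fg_of_conn {Θ : N → E} (hΘ : ∀ x y, Θ (x * y) = Θ x + Θ y) (hSf : S.Finite)
    (hfin : (Θ '' {x | q x ≤ n}).Finite) (M : Subgroup N) (hM : ∀ x, x ∈ M ↔ Θ x = 0)
    (hconn : ∀ x ∈ M, Conn S q n 1 x) : M.FG := by
  classical
  choose! c hc using fun (t : E) (ht : ∃ x, Θ x = t) => ht
  have hcΘ : ∀ x, Θ (c (Θ x)) = Θ x := fun x => hc _ ⟨x, rfl⟩
  set gens : Set N := insert (c 0) ((fun r : E × N => c r.1 * r.2 * (c (r.1 + Θ r.2))⁻¹) ''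
    ((Θ '' {x | q x ≤ n}) ×ˢ S)) with hgens
  have h0 : Θ (c 0) = 0 := by
    have := hcΘ 1
    rwa [map_one_eq_zero hΘ] at this
  have hle : Subgroup.closure gens ≤ M := by
    rw [Subgroup.closure_le]
    rintro _ (rfl | ⟨⟨_, s⟩, ⟨⟨x, -, rfl⟩, -⟩, rfl⟩)
    · exact (hM _).2 h0
    · refine (hM _).2 ?_
      simp only
      rw [hΘ, hΘ, map_inv_eq_neg hΘ, ← hΘ x s, hcΘ, hcΘ, hΘ]
      abel
  refine (Subgroup.fg_iff _).2 ⟨gens, le_antisymm hle fun x hx => ?_, ?_⟩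
  · have key : ∀ v, Conn S q n 1 v → v * (c (Θ v))⁻¹ ∈ Subgroup.closure gens := by
      intro v hv
      induction hv with
      | refl =>
        rw [map_one_eq_zero hΘ, one_mul]
        exact inv_mem (Subgroup.subset_closure (Set.mem_insert _ _))
      | @tail v _ _ hstep ih =>
        obtain ⟨⟨s, hs, rfl⟩, hv, -⟩ := hstep
        have h1 : c (Θ v) * s * (c (Θ v + Θ s))⁻¹ ∈ Subgroup.closure gens :=
          Subgroup.subset_closure (Or.inr ⟨(Θ v, s), ⟨⟨v, hv, rfl⟩, hs⟩, rfl⟩)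
        have := mul_mem ih h1
        rw [hΘ]
        convert this using 1
        group
    have h1 := key x (hconn x hx)
    rw [(hM x).1 hx] at h1
    have := mul_mem h1 (Subgroup.subset_closure (Set.mem_insert (c 0) _))
    rwa [inv_mul_cancel_right] at this
  · exact ((hfin.prod hSf).image _).insert _

/-- A criterion for the kernel of a homomorphism to a lattice to be finitely generated. -/
theorem fg_kernel [FiniteDimensional ℝ E] {Θ : N → E} (hΘ : ∀ x y, Θ (x * y) = Θ x + Θ y)
    (hN : Group.FG N)
    (hq : ∀ x, ‖Θ x‖ ^ 2 = q x) (hfin : ∀ n, (Θ '' {x | q x ≤ n}).Finite) (M : Subgroup N)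
    (hM : ∀ x, x ∈ M ↔ Θ x = 0)
    (H : ∀ χ : E, χ ≠ 0 → ∃ D : Set N, ∃ z ∈ D, (Θ '' D).Finite ∧ (∀ y ∈ D, 0 < ⟪χ, Θ y⟫) ∧
      ∀ s : N, ReflTransGen (fun a b => a ∈ D ∧ b ∈ D ∧ Commute a b) z (s * z * s⁻¹)) :
    M.FG := by
  classical
  choose! D z hz hD hpos hchain using H
  -- neighbourhoods on which the data of a given direction work
  have hδ : ∀ χ : E, χ ≠ 0 → ∃ δ > 0, ∀ y ∈ D χ, δ < ⟪χ, Θ y⟫ := by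
    intro χ hχ
    obtain ⟨δ, h1, h2⟩ : ∃ δ > 0, ∀ w ∈ Θ '' D χ, δ < ⟪χ, w⟫ := by
      have hne : (Θ '' D χ).Nonempty := ⟨_, z χ, hz χ hχ, rfl⟩
      obtain ⟨w, ⟨y, hy, rfl⟩, hmin⟩ := (hD χ hχ).exists_minimalFor (fun w => ⟪χ, w⟫) _ hne
      have hp := hpos χ hχ y hy
      refine ⟨⟪χ, Θ y⟫ / 2, by linarith, fun w hw => ?_⟩
      have : ⟪χ, Θ y⟫ ≤ ⟪χ, w⟫ := by
        rcases le_total ⟪χ, Θ y⟫ ⟪χ, w⟫ with h | h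
        · exact h
        · exact hmin hw h
      linarith
    exact ⟨δ, h1, fun y hy => h2 _ ⟨y, hy, rfl⟩⟩
  choose! δ hδ0 hδ using hδ
  -- The data found for `χ` still work for nearby directions, since `D χ` has finite image.
  -- Compactness of the sphere leaves finitely many directions.
  set U : E → Set E := fun χ => {χ' | ∀ w ∈ Θ '' D χ, δ χ < ⟪χ', w⟫} with hU
  have hUo : ∀ χ, χ ≠ 0 → IsOpen (U χ) := by
    intro χ hχ
    have : U χ = ⋂ w ∈ Θ '' D χ, {χ' | δ χ < ⟪χ', w⟫} := by ext; simp [hU]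
    rw [this]
    refine (hD χ hχ).isOpen_biInter fun w _ => isOpen_lt continuous_const ?_
    fun_prop
  have hne : ∀ χ ∈ Metric.sphere (0 : E) 1, χ ≠ 0 := by
    rintro χ hχ rfl
    simp at hχ
  obtain ⟨t, ht, hcov⟩ := (isCompact_sphere (0 : E) 1).elim_nhds_subcover U fun χ hχ =>
    (hUo χ (hne χ hχ)).mem_nhds (by rintro _ ⟨y, hy, rfl⟩; exact hδ χ (hne χ hχ) y hy)
  obtain ⟨S₀, hS₀, hS₀f⟩ := (Group.fg_iff (G := N)).1 hN
  set S₁ : Set N := S₀ ∪ z '' (t : Set E) with hS₁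
  have hS₁f : S₁.Finite := hS₀f.union (t.finite_toSet.image z)
  set S : Set N := S₁ ∪ S₁⁻¹ with hSdef
  have hSf : S.Finite := hS₁f.union hS₁f.inv
  have hS : ∀ s ∈ S, s⁻¹ ∈ S := by
    rintro s (hs | hs)
    · exact Or.inr (by rwa [Set.mem_inv, inv_inv])
    · exact Or.inl hs
  have hgen : Subgroup.closure S = ⊤ := by
    rw [eq_top_iff, ← hS₀]
    exact Subgroup.closure_mono fun s hs => Or.inl (Or.inl hs)
  have hzS : ∀ χ ∈ t, z χ ∈ S := fun χ hχ => Or.inl (Or.inr ⟨χ, hχ, rfl⟩)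
  -- uniform constants
  obtain ⟨L, hL⟩ := exists_uniform ((t.finite_toSet.prod hSf)) (fun r L => ∀ v n (i : ℕ),
    (∀ x, ∀ y ∈ D r.1, ∀ y' ∈ D r.1, ∀ a ≤ i,
      ‖Θ x - (Θ v + (i : ℝ) • Θ y + (a : ℝ) • Θ y')‖ ≤ L → q x ≤ n) →
      Conn S q n (v * z r.1 ^ i) (v * (r.2 * z r.1 * r.2⁻¹) ^ i))
    (fun r L L' hLL' h v n i h' => h v n i fun x y hy y' hy' a ha hx =>
      h' x y hy y' hy' a ha (hx.trans hLL'))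
    (fun r hr => exists_conn_pow hΘ hS hgen (hchain r.1 (hne _ (ht _ hr.1)) r.2))
  obtain ⟨η, hη0, hη⟩ : ∃ η > 0, ∀ χ ∈ t, η ≤ δ χ := by
    rcases t.eq_empty_or_nonempty with rfl | h
    · exact ⟨1, one_pos, by simp⟩
    · obtain ⟨χ, hχ, hmin⟩ := t.exists_min_image δ h
      exact ⟨δ χ, hδ0 χ (hne _ (ht _ hχ)), hmin⟩
  obtain ⟨C, hC⟩ := exists_uniform t.finite_toSet (fun χ C => ∀ y ∈ D χ, ‖Θ y‖ ≤ C)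
    (fun χ C C' h h' y hy => (h' y hy).trans h)
    (fun χ hχ => by
      obtain ⟨C, hC⟩ := ((hD χ (hne _ (ht _ hχ))).image fun w => ‖w‖).bddAbove
      exact ⟨C, fun y hy => hC ⟨_, ⟨y, hy, rfl⟩, rfl⟩⟩)
  obtain ⟨σ, hσ⟩ := exists_uniform (hSf.insert 1) (fun s σ => ‖Θ s‖ ≤ σ)
    (fun s x y h h' => h'.trans h) (fun s _ => ⟨_, le_rfl⟩)
  have hσ0 : 0 ≤ σ := (norm_nonneg _).trans (hσ 1 (Or.inl rfl))
  -- Moving `i` steps inwards gains at least `η * i`, which must exceed by one the width `L` of the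
  -- paths of `exists_conn_pow`.
  obtain ⟨i, hi⟩ := exists_nat_gt ((|L| + 1) / η + 1)
  have hi1 : 1 ≤ i := by
    have : (0 : ℝ) ≤ (|L| + 1) / η := by positivity
    exact_mod_cast (show (1 : ℝ) ≤ i by linarith)
  have hiL : L + 1 ≤ η * i := by
    have h1 : (|L| + 1) / η < i := by linarith
    rw [div_lt_iff₀ hη0] at h1
    linarith [le_abs_self L]
  -- At distance greater than `B` the quadratic error terms are dominated by the linear inward gain:
  -- the first summand serves the paths between conjugates, the second the powers of `z χ`.
  set B : ℝ := (2 * i * |C| + |L|) ^ 2 + (i * |C| ^ 2 + 2 * σ * |C|) / η with hB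
  have hB0 : 0 ≤ B := by positivity
  obtain ⟨n₀, hn₀⟩ := exists_nat_gt (B ^ 2)
  have hpush : ∀ n, n₀ ≤ n → ∀ v, q v = n + 1 → ∃ z ∈ S, ∀ s ∈ insert 1 S, q (v * s) ≤ n + 1 →
      q (v * s * z) ≤ n ∧ Conn S q n (v * z) (v * s * z) := by
    intro n hn v hv
    have hlow : ∀ x, ‖Θ x‖ ^ 2 < ‖Θ v‖ ^ 2 → q x ≤ n := by
      intro x hx
      rw [hq, hq, hv] at hx
      have : q x < n + 1 := by exact_mod_cast hx
      omega
    set A := ‖Θ v‖ with hA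
    have hA2 : A ^ 2 = n + 1 := by rw [hA, hq, hv]; push_cast; rfl
    have hAB : B < A := by
      have : (n₀ : ℝ) ≤ n := by exact_mod_cast hn
      exact lt_of_pow_lt_pow_left₀ 2 (norm_nonneg _) (by linarith)
    have hA0 : 0 < A := hB0.trans_lt hAB
    have hA1 : (2 * i * |C| + |L|) ^ 2 < A := by
      refine lt_of_le_of_lt ?_ hAB
      rw [hB]
      have : 0 ≤ (i * |C| ^ 2 + 2 * σ * |C|) / η := by positivity
      linarith
    have hA3 : i * |C| ^ 2 + 2 * σ * |C| < η * A := by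
      have h1 : (i * |C| ^ 2 + 2 * σ * |C|) / η < A := by
        refine lt_of_le_of_lt ?_ hAB
        rw [hB]
        have := sq_nonneg (2 * i * |C| + |L|)
        linarith
      rw [div_lt_iff₀ hη0] at h1
      linarith
    -- The direction from `Θ v` towards the origin selects the member of the cover that is used for
    -- pushing.
    have hmem : -(A⁻¹ • Θ v) ∈ Metric.sphere (0 : E) 1 := by
      rw [mem_sphere_zero_iff_norm, norm_neg, norm_smul, norm_inv, norm_norm,
        inv_mul_cancel₀ hA0.ne']
    obtain ⟨χ, hχ, hχU⟩ := Set.mem_iUnion₂.1 (hcov hmem)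
    have hχ0 := hne χ (ht χ hχ)
    have hin : ∀ y ∈ D χ, ⟪Θ v, Θ y⟫ < -(η * A) := by
      intro y hy
      have h1 := hχU _ ⟨y, hy, rfl⟩
      rw [inner_neg_left, inner_smul_left] at h1
      simp only [conj_trivial] at h1
      have h2 := hη χ hχ
      have h3 : A⁻¹ * ⟪Θ v, Θ y⟫ < -η := by linarith
      rw [inv_mul_lt_iff₀ hA0] at h3
      linarith
    have hCy : ∀ y ∈ D χ, ‖Θ y‖ ≤ |C| := fun y hy => (hC χ hχ y hy).trans (le_abs_self C)
    have hzD := hz χ hχ0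
    refine ⟨z χ, hzS χ hχ, fun s hs hvs => ?_⟩
    -- moving inside along powers of `z χ`
    have hin2 : ∀ s ∈ insert 1 S, q (v * s) ≤ n + 1 → ∀ a, 1 ≤ a → a ≤ i →
        q (v * s * z χ ^ a) ≤ n := by
      intro s hs hvs a ha1 hai
      apply hlow
      rw [hΘ, map_pow_eq_smul hΘ, norm_add_sq_real, inner_smul_right, norm_smul, mul_pow]
      have e1 : ‖Θ (v * s)‖ ^ 2 ≤ A ^ 2 := by
        rw [hq, hA2]; exact_mod_cast hvs
      have e2 : ⟪Θ (v * s), Θ (z χ)⟫ < -(η * A) + σ * |C| := by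
        rw [hΘ, inner_add_left]
        have := real_inner_le_norm (Θ s) (Θ (z χ))
        have h2 : ‖Θ s‖ * ‖Θ (z χ)‖ ≤ σ * |C| :=
          mul_le_mul (hσ s hs) (hCy _ hzD) (norm_nonneg _) hσ0
        linarith [hin _ hzD]
      have e3 : ‖Θ (z χ)‖ ^ 2 ≤ |C| ^ 2 := pow_le_pow_left₀ (norm_nonneg _) (hCy _ hzD) 2
      have ha1' : (1 : ℝ) ≤ a := by exact_mod_cast ha1
      have hai' : (a : ℝ) ≤ i := by exact_mod_cast hai
      have e4 : ‖(a : ℝ)‖ ^ 2 * ‖Θ (z χ)‖ ^ 2 ≤ a * (i * |C| ^ 2) := by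
        rw [Real.norm_of_nonneg (by linarith), sq (a : ℝ), mul_assoc]
        refine mul_le_mul_of_nonneg_left ?_ (by linarith)
        exact mul_le_mul hai' e3 (by positivity) (by positivity)
      have e5 : (0 : ℝ) < a := by linarith
      have e6 : 2 * ((a : ℝ) * ⟪Θ (v * s), Θ (z χ)⟫) + a * (i * |C| ^ 2) < 0 := by
        have : 2 * ⟪Θ (v * s), Θ (z χ)⟫ + i * |C| ^ 2 < 0 := by nlinarith
        nlinarith
      linarith
    have hin3 : ∀ s ∈ insert 1 S, q (v * s) ≤ n + 1 →
        Conn S q n (v * s * z χ) (v * s * z χ ^ i) := by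
      intro s hs hvs
      have : ∀ a, 1 ≤ a → a ≤ i → Conn S q n (v * s * z χ) (v * s * z χ ^ a) := by
        intro a ha1
        induction a, ha1 using Nat.le_induction with
        | base => intro _; rw [pow_one]; exact Conn.refl _
        | succ a ha1 ih =>
          intro hai
          refine (ih (Nat.le_of_succ_le hai)).trans ?_
          have := hin2 s hs hvs (a + 1) (by omega) hai
          rw [pow_succ, ← mul_assoc] at this ⊢
          exact Conn.of_step (hzS χ hχ) (hin2 s hs hvs a ha1 (Nat.le_of_succ_le hai)) this
      exact this i hi1 le_rfl
    have hone : q (v * 1) ≤ n + 1 := by rw [mul_one, hv]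
    refine ⟨by simpa using hin2 s hs hvs 1 le_rfl hi1, ?_⟩
    rcases hs with rfl | hs
    · rw [mul_one]; exact Conn.refl _
    have c1 := hin3 1 (Or.inl rfl) hone
    rw [mul_one] at c1
    have c2 := hL (χ, s) ⟨hχ, hs⟩ v n i (by
      intro x y hy y' hy' a hai hx
      apply hlow
      simp only at hx hy hy'
      have hai' : (a : ℝ) ≤ i := by exact_mod_cast hai
      have ha0 : (0 : ℝ) ≤ a := by positivity
      obtain ⟨w, hw⟩ : ∃ w, Θ x = Θ v + ((i : ℝ) • Θ y + (a : ℝ) • Θ y' + w) :=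
        ⟨Θ x - (Θ v + (i : ℝ) • Θ y + (a : ℝ) • Θ y'), by abel⟩
      have hwL : ‖w‖ ≤ L := by
        convert hx using 2
        rw [hw]; abel
      rw [hw, norm_add_sq_real]
      have f1 : ‖(i : ℝ) • Θ y + (a : ℝ) • Θ y' + w‖ ≤ 2 * i * |C| + |L| := by
        refine (norm_add_le _ _).trans (add_le_add ?_ (hwL.trans (le_abs_self L)))
        refine (norm_add_le _ _).trans ?_
        rw [norm_smul, norm_smul, Real.norm_of_nonneg ha0, Real.norm_of_nonneg (by positivity)]
        have g1 := mul_le_mul_of_nonneg_left (hCy y hy) (by positivity : (0 : ℝ) ≤ i)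
        have g2 := mul_le_mul hai' (hCy y' hy') (norm_nonneg _) (by positivity)
        linarith
      have f2 := pow_le_pow_left₀ (norm_nonneg _) f1 2
      have f3 : ⟪Θ v, (i : ℝ) • Θ y + (a : ℝ) • Θ y' + w⟫ ≤ -A := by
        rw [inner_add_right, inner_add_right, inner_smul_right, inner_smul_right]
        have g1 := mul_le_mul_of_nonneg_left (hin y hy).le (by positivity : (0 : ℝ) ≤ i)
        have g2 : (a : ℝ) * ⟪Θ v, Θ y'⟫ ≤ 0 :=
          mul_nonpos_of_nonneg_of_nonpos ha0 ((hin y' hy').le.trans (by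
            have := mul_pos hη0 hA0; linarith))
        have g3 := real_inner_le_norm (Θ v) w
        have g4 := mul_le_mul_of_nonneg_left hwL hA0.le
        have g5 := mul_le_mul_of_nonneg_right hiL hA0.le
        linarith
      linarith)
    have c3 := hin3 s (Or.inr hs) hvs
    -- The connection goes inwards along powers of `z χ`, across to powers of its conjugate by the
    -- commuting chain, over the edge `s`, and back outwards from `v * s * z χ ^ i`.
    have e1 : v * (s * z χ * s⁻¹) ^ i * s = v * s * z χ ^ i := by rw [conj_pow]; group
    have c4 : Conn S q n (v * (s * z χ * s⁻¹) ^ i) (v * (s * z χ * s⁻¹) ^ i * s) := by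
      refine Conn.of_step hs ?_ ?_
      · have h1 := hin2 1 (Or.inl rfl) hone i hi1 le_rfl
        have h2 : (q (v * (s * z χ * s⁻¹) ^ i) : ℝ) = q (v * 1 * z χ ^ i) := by
          rw [← hq, ← hq, hΘ, map_pow_eq_smul hΘ, map_conj_eq hΘ, mul_one, hΘ, map_pow_eq_smul hΘ]
        have h3 : q (v * (s * z χ * s⁻¹) ^ i) = q (v * 1 * z χ ^ i) := by exact_mod_cast h2
        rwa [h3]
      · rw [e1]; exact hin2 s (Or.inr hs) hvs i hi1 le_rfl
    rw [e1] at c4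
    exact ((c1.trans c2).trans c4).trans (c3.symm hS)
  have hq1 : q 1 = 0 := by
    have := hq 1
    rw [map_one_eq_zero hΘ, norm_zero] at this
    simpa using this.symm
  refine fg_of_conn (n := n₀) hΘ hSf (hfin n₀) M hM fun x hx => ?_
  have hqx : q x = 0 := by
    have := hq x
    rw [(hM x).1 hx, norm_zero] at this
    simpa using this.symm
  -- Some path from `1` to `x` exists over a large ball depending on `x`; the descent brings it to
  -- the uniform ball.
  obtain ⟨L', hL'⟩ := exists_conn (q := q) hΘ hS hgen x
  obtain ⟨n₁, hn₁⟩ := exists_nat_gt (L' ^ 2)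
  have hc := hL' 1 (max n₀ n₁) fun y hy => by
    rw [map_one_eq_zero hΘ, sub_zero] at hy
    have h1 := pow_le_pow_left₀ (norm_nonneg _) hy 2
    rw [hq] at h1
    have : q y < n₁ := by exact_mod_cast h1.trans_lt hn₁
    exact this.le.trans (le_max_right _ _)
  rw [one_mul] at hc
  exact Conn.descend hS hpush (by omega) (by omega) (le_max_left _ _) hc

end Pushing


namespace Pushing

/-! ### From commuting elements to finitely generated commutator subgroups -/

open Relation
open scoped RealInnerProductSpace

/-- The subgroup `P` has finite index in `M`. -/
theorem fg_of_finite_quotient {N : Type*} [Group N] {P M : Subgroup N} (hPM : P ≤ M) (hM : M.FG)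
    {Q : Type*} [Group Q] (f : N →* Q) (hP : f.ker = P) (hf : ((f '' M : Set Q)).Finite) :
    P.FG := by
  have hMfg : Group.FG M := (Group.fg_iff_subgroup_fg M).2 hM
  set φ : M →* Q := f.comp M.subtype with hφ
  have hfin : Finite φ.range := by
    refine Set.Finite.to_subtype (hf.subset ?_)
    rintro _ ⟨x, rfl⟩
    exact ⟨x, x.2, rfl⟩
  have h1 : Group.FG φ.ker := Subgroup.fg_of_index_ne_zero φ.ker
  have h2 : (φ.ker.map M.subtype).FG := by
    have := (Group.fg_iff_subgroup_fg _).1 h1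
    rw [Subgroup.fg_iff_submonoid_fg] at this ⊢
    exact this.map M.subtype
  convert h2
  ext x
  rw [← hP, Subgroup.mem_map]
  constructor
  · intro hx
    exact ⟨⟨x, hPM (hP ▸ hx)⟩, hx, rfl⟩
  · rintro ⟨y, hy, rfl⟩
    exact hy

/-- The quotient by `P` is finitely generated abelian. Its torsion-free part is a lattice, to which
`fg_kernel` applies; the kernel obtained there contains `P` with finite torsion quotient. -/
theorem fg_of_directions {N : Type*} [Group N] (hN : Group.FG N) (P : Subgroup N) [P.Normal]
    (hcomm : ∀ x y, x * y * x⁻¹ * y⁻¹ ∈ P)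
    (H : ∀ χ : N → ℝ, (∀ x y, χ (x * y) = χ x + χ y) → (∀ x ∈ P, χ x = 0) → (∃ x, χ x ≠ 0) →
      ∃ D : Set N, ∃ z ∈ D, (∃ F : Set N, F.Finite ∧ ∀ y ∈ D, ∃ f ∈ F, f⁻¹ * y ∈ P) ∧
      (∀ y ∈ D, 0 < χ y) ∧
      ∀ s : N, ReflTransGen (fun a b => a ∈ D ∧ b ∈ D ∧ Commute a b) z (s * z * s⁻¹)) :
    P.FG := by
  classical
  let _ : CommGroup (N ⧸ P) :=
    { (inferInstance : Group (N ⧸ P)) with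
      mul_comm := by
        rintro ⟨x⟩ ⟨y⟩
        change QuotientGroup.mk' P x * QuotientGroup.mk' P y = QuotientGroup.mk' P y *
          QuotientGroup.mk' P x
        rw [← map_mul, ← map_mul]
        refine QuotientGroup.eq.2 ?_
        have := hcomm y⁻¹ x⁻¹
        have e : (x * y)⁻¹ * (y * x) = y⁻¹ * x⁻¹ * y⁻¹⁻¹ * x⁻¹⁻¹ := by group
        rwa [e] }
  have hfg : AddGroup.FG (Additive (N ⧸ P)) := by
    have : Group.FG (N ⧸ P) := QuotientGroup.fg P
    exact GroupFG.iff_add_fg.1 this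
  have hfin : Module.Finite ℤ (Additive (N ⧸ P)) := Module.Finite.iff_addGroup_fg.2 hfg
  set T := Submodule.torsion ℤ (Additive (N ⧸ P)) with hT
  have hTfin : Finite T := by
    refine Module.finite_of_fg_torsion T ?_
    exact Submodule.torsion_isTorsion
  let B := Module.Free.chooseBasis ℤ (Additive (N ⧸ P) ⧸ T)
  set ι := Module.Free.ChooseBasisIndex ℤ (Additive (N ⧸ P) ⧸ T)
  let r : N → ι → ℤ := fun x i => B.repr (T.mkQ (Additive.ofMul (QuotientGroup.mk' P x))) i
  have hr : ∀ x y i, r (x * y) i = r x i + r y i := by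
    intro x y i
    simp only [r, map_mul, ofMul_mul, map_add, Finsupp.add_apply]
  let Θ : N → EuclideanSpace ℝ ι := fun x => WithLp.toLp 2 fun i => (r x i : ℝ)
  have hΘ : ∀ x y, Θ (x * y) = Θ x + Θ y := by
    intro x y
    ext i
    simp only [Θ, hr, PiLp.add_apply]
    push_cast
    rfl
  have hr0 : ∀ x, Θ x = 0 ↔ Additive.ofMul (QuotientGroup.mk' P x) ∈ T := by
    intro x
    have h1 : Θ x = 0 ↔ ∀ i, r x i = 0 := by
      constructor
      · intro h i
        have := congrArg (fun v : EuclideanSpace ℝ ι => v i) h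
        simpa [Θ] using this
      · intro h
        ext i
        simp [Θ, h i]
    rw [h1, ← Submodule.Quotient.mk_eq_zero T]
    constructor
    · intro h
      have : B.repr (T.mkQ (Additive.ofMul (QuotientGroup.mk' P x))) = 0 := Finsupp.ext h
      rwa [map_eq_zero_iff _ B.repr.injective] at this
    · intro h i
      change B.repr (Submodule.Quotient.mk _) i = 0
      rw [h, map_zero]; rfl
  have hPΘ : ∀ x ∈ P, Θ x = 0 := by
    intro x hx
    rw [hr0]
    have : QuotientGroup.mk' P x = 1 := (QuotientGroup.eq_one_iff x).2 hx
    rw [this]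
    exact T.zero_mem
  let q : N → ℕ := fun x => ∑ i, (r x i).natAbs ^ 2
  have hq : ∀ x, ‖Θ x‖ ^ 2 = q x := by
    intro x
    rw [EuclideanSpace.norm_sq_eq]
    simp only [q, Θ]
    push_cast
    refine Finset.sum_congr rfl fun i _ => ?_
    rw [Real.norm_eq_abs, sq_abs, Nat.cast_natAbs, Int.cast_abs, sq_abs]
  have hqf : ∀ n, (Θ '' {x | q x ≤ n}).Finite := by
    intro n
    have : (Set.Icc (fun _ : ι => -(n : ℤ)) (fun _ => n)).Finite := Set.finite_Icc _ _
    refine (this.image fun v : ι → ℤ =>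
      (WithLp.toLp 2 fun i => (v i : ℝ) : EuclideanSpace ℝ ι)).subset ?_
    rintro _ ⟨x, hx, rfl⟩
    refine ⟨r x, ?_, rfl⟩
    have h1 : ∀ i, (r x i).natAbs ≤ n := by
      intro i
      have h2 : (r x i).natAbs ^ 2 ≤ q x :=
        Finset.single_le_sum (f := fun i => (r x i).natAbs ^ 2) (fun _ _ => Nat.zero_le _)
          (Finset.mem_univ i)
      have h3 : (r x i).natAbs ≤ (r x i).natAbs ^ 2 := Nat.le_self_pow two_ne_zero _
      exact h3.trans (h2.trans hx)
    exact ⟨fun i => by have := h1 i; simp only; omega, fun i => by have := h1 i; simp only; omega⟩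
  let M : Subgroup N :=
    { carrier := {x | Θ x = 0}
      one_mem' := map_one_eq_zero hΘ
      mul_mem' := fun {x y} hx hy => by
        change Θ (x * y) = 0
        rw [hΘ, show Θ x = 0 from hx, show Θ y = 0 from hy, add_zero]
      inv_mem' := fun {x} hx => by
        change Θ x⁻¹ = 0
        rw [map_inv_eq_neg hΘ, show Θ x = 0 from hx, neg_zero] }
  have hMfg : M.FG := by
    refine fg_kernel hΘ hN hq hqf M (fun x => Iff.rfl) fun χ hχ => ?_
    obtain ⟨D, z, hz, ⟨F, hF, hDF⟩, hpos, hchain⟩ := H (fun x => ⟪χ, Θ x⟫)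
      (fun x y => by rw [hΘ, inner_add_right])
      (fun x hx => by rw [hPΘ x hx, inner_zero_right])
      (by
        obtain ⟨i, hi⟩ : ∃ i, χ i ≠ 0 := by
          by_contra hcon
          push Not at hcon
          exact hχ (by ext i; exact hcon i)
        obtain ⟨a, ha⟩ := T.mkQ_surjective (B i)
        obtain ⟨x, hx⟩ := QuotientGroup.mk'_surjective P a.toMul
        refine ⟨x, ?_⟩
        have h1 : ∀ j, r x j = if i = j then 1 else 0 := by
          intro j
          simp only [r, hx, ofMul_toMul, ha, Module.Basis.repr_self, Finsupp.single_apply]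
        have h2 : Θ x = EuclideanSpace.single i (1 : ℝ) := by
          ext j
          simp only [Θ, h1, PiLp.single_apply, eq_comm (a := j)]
          split_ifs <;> simp
        rw [h2, EuclideanSpace.inner_single_right]
        simpa using hi)
    refine ⟨D, z, hz, (hF.image Θ).subset ?_, hpos, hchain⟩
    rintro _ ⟨y, hy, rfl⟩
    obtain ⟨f, hf, hfy⟩ := hDF y hy
    refine ⟨f, hf, ?_⟩
    have := hPΘ _ hfy
    rw [hΘ, map_inv_eq_neg hΘ, neg_add_eq_zero] at this
    exact this
  refine fg_of_finite_quotient (M := M) (fun x hx => hPΘ x hx) hMfg (QuotientGroup.mk' P)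
    (QuotientGroup.ker_mk' P) ?_
  have h1 : (Additive.toMul '' (T : Set (Additive (N ⧸ P)))).Finite :=
    (Set.toFinite (T : Set (Additive (N ⧸ P)))).image _
  refine h1.subset ?_
  rintro _ ⟨x, hx, rfl⟩
  exact ⟨_, (hr0 x).1 hx, rfl⟩

/-- If every nonzero additive character of `N` which is invariant under `G` has suitable commuting
elements outside its kernel, then `⁅N, G⁆` is finitely generated. -/
theorem fg_commutator {G : Type*} [Group G] (N : Subgroup G) [N.Normal] (hN : N.FG)
    (H : ∀ χ : N → ℝ, (∀ x y, χ (x * y) = χ x + χ y) →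
      (∀ x : N, (x : G) ∈ ⁅N, (⊤ : Subgroup G)⁆ → χ x = 0) →
      (∃ x, χ x ≠ 0) →
      ∃ X : Set G, Subgroup.closure X = ⊤ ∧ ∃ Z : Set N, Z.Finite ∧ Z.Nonempty ∧
        (∀ z ∈ Z, χ z ≠ 0) ∧
        (∀ z ∈ Z, ∀ z' ∈ Z, ReflTransGen (fun a b => a ∈ Z ∧ b ∈ Z ∧ Commute (a : G) b) z z') ∧
        ∀ x ∈ X, ∃ z ∈ Z, Commute x (z : G)) :
    (⁅N, (⊤ : Subgroup G)⁆).FG := by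
  have hle : ⁅N, (⊤ : Subgroup G)⁆ ≤ N := Subgroup.commutator_le_left N ⊤
  have hcm : ∀ x ∈ N, ∀ g : G, x * g * x⁻¹ * g⁻¹ ∈ ⁅N, (⊤ : Subgroup G)⁆ := fun x hx g =>
    Subgroup.commutator_mem_commutator hx (Subgroup.mem_top g)
  have hP : (⁅N, (⊤ : Subgroup G)⁆.subgroupOf N).FG := by
    refine fg_of_directions ((Group.fg_iff_subgroup_fg N).2 hN) _
      (fun x y => by
        rw [Subgroup.mem_subgroupOf]
        exact hcm x x.2 y) fun χ hχ hχP hχ0 => ?_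
    obtain ⟨X, hX, Z, hZf, ⟨z₀, hz₀⟩, hZ0, hZc, hXZ⟩ := H χ hχ
      (fun x hx => hχP x (Subgroup.mem_subgroupOf.2 hx)) hχ0
    -- choose signs
    let sg : N → N := fun z => if 0 < χ z then z else z⁻¹
    have hsg : ∀ z ∈ Z, 0 < χ (sg z) := by
      intro z hz
      simp only [sg]
      split_ifs with h
      · exact h
      · rw [map_inv_eq_neg hχ]
        exact neg_pos.2 (lt_of_le_of_ne (not_lt.1 h) (hZ0 z hz))
    have hsgc : ∀ (z : N) (x : G), Commute x (z : G) → Commute x (sg z : G) := by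
      intro z x h
      simp only [sg]
      split_ifs
      · exact h
      · exact h.inv_right
    let cj : G → N → N := fun g x => ⟨g * x * g⁻¹, (inferInstance : N.Normal).conj_mem x x.2 g⟩
    have hcj : ∀ g x, x⁻¹ * cj g x ∈ ⁅N, (⊤ : Subgroup G)⁆.subgroupOf N := by
      intro g x
      rw [Subgroup.mem_subgroupOf]
      have := hcm _ (inv_mem x.2) g
      rw [inv_inv] at this
      change (x : G)⁻¹ * (g * x * g⁻¹) ∈ _
      have e : (x : G)⁻¹ * (g * x * g⁻¹) = (x : G)⁻¹ * g * x * g⁻¹ := by group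
      rwa [e]
    have hcjχ : ∀ g x, χ (cj g x) = χ x := by
      intro g x
      have := hχP _ (hcj g x)
      rw [hχ, map_inv_eq_neg hχ] at this
      linarith
    -- Conjugation by `G` is trivial modulo the commutator subgroup, so `D` is finite modulo it and
    -- `χ` remains positive on `D`.
    let D : Set N := {y | ∃ g : G, ∃ z ∈ Z, y = cj g (sg z)}
    have hcjcj : ∀ g h x, cj g (cj h x) = cj (g * h) x := by
      intro g h x
      apply Subtype.ext
      change g * (h * x * h⁻¹) * g⁻¹ = g * h * x * (g * h)⁻¹
      group
    have hcj1 : ∀ x, cj 1 x = x := by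
      intro x
      apply Subtype.ext
      change 1 * (x : G) * 1⁻¹ = x
      group
    have hZD : ∀ z ∈ Z, sg z ∈ D := fun z hz => ⟨1, z, hz, (hcj1 _).symm⟩
    set R : N → N → Prop := ReflTransGen (fun a b => a ∈ D ∧ b ∈ D ∧ Commute a b) with hR
    have hRsymm : ∀ {a b}, R a b → R b a := by
      intro a b h
      have : Std.Symm (fun a b : N => a ∈ D ∧ b ∈ D ∧ Commute a b) :=
        ⟨fun a b h => ⟨h.2.1, h.1, h.2.2.symm⟩⟩
      exact Std.Symm.symm (r := ReflTransGen (fun a b : N => a ∈ D ∧ b ∈ D ∧ Commute a b)) _ _ h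
    have hRcj : ∀ (g : G) {a b}, R a b → R (cj g a) (cj g b) := by
      intro g a b h
      have hD : ∀ a ∈ D, cj g a ∈ D := by
        rintro _ ⟨h, z, hz, rfl⟩
        exact ⟨g * h, z, hz, hcjcj _ _ _⟩
      refine ReflTransGen.lift (cj g) ?_ _ _ h
      rintro a b ⟨ha, hb, hab⟩
      refine ⟨hD a ha, hD b hb, Subtype.ext ?_⟩
      change g * a * g⁻¹ * (g * b * g⁻¹) = g * b * g⁻¹ * (g * a * g⁻¹)
      have : (a : G) * b = b * a := congrArg Subtype.val hab
      calc _ = g * (a * b) * g⁻¹ := by group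
        _ = _ := by rw [this]; group
    have hRZ : ∀ z ∈ Z, ∀ z' ∈ Z, R (sg z) (sg z') := by
      intro z hz z' hz'
      refine ReflTransGen.lift sg ?_ _ _ (hZc z hz z' hz')
      rintro a b ⟨ha, hb, hab⟩
      refine ⟨hZD a ha, hZD b hb, Subtype.ext ?_⟩
      exact hsgc b _ (hsgc a _ hab.symm).symm
    -- For a generator `x`, go from `z₀` to a `z` commuting with `x`, which conjugation by `x`
    -- fixes, and return along the conjugated chain. Products and inverses follow by transporting
    -- chains.
    have hmove : ∀ g : G, R (sg z₀) (cj g (sg z₀)) := by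
      intro g
      have hg : g ∈ Subgroup.closure X := hX ▸ Subgroup.mem_top g
      induction hg using Subgroup.closure_induction with
      | mem x hx =>
        obtain ⟨z, hz, hc⟩ := hXZ x hx
        have h1 : cj x (sg z) = sg z := by
          apply Subtype.ext
          change x * sg z * x⁻¹ = sg z
          rw [(hsgc z x hc).eq, mul_inv_cancel_right]
        have h2 := hRZ z₀ hz₀ z hz
        have h3 := hRcj x h2
        rw [h1] at h3
        exact ReflTransGen.trans h2 (hRsymm h3)
      | one => rw [hcj1]
      | mul g h _ _ hg hh =>
        rw [← hcjcj]
        exact ReflTransGen.trans hg (hRcj g hh)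
      | inv g _ hg =>
        have := hRcj g⁻¹ hg
        rw [hcjcj, inv_mul_cancel, hcj1] at this
        exact hRsymm this
    refine ⟨D, sg z₀, hZD z₀ hz₀, ⟨sg '' Z, hZf.image _, ?_⟩, ?_, fun s => hmove s⟩
    · rintro _ ⟨g, z, hz, rfl⟩
      exact ⟨_, ⟨z, hz, rfl⟩, hcj g _⟩
    · rintro _ ⟨g, z, hz, rfl⟩
      rw [hcjχ]
      exact hsg z hz
  have h2 : ((⁅N, (⊤ : Subgroup G)⁆.subgroupOf N).map N.subtype).FG := by
    rw [Subgroup.fg_iff_submonoid_fg] at hP ⊢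
    exact hP.map N.subtype
  rwa [Subgroup.subgroupOf_map_subtype, inf_eq_left.2 hle] at h2

end Pushing


/-! ### Real characters of the lower central series -/

open scoped commutatorElement

section LcsChar

variable {A : Type*} [Group A] {H : Subgroup A}

/-- A real valued function which is additive on the `j`-th term of the lower central series of `H`
and vanishes on the next term. -/
structure IsLcsChar (H : Subgroup A) (j : ℕ) (χ : A → ℝ) : Prop where
  map_mul : ∀ x ∈ H.lowerCentralSeries j, ∀ y ∈ H.lowerCentralSeries j, χ (x * y) = χ x + χ y
  map_succ : ∀ x ∈ H.lowerCentralSeries (j + 1), χ x = 0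

/-- A real valued function which is additive on `H`. -/
def AdditiveOn (H : Subgroup A) (ψ : A → ℝ) : Prop := ∀ x ∈ H, ∀ y ∈ H, ψ (x * y) = ψ x + ψ y

theorem AdditiveOn.map_one {ψ : A → ℝ} (h : AdditiveOn H ψ) : ψ 1 = 0 := by
  have := h 1 (one_mem _) 1 (one_mem _)
  rwa [mul_one, left_eq_add] at this

theorem AdditiveOn.map_inv {ψ : A → ℝ} (h : AdditiveOn H ψ) {x : A} (hx : x ∈ H) :
    ψ x⁻¹ = -ψ x := by
  have := h _ (inv_mem hx) _ hx
  rw [inv_mul_cancel, h.map_one] at this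
  linarith

theorem AdditiveOn.eq_zero {ψ : A → ℝ} (h : AdditiveOn H ψ) {S : Set A}
    (hS : Subgroup.closure S = H) (h0 : ∀ x ∈ S, ψ x = 0) {x : A} (hx : x ∈ H) : ψ x = 0 := by
  subst hS
  induction hx using Subgroup.closure_induction with
  | mem x hx => exact h0 x hx
  | one => exact h.map_one
  | mul x y hx hy ih1 ih2 => rw [h x hx y hy, ih1, ih2, add_zero]
  | inv x hx ih => rw [h.map_inv hx, ih, neg_zero]

theorem AdditiveOn.conj [hH : H.Normal] {ψ : A → ℝ} (h : AdditiveOn H ψ) (g : A) :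
    AdditiveOn H (fun x => ψ (g * x * g⁻¹)) := by
  intro x hx y hy
  have e : g * (x * y) * g⁻¹ = g * x * g⁻¹ * (g * y * g⁻¹) := by group
  simp only
  rw [e, h _ (hH.conj_mem x hx g) _ (hH.conj_mem y hy g)]

theorem AdditiveOn.conj_self {ψ : A → ℝ} (h : AdditiveOn H ψ) {g x : A} (hg : g ∈ H)
    (hx : x ∈ H) : ψ (g * x * g⁻¹) = ψ x := by
  rw [h _ (mul_mem hg hx) _ (inv_mem hg), h _ hg _ hx, h.map_inv hg]; ring

variable {j : ℕ} {χ : A → ℝ}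

theorem IsLcsChar.additiveOn (h : IsLcsChar H j χ) :
    AdditiveOn (H.lowerCentralSeries j) χ := h.map_mul

theorem commutator_mem_lcs {x y : A} (hx : x ∈ H.lowerCentralSeries j) (hy : y ∈ H) :
    ⁅x, y⁆ ∈ H.lowerCentralSeries (j + 1) := Subgroup.commutator_mem_commutator hx hy

theorem lcs_succ_le (H : Subgroup A) (j : ℕ) :
    H.lowerCentralSeries (j + 1) ≤ H.lowerCentralSeries j :=
  H.lowerCentralSeries_antitone j.le_succ

theorem IsLcsChar.conj_self (h : IsLcsChar H j χ) {x y : A} (hx : x ∈ H.lowerCentralSeries j)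
    (hy : y ∈ H) : χ (y * x * y⁻¹) = χ x := by
  have h1 := commutator_mem_lcs hx hy
  have h2 := h.map_mul _ (inv_mem (lcs_succ_le H j h1)) x hx
  rw [h.map_succ _ (inv_mem h1), zero_add] at h2
  rw [← h2, commutatorElement_inv, commutatorElement_def, inv_mul_cancel_right]

theorem lcs_conj_mem {x y : A} (hx : x ∈ H.lowerCentralSeries j) (hy : y ∈ H) :
    y * x * y⁻¹ ∈ H.lowerCentralSeries j :=
  (Subgroup.mem_normalizer_iff.1 (H.self_le_normalizer_lowerCentralSeries j hy) x).1 hx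

theorem IsLcsChar.conj [hH : H.Normal] (h : IsLcsChar H j χ) (g : A) :
    IsLcsChar H j (fun x => χ (g * x * g⁻¹)) where
  map_mul := h.additiveOn.conj g
  map_succ x hx := h.map_succ _ ((H.lowerCentralSeries_normal (j + 1)).conj_mem x hx g)

/-- The commutator is bilinear modulo the next term: the conjugation appearing in the commutator
identity is invisible to `χ`. -/
theorem IsLcsChar.commutator_left (h : IsLcsChar H (j + 1) χ) {y : A} (hy : y ∈ H) :
    IsLcsChar H j (fun x => χ ⁅x, y⁆) where
  map_mul x hx x' hx' := by
    have e : ⁅x * x', y⁆ = x * ⁅x', y⁆ * x⁻¹ * ⁅x, y⁆ := by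
      simp only [commutatorElement_def]; group
    have hx'H := H.lowerCentralSeries_le_self j hx
    rw [e, h.map_mul _ (lcs_conj_mem (commutator_mem_lcs hx' hy) hx'H) _
      (commutator_mem_lcs hx hy), h.conj_self (commutator_mem_lcs hx' hy) hx'H, add_comm]
  map_succ x hx := h.map_succ _ (commutator_mem_lcs hx hy)

theorem IsLcsChar.commutator_right (h : IsLcsChar H (j + 1) χ) {x : A}
    (hx : x ∈ H.lowerCentralSeries j) : AdditiveOn H (fun y => χ ⁅x, y⁆) := by
  intro y hy y' hy'
  have e : ⁅x, y * y'⁆ = ⁅x, y⁆ * (y * ⁅x, y'⁆ * y⁻¹) := by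
    simp only [commutatorElement_def]; group
  simp only
  rw [e, h.map_mul _ (commutator_mem_lcs hx hy) _ (lcs_conj_mem (commutator_mem_lcs hx hy') hy),
    h.conj_self (commutator_mem_lcs hx hy') hy]

/-- A nonzero character does not vanish on all left normed commutators in the generators. -/
theorem IsLcsChar.exists_ne_zero {S : Set A} (hS : Subgroup.closure S = H) (B : ℕ → Set A)
    (hB0 : ∀ x ∈ S, x ∈ B 0) (hB : ∀ j, ∀ x ∈ B j, ∀ y ∈ S, ⁅x, y⁆ ∈ B (j + 1)) (j : ℕ)
    (χ : A → ℝ) (h : IsLcsChar H j χ) (h0 : ∃ x ∈ H.lowerCentralSeries j, χ x ≠ 0) :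
    ∃ x ∈ B j, x ∈ H.lowerCentralSeries j ∧ χ x ≠ 0 := by
  have hSH : ∀ y ∈ S, y ∈ H := fun y hy => hS ▸ Subgroup.subset_closure hy
  by_contra hcon
  push Not at hcon
  obtain ⟨x, hx, hx0⟩ := h0
  refine hx0 ?_
  clear hx0
  induction j generalizing χ x with
  | zero =>
    exact h.additiveOn.eq_zero (H := H) hS (fun y hy => hcon y (hB0 y hy) (hSH y hy)) hx
  | succ j ih =>
    refine h.additiveOn.eq_zero (S := {x | ∃ p ∈ H.lowerCentralSeries j, ∃ q ∈ H, ⁅p, q⁆ = x})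
      rfl ?_ hx
    rintro _ ⟨p, hp, q, hq, rfl⟩
    refine (h.commutator_right hp).eq_zero hS (fun y hy => ?_) hq
    exact ih _ (h.commutator_left (hSH y hy))
      (fun z hz hzj => hcon _ (hB j z hz y hy) (commutator_mem_lcs hzj (hSH y hy))) p hp

end LcsChar

/-! ### Polynomial dependence on unipotent conjugation -/

section Polynomial

open Polynomial

/-- A sequence with vanishing third differences is a quadratic polynomial. -/
theorem eq_interpolation_of_third_difference {f : ℕ → ℝ}
    (h : ∀ t, f (t + 3) - 3 * f (t + 2) + 3 * f (t + 1) - f t = 0) (t : ℕ) :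
    f t = ((t - 1) * (t - 2) / 2) * f 0 + (-(t * (t - 2))) * f 1 + (t * (t - 1) / 2) * f 2 := by
  induction t using Nat.strong_induction_on with
  | _ t ih =>
    rcases t with _ | _ | _ | t
    · norm_num
    · norm_num
    · norm_num
    · have h0 := ih t (by omega)
      have h1 := ih (t + 1) (by omega)
      have h2 := ih (t + 2) (by omega)
      have h3 := h t
      push_cast at *
      have : f (t + 3) = 3 * f (t + 2) - 3 * f (t + 1) + f t := by linarith
      rw [this, h0, h1, h2]
      ring

variable {A : Type*} [Group A] {H : Subgroup A}

/-- Conjugation by `e` acts on the abelianization of `H` unipotently of class three. -/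
def UnipotentOn (H : Subgroup A) (e : A) : Prop :=
  ∀ ψ : A → ℝ, AdditiveOn H ψ → ∀ y ∈ H,
    ψ (e * (e * (e * y * e⁻¹) * e⁻¹) * e⁻¹) - 3 * ψ (e * (e * y * e⁻¹) * e⁻¹) +
      3 * ψ (e * y * e⁻¹) - ψ y = 0

theorem UnipotentOn.interpolation [hH : H.Normal] {e : A} (he : UnipotentOn H e) {ψ : A → ℝ}
    (hψ : AdditiveOn H ψ) {y : A} (hy : y ∈ H) (t : ℕ) :
    ψ (e ^ t * y * (e ^ t)⁻¹) = ((t - 1) * (t - 2) / 2) * ψ y +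
      (-(t * (t - 2))) * ψ (e ^ 1 * y * (e ^ 1)⁻¹) +
      (t * (t - 1) / 2) * ψ (e ^ 2 * y * (e ^ 2)⁻¹) := by
  have hstep : ∀ t : ℕ, e * (e ^ t * y * (e ^ t)⁻¹) * e⁻¹ = e ^ (t + 1) * y * (e ^ (t + 1))⁻¹ :=
    fun t => by rw [pow_succ', mul_inv_rev]; simp only [mul_assoc]
  have := eq_interpolation_of_third_difference (f := fun t => ψ (e ^ t * y * (e ^ t)⁻¹))
    (fun t => by
      have h := he ψ hψ (e ^ t * y * (e ^ t)⁻¹) (hH.conj_mem y hy _)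
      rwa [hstep, hstep, hstep] at h) t
  simpa using this

/-- For a commutator, conjugation acts on both slots. With the second slot frozen, the dependence on
the first is polynomial by induction. The second slot is a quadratic combination of its values at 0,
1 and 2, so only three frozen slots are needed. -/
theorem UnipotentOn.exists_polynomial [hH : H.Normal] {e : A} (he : UnipotentOn H e) (j : ℕ)
    {χ : A → ℝ} (h : IsLcsChar H j χ) {z : A} (hz : z ∈ H.lowerCentralSeries j) :
    ∃ p : ℝ[X], ∀ t : ℕ, χ (e ^ t * z * (e ^ t)⁻¹) = p.eval (t : ℝ) := by
  induction j generalizing χ z with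
  | zero =>
    refine ⟨C (χ z) * ((X - 1) * (X - 2) * C (1 / 2)) +
      C (χ (e ^ 1 * z * (e ^ 1)⁻¹)) * (-(X * (X - 2))) +
      C (χ (e ^ 2 * z * (e ^ 2)⁻¹)) * (X * (X - 1) * C (1 / 2)), fun t => ?_⟩
    rw [he.interpolation (h.additiveOn (j := 0)) hz]
    simp
    ring
  | succ j ih =>
    have hconj : ∀ (g : A), ∀ x ∈ H.lowerCentralSeries (j + 1),
        g * x * g⁻¹ ∈ H.lowerCentralSeries (j + 1) := fun g x hx =>
      (H.lowerCentralSeries_normal (j + 1)).conj_mem x hx g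
    have hz' : z ∈ Subgroup.closure {x | ∃ p ∈ H.lowerCentralSeries j, ∃ q ∈ H, ⁅p, q⁆ = x} := hz
    clear hz
    induction hz' using Subgroup.closure_induction with
    | mem z hz =>
      obtain ⟨x, hx, y, hy, rfl⟩ := hz
      have hc : ∀ s : ℕ, ∃ p : ℝ[X], ∀ t : ℕ,
          χ ⁅e ^ t * x * (e ^ t)⁻¹, e ^ s * y * (e ^ s)⁻¹⁆ = p.eval (t : ℝ) := fun s =>
        ih (h.commutator_left (hH.conj_mem y hy (e ^ s))) hx
      obtain ⟨p₀, h₀⟩ := hc 0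
      obtain ⟨p₁, h₁⟩ := hc 1
      obtain ⟨p₂, h₂⟩ := hc 2
      refine ⟨p₀ * ((X - 1) * (X - 2) * C (1 / 2)) + p₁ * (-(X * (X - 2))) +
        p₂ * (X * (X - 1) * C (1 / 2)), fun t => ?_⟩
      have e1 : e ^ t * ⁅x, y⁆ * (e ^ t)⁻¹ =
          ⁅e ^ t * x * (e ^ t)⁻¹, e ^ t * y * (e ^ t)⁻¹⁆ := by
        simp only [commutatorElement_def]; group
      have hxt := (H.lowerCentralSeries_normal j).conj_mem x hx (e ^ t)
      rw [e1, he.interpolation (h.commutator_right hxt) hy t]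
      simp only [eval_add, eval_mul, eval_neg, eval_sub, eval_X, eval_one, eval_C,
        ← h₀, ← h₁, ← h₂, eval_ofNat, pow_zero, one_mul, inv_one, mul_one]
      ring
    | one => exact ⟨0, fun t => by
        rw [mul_one, mul_inv_cancel, h.additiveOn.map_one, eval_zero]⟩
    | mul x y hx hy ihx ihy =>
      obtain ⟨p, hp⟩ := ihx
      obtain ⟨p', hp'⟩ := ihy
      refine ⟨p + p', fun t => ?_⟩
      have := h.additiveOn.conj (hH := H.lowerCentralSeries_normal (j + 1)) (e ^ t) x hx y hy
      simp only at this
      rw [this, hp, hp', eval_add]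
    | inv x hx ihx =>
      obtain ⟨p, hp⟩ := ihx
      refine ⟨-p, fun t => ?_⟩
      rw [eval_neg, ← hp, ← h.additiveOn.map_inv (hconj _ x hx)]
      congr 1
      group

/-- The functions on a group which are polynomial along the one parameter families defined by the
elements of `U`, and invariant under `H`. -/
structure PolynomialAlong (U : Set A) (H : Subgroup A) (f : A → ℝ) : Prop where
  polynomial : ∀ e ∈ U, ∀ g h, ∃ p : ℝ[X], ∀ t : ℕ, f (g * e ^ t * h) = p.eval (t : ℝ)
  invariant : ∀ x ∈ H, ∀ g h, f (g * x * h) = f (g * h)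

theorem PolynomialAlong.mul {U : Set A} {f f' : A → ℝ} (hf : PolynomialAlong U H f)
    (hf' : PolynomialAlong U H f') : PolynomialAlong U H (fun g => f g * f' g) where
  polynomial e he g h := by
    obtain ⟨p, hp⟩ := hf.polynomial e he g h
    obtain ⟨p', hp'⟩ := hf'.polynomial e he g h
    exact ⟨p * p', fun t => by rw [eval_mul, hp, hp']⟩
  invariant x hx g h := by rw [hf.invariant x hx, hf'.invariant x hx]

theorem exists_nat_eval_ne_zero {p : ℝ[X]} (hp : p ≠ 0) : ∃ t : ℕ, p.eval (t : ℝ) ≠ 0 := by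
  by_contra hcon
  push Not at hcon
  refine hp (Polynomial.eq_zero_of_infinite_isRoot p ?_)
  refine (Set.infinite_range_of_injective (Nat.cast_injective (R := ℝ))).mono ?_
  rintro _ ⟨t, rfl⟩
  exact hcon t

/-- A word leading from `a` to `b` is consumed one generator at a time, keeping `f g ≠ 0` and `f' (g
* u) ≠ 0` for the remaining word `u`. Along a generator in `U` both are nonzero polynomials in the
exponent, hence simultaneously nonzero at some natural number; a generator in `H` can simply be
dropped. -/
theorem PolynomialAlong.exists_ne_zero_mul {U : Set A} {f f' : A → ℝ}
    (hf : PolynomialAlong U H f) (hf' : PolynomialAlong U H f') {a b : A}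
    (ha : a ∈ Subgroup.closure (U ∪ H)) (hb : b ∈ Subgroup.closure (U ∪ H))
    (hfa : f a ≠ 0) (hfb : f' b ≠ 0) : ∃ c ∈ Subgroup.closure (U ∪ H), f c * f' c ≠ 0 := by
  have two : ∀ e ∈ U, ∀ g u, g ∈ Subgroup.closure (U ∪ H) → (∃ s : ℕ, f (g * e ^ s) ≠ 0) →
      (∃ s : ℕ, f' (g * e ^ s * u) ≠ 0) → ∃ c ∈ Subgroup.closure (U ∪ H),
      f c ≠ 0 ∧ f' (c * u) ≠ 0 := by
    rintro e he g u hg ⟨s, hs⟩ ⟨s', hs'⟩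
    obtain ⟨p, hp⟩ := hf.polynomial e he g 1
    obtain ⟨p', hp'⟩ := hf'.polynomial e he g u
    simp only [mul_one] at hp
    rw [hp] at hs
    rw [hp'] at hs'
    have h1 : p ≠ 0 := by rintro rfl; simp at hs
    have h2 : p' ≠ 0 := by rintro rfl; simp at hs'
    obtain ⟨t, ht⟩ := exists_nat_eval_ne_zero (mul_ne_zero h1 h2)
    rw [eval_mul, ← hp, ← hp'] at ht
    have heU : e ∈ Subgroup.closure (U ∪ H) := Subgroup.subset_closure (Or.inl he)
    exact ⟨g * e ^ t, mul_mem hg (pow_mem heU t),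
      left_ne_zero_of_mul ht, right_ne_zero_of_mul ht⟩
  have key : ∀ u ∈ Subgroup.closure (U ∪ H), ∀ g ∈ Subgroup.closure (U ∪ H), f g ≠ 0 →
      f' (g * u) ≠ 0 → ∃ c ∈ Subgroup.closure (U ∪ H), f c * f' c ≠ 0 := by
    intro u hu
    induction hu using Subgroup.closure_induction_left with
    | one => exact fun g hg h h' => ⟨g, hg, mul_ne_zero h (by rwa [mul_one] at h')⟩
    | mul_left x hx u hu ih =>
      intro g hg h h'
      rcases hx with hx | hx
      · obtain ⟨c, hc, h1, h2⟩ := two x hx g u hg ⟨0, by rwa [pow_zero, mul_one]⟩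
          ⟨1, by rwa [pow_one, mul_assoc]⟩
        exact ih c hc h1 h2
      · rw [← mul_assoc, hf'.invariant x hx] at h'
        exact ih g hg h h'
    | inv_mul_cancel x hx u hu ih =>
      intro g hg h h'
      rcases hx with hx | hx
      -- Only natural exponents are available, so the line is started at `g * x⁻¹`: exponent one is
      -- nonzero for `f`, exponent zero for `f'`.
      · obtain ⟨c, hc, h1, h2⟩ := two x hx (g * x⁻¹) u
          (mul_mem hg (inv_mem (Subgroup.subset_closure (Or.inl hx))))
          ⟨1, by rwa [pow_one, inv_mul_cancel_right]⟩
          ⟨0, by rwa [pow_zero, mul_one, mul_assoc]⟩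
        exact ih c hc h1 h2
      · rw [← mul_assoc, hf'.invariant _ (inv_mem hx)] at h'
        exact ih g hg h h'
  exact key (a⁻¹ * b) (mul_mem (inv_mem ha) hb) a ha hfa (by rwa [mul_inv_cancel_left])

theorem PolynomialAlong.exists_ne_zero {U : Set A} {ι : Type*} (s : Finset ι) (f : ι → A → ℝ)
    (hf : ∀ i ∈ s, PolynomialAlong U H (f i))
    (h : ∀ i ∈ s, ∃ a ∈ Subgroup.closure (U ∪ H), f i a ≠ 0) :
    ∃ a ∈ Subgroup.closure (U ∪ H), ∀ i ∈ s, f i a ≠ 0 := by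
  classical
  suffices ∃ F : A → ℝ, PolynomialAlong U H F ∧ (∃ a ∈ Subgroup.closure (U ∪ H), F a ≠ 0) ∧
      ∀ a, F a ≠ 0 → ∀ i ∈ s, f i a ≠ 0 by
    obtain ⟨F, -, ⟨a, ha, hFa⟩, hF⟩ := this
    exact ⟨a, ha, hF a hFa⟩
  induction s using Finset.induction_on with
  | empty =>
    exact ⟨fun _ => 1, ⟨fun _ _ _ _ => ⟨1, fun _ => by rw [eval_one]⟩, fun _ _ _ _ => rfl⟩,
      ⟨1, one_mem _, one_ne_zero⟩, by simp⟩
  | insert i s hi ih =>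
    obtain ⟨F, hF, ⟨a, ha, hFa⟩, hFs⟩ := ih (fun k hk => hf k (Finset.mem_insert_of_mem hk))
      (fun k hk => h k (Finset.mem_insert_of_mem hk))
    obtain ⟨b, hb, hfb⟩ := h i (Finset.mem_insert_self i s)
    have hfi := hf i (Finset.mem_insert_self i s)
    obtain ⟨c, hc, hc0⟩ := hF.exists_ne_zero_mul hfi ha hb hFa hfb
    refine ⟨_, hF.mul hfi, ⟨c, hc, hc0⟩, fun a ha k hk => ?_⟩
    rcases Finset.mem_insert.1 hk with rfl | hk
    · exact right_ne_zero_of_mul ha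
    · exact hFs a (left_ne_zero_of_mul ha) k hk

theorem IsLcsChar.polynomialAlong [hH : H.Normal] {U : Set A} (hU : ∀ e ∈ U, UnipotentOn H e)
    {j : ℕ} {χ : A → ℝ} (h : IsLcsChar H j χ) {z : A} (hz : z ∈ H.lowerCentralSeries j) :
    PolynomialAlong U H (fun g => χ (g * z * g⁻¹)) where
  polynomial e he g k := by
    obtain ⟨p, hp⟩ := (hU e he).exists_polynomial j (h.conj g)
      ((H.lowerCentralSeries_normal j).conj_mem z hz k)
    refine ⟨p, fun t => ?_⟩
    rw [← hp]
    congr 1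
    group
  invariant x hx g k := by
    have h1 := (h.conj g).conj_self ((H.lowerCentralSeries_normal j).conj_mem z hz k) hx
    convert h1 using 2 <;> group

end Polynomial


/-- The functionals `δ` and `δ'` are the first and second differences at `y`; the second one being
invariant, the third difference vanishes. -/
theorem UnipotentOn.of_differences {A : Type*} [Group A] {H : Subgroup A} [H.Normal] {e y : A}
    (δ δ' : (A → ℝ) → ℝ) (h0 : ∀ ψ, AdditiveOn H ψ → ψ (e * y * e⁻¹) = ψ y + δ ψ)
    (h1 : ∀ ψ, AdditiveOn H ψ → δ (fun x => ψ (e * x * e⁻¹)) = δ ψ + δ' ψ)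
    (h2 : ∀ ψ, AdditiveOn H ψ → δ' (fun x => ψ (e * x * e⁻¹)) = δ' ψ) {ψ : A → ℝ}
    (hψ : AdditiveOn H ψ) :
    ψ (e * (e * (e * y * e⁻¹) * e⁻¹) * e⁻¹) - 3 * ψ (e * (e * y * e⁻¹) * e⁻¹) +
      3 * ψ (e * y * e⁻¹) - ψ y = 0 := by
  have hψ1 := hψ.conj e
  have hψ2 := hψ1.conj e
  have a0 := h0 _ hψ
  have a1 := h0 _ hψ1
  have a2 := h0 _ hψ2
  have b0 := h1 _ hψ
  have b1 := h1 _ hψ1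
  have c0 := h2 _ hψ
  linarith

/-- The third difference is itself additive, so it may be tested on generators. -/
theorem UnipotentOn.of_closure {A : Type*} [Group A] {S : Set A} {e : A}
    [hN : (Subgroup.closure S).Normal]
    (h : ∀ y ∈ S, ∀ ψ : A → ℝ, AdditiveOn (Subgroup.closure S) ψ →
      ψ (e * (e * (e * y * e⁻¹) * e⁻¹) * e⁻¹) - 3 * ψ (e * (e * y * e⁻¹) * e⁻¹) +
      3 * ψ (e * y * e⁻¹) - ψ y = 0) : UnipotentOn (Subgroup.closure S) e := by
  intro ψ hψ y hy
  have hψ1 := hψ.conj e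
  have hψ2 := hψ1.conj e
  have hψ3 := hψ2.conj e
  refine AdditiveOn.eq_zero (H := Subgroup.closure S) (ψ := fun y =>
    ψ (e * (e * (e * y * e⁻¹) * e⁻¹) * e⁻¹) - 3 * ψ (e * (e * y * e⁻¹) * e⁻¹) +
      3 * ψ (e * y * e⁻¹) - ψ y) (fun x hx y hy => ?_) rfl (fun y hy => h y hy ψ hψ) hy
  have a0 := hψ x hx y hy
  have a1 := hψ1 x hx y hy
  have a2 := hψ2 x hx y hy
  have a3 := hψ3 x hx y hy
  simp only at a1 a2 a3 ⊢
  rw [a0, a1, a2, a3]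
  ring

namespace AutFree

/-! ### Transvections act unipotently on the characters of the Torelli group -/

section Unipotent

variable {α : Type*} [DecidableEq α]

open FreeGroup (of)
open scoped commutatorElement

variable {ψ : MulAut (FreeGroup α) → ℝ} (hψ : AdditiveOn (magnusSubgroup α) ψ)
include hψ

theorem char_rightMul_conj {a : α} {u w : FreeGroup α} (hu : u ∈ away a) (hw : w ∈ away a)
    (h : rightMul a w ∈ magnusSubgroup α) :
    ψ (rightMul a (u * w * u⁻¹)) = ψ (rightMul a w) := by
  rw [partialConj_conj_rightMul hu hw, hψ.conj_self (partialConj_mem hu) h]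

theorem char_commutator_mul {a : α} {u u' v : FreeGroup α} (hu : u ∈ away a) (hu' : u' ∈ away a)
    (hv : v ∈ away a) : ψ (rightMul a ⁅u * u', v⁆) =
      ψ (rightMul a ⁅u, v⁆) + ψ (rightMul a ⁅u', v⁆) := by
  have e : ⁅u * u', v⁆ = u * ⁅u', v⁆ * u⁻¹ * ⁅u, v⁆ := by
    simp only [commutatorElement_def]; group
  have h1 := commutator_mem_away hu' hv
  have h2 := rightMul_commutator_mem hu' hv
  have h3 := mul_mem (mul_mem hu h1) (inv_mem hu)
  rw [e, rightMul_mul h3 (commutator_mem_away hu hv), hψ _ ?_ _ (rightMul_commutator_mem hu hv),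
    char_rightMul_conj hψ hu h1 h2, add_comm]
  rw [partialConj_conj_rightMul hu h1]
  exact mul_mem (mul_mem (partialConj_mem hu) h2) (inv_mem (partialConj_mem hu))

theorem char_commutator_self (a : α) (u : FreeGroup α) : ψ (rightMul a ⁅u, u⁆) = 0 := by
  rw [commutatorElement_self, rightMul, transv_one_one, hψ.map_one]

theorem char_commutator_symm {a : α} {u v : FreeGroup α} (hu : u ∈ away a) (hv : v ∈ away a) :
    ψ (rightMul a ⁅v, u⁆) = -ψ (rightMul a ⁅u, v⁆) := by
  rw [← commutatorElement_inv, rightMul_inv (commutator_mem_away hu hv),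
    hψ.map_inv (rightMul_commutator_mem hu hv)]

theorem char_commutator_inv {a : α} {u v : FreeGroup α} (hu : u ∈ away a) (hv : v ∈ away a) :
    ψ (rightMul a ⁅u⁻¹, v⁆) = -ψ (rightMul a ⁅u, v⁆) := by
  have := char_commutator_mul hψ hu (inv_mem hu) hv
  rw [mul_inv_cancel, commutatorElement_one_left, rightMul, transv_one_one, hψ.map_one] at this
  linarith

theorem char_partialConj_mul {a : α} {u v : FreeGroup α} (hu : u ∈ away a) (hv : v ∈ away a) :
    ψ (partialConj a (u * v)) = ψ (partialConj a u) + ψ (partialConj a v) := by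
  rw [partialConj_mul hu hv, hψ _ (partialConj_mem hu) _ (partialConj_mem hv)]

variable {i j : α} (hij : j ≠ i)
include hij

theorem char_conj_partialConj_of_ne {a b : α} (hai : a ≠ i) (haj : a ≠ j) (hba : b ≠ a)
    (hbi : b ≠ i) : ψ (nielsen i j * partialConj a (of b) * (nielsen i j)⁻¹) =
      ψ (partialConj a (of b)) := by
  rw [nielsen_mul_partialConj hij hai haj.symm (of_mem_away hba), mul_inv_cancel_right,
    nielsen_of_ne _ hbi]

theorem char_conj_partialConj_left {a : α} (hai : a ≠ i) (haj : a ≠ j) :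
    ψ (nielsen i j * partialConj a (of i) * (nielsen i j)⁻¹) =
      ψ (partialConj a (of i)) + ψ (partialConj a (of j)) := by
  rw [nielsen_mul_partialConj hij hai haj.symm (of_mem_away hai.symm), mul_inv_cancel_right,
    nielsen_self hij, char_partialConj_mul hψ (of_mem_away hai.symm) (of_mem_away haj.symm)]

theorem char_conj_commutator {a : α} (hai : a ≠ i) (haj : a ≠ j) {u v : FreeGroup α}
    (hu : u ∈ away a) (hv : v ∈ away a) :
    ψ (nielsen i j * rightMul a ⁅u, v⁆ * (nielsen i j)⁻¹) =
      ψ (rightMul a ⁅nielsen i j u, nielsen i j v⁆) := by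
  rw [nielsen_mul_rightMul hij hai haj.symm (commutator_mem_away hu hv), mul_inv_cancel_right,
    map_commutatorElement]

theorem char_conj_partialConj_self {b : α} (hbi : b ≠ i) :
    ψ (nielsen i j * partialConj i (of b) * (nielsen i j)⁻¹) =
      ψ (partialConj i (of b)) - ψ (rightMul i ⁅of b, of j⁆) := by
  have hb := of_mem_away hbi
  have hj := of_mem_away hij
  rw [nielsen_mul_partialConj_self hij hb, mul_inv_cancel_right,
    hψ _ (partialConj_mem hb) _ (rightMul_commutator_mem (inv_mem hb) hj),
    char_commutator_inv hψ hb hj, sub_eq_add_neg]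

theorem char_conj_commutator_self {u v : FreeGroup α} (hu : u ∈ away i) (hv : v ∈ away i) :
    ψ (nielsen i j * rightMul i ⁅u, v⁆ * (nielsen i j)⁻¹) = ψ (rightMul i ⁅u, v⁆) := by
  have hm := commutator_mem_away hu hv
  rw [nielsen_mul_rightMul_self hij hm, mul_inv_cancel_right,
    char_rightMul_conj hψ (of_mem_away hij) hm (rightMul_commutator_mem hu hv)]

theorem char_conj_partialConj_right {b : α} (hbi : b ≠ i) (hbj : b ≠ j) :
    ψ (nielsen i j * partialConj j (of b) * (nielsen i j)⁻¹) =
      ψ (partialConj j (of b)) - ψ (rightMul i ⁅of j, of b⁆) := by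
  have hb := of_mem_away hbi
  have hb' := of_mem_away hbj
  have hj := of_mem_away hij
  have e : nielsen i j * partialConj j (of b) * (nielsen i j)⁻¹ =
      rightMul i ⁅of j, (of b)⁻¹⁆ * partialConj j (of b) := by
    rw [partialConj, nielsen_mul_transv_right hij (inv_mem hb) hb (inv_mem hb') hb',
      mul_inv_cancel_right]
    rfl
  rw [e, hψ _ (rightMul_commutator_mem hj (inv_mem hb)) _ (partialConj_mem hb'),
    char_commutator_symm hψ (inv_mem hb) hj, char_commutator_inv hψ hb hj,
    char_commutator_symm hψ hj hb]
  ring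

theorem char_conj_partialConj_swap :
    ψ (nielsen i j * partialConj j (of i) * (nielsen i j)⁻¹) =
      ψ (partialConj j (of i)) + ψ (partialConj i (of j)) := by
  rw [nielsen_mul_partialConj_swap hij, mul_inv_cancel_right,
    hψ _ (partialConj_mem (of_mem_away hij)) _ (partialConj_mem (of_mem_away hij.symm)), add_comm]

theorem char_conj_commutator_right {b c : α} (hbi : b ≠ i) (hbj : b ≠ j) (hci : c ≠ i)
    (hcj : c ≠ j) : ψ (nielsen i j * rightMul j ⁅of b, of c⁆ * (nielsen i j)⁻¹) =
      ψ (rightMul j ⁅of b, of c⁆) - ψ (rightMul i ⁅of b, of c⁆) := by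
  have hb := of_mem_away hbi
  have hb' := of_mem_away hbj
  have hc := of_mem_away hci
  have hc' := of_mem_away hcj
  have hj := of_mem_away hij
  have e : ψ (rightMul i (of j * ⁅of c, of b⁆ * (of j)⁻¹)) = ψ (rightMul i ⁅of c, of b⁆) :=
    char_rightMul_conj hψ hj (commutator_mem_away hc hb) (rightMul_commutator_mem hc hb)
  have hmem : rightMul i (of j * ⁅of c, of b⁆ * (of j)⁻¹) ∈ magnusSubgroup α := by
    rw [partialConj_conj_rightMul hj (commutator_mem_away hc hb)]
    exact mul_mem (mul_mem (partialConj_mem hj) (rightMul_commutator_mem hc hb))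
      (inv_mem (partialConj_mem hj))
  have e' : nielsen i j * rightMul j ⁅of b, of c⁆ * (nielsen i j)⁻¹ =
      rightMul i (of j * ⁅of c, of b⁆ * (of j)⁻¹) * rightMul j ⁅of b, of c⁆ := by
    rw [rightMul, nielsen_mul_transv_right hij (one_mem _) (commutator_mem_away hb hc)
      (one_mem _) (commutator_mem_away hb' hc'), mul_inv_cancel_right, inv_one, mul_one,
      commutatorElement_inv]
  rw [e', hψ _ hmem _ (rightMul_commutator_mem hb' hc'), e, char_commutator_symm hψ hb hc]
  ring

theorem char_conj_commutator_swap {c : α} (hci : c ≠ i) (hcj : c ≠ j) :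
    ψ (nielsen i j * rightMul j ⁅of i, of c⁆ * (nielsen i j)⁻¹) =
      ψ (rightMul j ⁅of i, of c⁆) +
        (ψ (partialConj j (of c)) - ψ (rightMul i ⁅of j, of c⁆) - ψ (partialConj i (of c))) := by
  have hj := of_mem_away hij
  have hi := of_mem_away hij.symm
  have hc := of_mem_away hci
  have hc' := of_mem_away hcj
  have m1 := partialConj_mem hj
  have m2 := partialConj_mem hi
  have m3 := partialConj_mem hc
  have m4 := partialConj_mem hc'
  have m5 := rightMul_commutator_mem hj hc
  have m6 := rightMul_commutator_mem (inv_mem hi) hc'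
  rw [nielsen_mul_rightMul_commutator hij hci hcj, mul_inv_cancel_right,
    hψ _ (mul_mem (mul_mem (mul_mem m1 m2) m4) (inv_mem m5)) _
      (inv_mem (mul_mem (mul_mem (mul_mem m1 m3) m2) m6)),
    hψ.map_inv (mul_mem (mul_mem (mul_mem m1 m3) m2) m6),
    hψ _ (mul_mem (mul_mem m1 m2) m4) _ (inv_mem m5), hψ.map_inv m5,
    hψ _ (mul_mem m1 m2) _ m4, hψ _ m1 _ m2, hψ _ (mul_mem (mul_mem m1 m3) m2) _ m6,
    hψ _ (mul_mem m1 m3) _ m2, hψ _ m1 _ m3, char_commutator_inv hψ hi hc']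
  ring

-- The first difference of a Magnus generator is a combination of simpler generators on which the
-- action is visible. A nonzero second difference occurs only for `rightMul j` of a commutator
-- containing `i`, and it is fixed by the action; hence class three.
omit hψ in
theorem unipotentOn_nielsen [Fintype α] : UnipotentOn (magnusSubgroup α) (nielsen i j) := by
  have hj := of_mem_away hij
  have hi := of_mem_away hij.symm
  have hN : (Subgroup.closure (magnusGens α)).Normal := magnusSubgroup_normal
  refine UnipotentOn.of_closure fun y hy ψ hψ => ?_
  change AdditiveOn (magnusSubgroup α) ψ at hψ
  rcases hy with ⟨a, b, hba, rfl⟩ | ⟨a, b, c, hba, hca, hbc, rfl⟩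
  · by_cases hai : a = i
    · subst hai
      exact UnipotentOn.of_differences (H := magnusSubgroup α)
        (fun ψ => -ψ (rightMul a ⁅of b, of j⁆)) (fun _ => 0)
        (fun ψ hψ => by rw [char_conj_partialConj_self hψ hij hba, sub_eq_add_neg])
        (fun ψ hψ => by
          beta_reduce
          rw [char_conj_commutator_self hψ hij (of_mem_away hba) hj, add_zero])
        (fun _ _ => rfl) hψ
    by_cases haj : a = j
    · subst haj
      by_cases hbi : b = i
      · subst hbi
        exact UnipotentOn.of_differences (H := magnusSubgroup α)
          (fun ψ => ψ (partialConj b (of a))) (fun _ => 0)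
          (fun ψ hψ => char_conj_partialConj_swap hψ hij)
          (fun ψ hψ => by
            beta_reduce
            rw [char_conj_partialConj_self hψ hij hij, char_commutator_self hψ, sub_zero, add_zero])
          (fun _ _ => rfl) hψ
      · exact UnipotentOn.of_differences (H := magnusSubgroup α)
          (fun ψ => -ψ (rightMul i ⁅of a, of b⁆)) (fun _ => 0)
          (fun ψ hψ => by rw [char_conj_partialConj_right hψ hij hbi hba, sub_eq_add_neg])
          (fun ψ hψ => by
            beta_reduce
            rw [char_conj_commutator_self hψ hij hj (of_mem_away hbi), add_zero])
          (fun _ _ => rfl) hψ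
    by_cases hbi : b = i
    · subst hbi
      exact UnipotentOn.of_differences (H := magnusSubgroup α)
        (fun ψ => ψ (partialConj a (of j))) (fun _ => 0)
        (fun ψ hψ => char_conj_partialConj_left hψ hij hai haj)
        (fun ψ hψ => by
          beta_reduce
          rw [char_conj_partialConj_of_ne hψ hij hai haj (Ne.symm haj) hij, add_zero])
        (fun _ _ => rfl) hψ
    · exact UnipotentOn.of_differences (H := magnusSubgroup α) (fun _ => 0) (fun _ => 0)
        (fun ψ hψ => by rw [char_conj_partialConj_of_ne hψ hij hai haj hba hbi, add_zero])
        (fun ψ hψ => (add_zero _).symm) (fun _ _ => rfl) hψ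
  · have hb := of_mem_away hba
    have hc := of_mem_away hca
    by_cases hai : a = i
    · subst hai
      exact UnipotentOn.of_differences (H := magnusSubgroup α) (fun _ => 0) (fun _ => 0)
        (fun ψ hψ => by rw [char_conj_commutator_self hψ hij hb hc, add_zero])
        (fun ψ hψ => (add_zero _).symm) (fun _ _ => rfl) hψ
    by_cases haj : a = j
    · subst haj
      have main : ∀ c, c ≠ i → c ≠ a → ∀ ψ, AdditiveOn (magnusSubgroup α) ψ →
          (ψ (nielsen i a * partialConj a (of c) * (nielsen i a)⁻¹) -
            ψ (nielsen i a * rightMul i ⁅of a, of c⁆ * (nielsen i a)⁻¹) -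
            ψ (nielsen i a * partialConj i (of c) * (nielsen i a)⁻¹)) =
          (ψ (partialConj a (of c)) - ψ (rightMul i ⁅of a, of c⁆) - ψ (partialConj i (of c))) +
            -(2 * ψ (rightMul i ⁅of a, of c⁆)) := by
        intro c hci hca ψ hψ
        rw [char_conj_partialConj_right hψ hij hci hca,
          char_conj_commutator_self hψ hij hj (of_mem_away hci),
          char_conj_partialConj_self hψ hij hci, char_commutator_symm hψ hj (of_mem_away hci)]
        ring
      by_cases hbi : b = i
      · subst hbi
        exact UnipotentOn.of_differences (H := magnusSubgroup α)
          (fun ψ => ψ (partialConj a (of c)) - ψ (rightMul b ⁅of a, of c⁆) -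
            ψ (partialConj b (of c)))
          (fun ψ => -(2 * ψ (rightMul b ⁅of a, of c⁆)))
          (fun ψ hψ => char_conj_commutator_swap hψ hij hbc.symm hca)
          (main c hbc.symm hca)
          (fun ψ hψ => by beta_reduce; rw [char_conj_commutator_self hψ hij hj (of_mem_away hbc.symm)]) hψ
      by_cases hci : c = i
      · subst hci
        exact UnipotentOn.of_differences (H := magnusSubgroup α)
          (fun ψ => -(ψ (partialConj a (of b)) - ψ (rightMul c ⁅of a, of b⁆) -
            ψ (partialConj c (of b))))
          (fun ψ => 2 * ψ (rightMul c ⁅of a, of b⁆))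
          (fun ψ hψ => by
            have hψ' := hψ.conj (nielsen c a)
            have h1 := char_commutator_symm hψ' hi hb
            rw [h1, char_conj_commutator_swap hψ hij hbi hba, char_commutator_symm hψ hi hb]
            ring)
          (fun ψ hψ => by
            simp only
            rw [main b hbi hba ψ hψ]
            ring)
          (fun ψ hψ => by beta_reduce; rw [char_conj_commutator_self hψ hij hj (of_mem_away hbi)]) hψ
      · exact UnipotentOn.of_differences (H := magnusSubgroup α)
          (fun ψ => -ψ (rightMul i ⁅of b, of c⁆)) (fun _ => 0)
          (fun ψ hψ => by
            rw [char_conj_commutator_right hψ hij hbi hba hci hca, sub_eq_add_neg])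
          (fun ψ hψ => by
            beta_reduce
            rw [char_conj_commutator_self hψ hij (of_mem_away hbi) (of_mem_away hci), add_zero])
          (fun _ _ => rfl) hψ
    have hja := of_mem_away (Ne.symm haj)
    by_cases hbi : b = i
    · subst hbi
      exact UnipotentOn.of_differences (H := magnusSubgroup α)
        (fun ψ => ψ (rightMul a ⁅of j, of c⁆)) (fun _ => 0)
        (fun ψ hψ => by
          rw [char_conj_commutator hψ hij hai haj hb hc, nielsen_self hij,
            nielsen_of_ne _ hbc.symm, char_commutator_mul hψ hb hja hc])
        (fun ψ hψ => by
          beta_reduce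
          rw [char_conj_commutator hψ hij hai haj hja hc, nielsen_of_ne _ hij,
            nielsen_of_ne _ hbc.symm, add_zero])
        (fun _ _ => rfl) hψ
    by_cases hci : c = i
    · subst hci
      exact UnipotentOn.of_differences (H := magnusSubgroup α)
        (fun ψ => ψ (rightMul a ⁅of b, of j⁆)) (fun _ => 0)
        (fun ψ hψ => by
          rw [char_conj_commutator hψ hij hai haj hb hc, nielsen_self hij,
            nielsen_of_ne _ hbi, char_commutator_symm hψ (mul_mem hc hja) hb,
            char_commutator_mul hψ hc hja hb, char_commutator_symm hψ hc hb,
            char_commutator_symm hψ hja hb]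
          ring)
        (fun ψ hψ => by
          beta_reduce
          rw [char_conj_commutator hψ hij hai haj hb hja, nielsen_of_ne _ hij,
            nielsen_of_ne _ hbi, add_zero])
        (fun _ _ => rfl) hψ
    · exact UnipotentOn.of_differences (H := magnusSubgroup α) (fun _ => 0) (fun _ => 0)
        (fun ψ hψ => by
          rw [char_conj_commutator hψ hij hai haj hb hc, nielsen_of_ne _ hbi, nielsen_of_ne _ hci,
            add_zero])
        (fun ψ hψ => (add_zero _).symm) (fun _ _ => rfl) hψ

end Unipotent

end AutFree


/-! ### Connectivity of Kneser graphs -/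

open Relation in
/-- The Kneser graph is connected. -/
theorem kneser_connected {α : Type*} [DecidableEq α] [Fintype α] {m : ℕ}
    (hm : 2 * m + 1 ≤ Fintype.card α) {J J' : Finset α} (hJ : J.card = m) (hJ' : J'.card = m) :
    ReflTransGen (fun I I' : Finset α => I.card = m ∧ I'.card = m ∧ Disjoint I I') J J' := by
  induction hd : (J \ J').card using Nat.strong_induction_on generalizing J with
  | _ d ih =>
    rcases (J \ J').eq_empty_or_nonempty with h | ⟨a, ha⟩
    · rw [Finset.sdiff_eq_empty_iff_subset] at h
      rw [Finset.eq_of_subset_of_card_le h (by omega)]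
    · have h1 : (J' \ J).Nonempty := by
        rw [← Finset.card_pos]
        have e1 := Finset.card_sdiff_add_card_inter J J'
        have e2 := Finset.card_sdiff_add_card_inter J' J
        rw [Finset.inter_comm] at e2
        have := Finset.card_pos.2 ⟨a, ha⟩
        omega
      obtain ⟨b, hb⟩ := h1
      rw [Finset.mem_sdiff] at ha hb
      have hab : b ∉ J.erase a := fun h => hb.2 (Finset.mem_of_mem_erase h)
      have hJ1 : (insert b (J.erase a)).card = m := by
        rw [Finset.card_insert_of_notMem hab, Finset.card_erase_add_one ha.1, hJ]
      -- The bound `2 * m + 1` leaves `m` points outside `J ∪ {b}`; such a set is disjoint from both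
      -- `J` and the result of exchanging `a` for `b`.
      obtain ⟨K, hK, hKm⟩ := Finset.exists_subset_card_eq (s := (insert b J)ᶜ) (n := m) (by
        rw [Finset.card_compl, Finset.card_insert_of_notMem hb.2]; omega)
      have hKd : Disjoint K (insert b J) :=
        Finset.disjoint_of_subset_left hK disjoint_compl_left
      have hswap : ReflTransGen (fun I I' : Finset α => I.card = m ∧ I'.card = m ∧ Disjoint I I')
          J (insert b (J.erase a)) :=
        (ReflTransGen.single ⟨hJ, hKm, (Finset.disjoint_of_subset_right
          (Finset.subset_insert b J) hKd).symm⟩).tail ⟨hKm, hJ1, Finset.disjoint_of_subset_right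
            (Finset.insert_subset_insert b (Finset.erase_subset a J)) hKd⟩
      refine hswap.trans (ih _ ?_ hJ1 rfl)
      rw [← hd]
      refine Finset.card_lt_card ⟨fun x hx => ?_, fun h => ?_⟩
      · rw [Finset.mem_sdiff, Finset.mem_insert, Finset.mem_erase] at hx
        rcases hx with ⟨rfl | hx, hx'⟩
        · exact absurd hb.1 hx'
        · exact Finset.mem_sdiff.2 ⟨hx.2, hx'⟩
      · have := h (Finset.mem_sdiff.2 ha)
        rw [Finset.mem_sdiff, Finset.mem_insert, Finset.mem_erase] at this
        rcases this with ⟨rfl | hx, hx'⟩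
        · exact hb.2 ha.1
        · exact hx.1 rfl

namespace AutFree

/-! ### Localized automorphisms and commuting families -/

section Localized

variable {α : Type*} [DecidableEq α]

open FreeGroup (of)
open scoped commutatorElement

/-- The subgroup generated by the letters in `I`. -/
def letters (I : Finset α) : Subgroup (FreeGroup α) := Subgroup.closure (of '' (I : Set α))

/-- The automorphisms which only involve the letters in `I`. -/
def localized (I : Finset α) : Subgroup (MulAut (FreeGroup α)) :=
  Subgroup.closure {φ | (∀ a ∉ I, φ (of a) = of a) ∧ ∀ a ∈ I, φ (of a) ∈ letters I}

theorem of_mem_letters {I : Finset α} {a : α} (h : a ∈ I) : of a ∈ letters I :=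
  Subgroup.subset_closure ⟨a, h, rfl⟩

theorem letters_mono {I J : Finset α} (h : I ⊆ J) : letters I ≤ letters J :=
  Subgroup.closure_mono (Set.image_mono (by exact_mod_cast h))

theorem localized_mono {I J : Finset α} (h : I ⊆ J) : localized I ≤ localized J := by
  rw [localized, Subgroup.closure_le]
  rintro φ ⟨h1, h2⟩
  refine Subgroup.subset_closure ⟨fun a ha => h1 a fun ha' => ha (h ha'), fun a ha => ?_⟩
  by_cases haI : a ∈ I
  · exact letters_mono h (h2 a haI)
  · rw [h1 a haI]; exact of_mem_letters ha

theorem map_letters {φ : MulAut (FreeGroup α)} {I : Finset α} (h : ∀ a ∈ I, φ (of a) = of a)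
    {w : FreeGroup α} (hw : w ∈ letters I) : φ w = w := by
  induction hw using Subgroup.closure_induction with
  | mem x hx => obtain ⟨a, ha, rfl⟩ := hx; exact h a ha
  | one => rw [map_one]
  | mul x y _ _ hx hy => rw [map_mul, hx, hy]
  | inv x _ hx => rw [map_inv, hx]

theorem localized_commute {I J : Finset α} (h : Disjoint I J) {φ ψ : MulAut (FreeGroup α)}
    (hφ : φ ∈ localized I) (hψ : ψ ∈ localized J) : Commute φ ψ := by
  rw [Finset.disjoint_left] at h
  induction hφ using Subgroup.closure_induction with
  | mem φ hφ =>
    obtain ⟨h1, h2⟩ := hφ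
    induction hψ using Subgroup.closure_induction with
    | mem ψ hψ =>
      obtain ⟨h3, h4⟩ := hψ
      apply mulAut_ext
      intro a
      rw [MulAut.mul_apply, MulAut.mul_apply]
      by_cases ha : a ∈ I
      · rw [h3 a (h ha), map_letters (fun b hb => h3 b (h hb)) (h2 a ha)]
      · rw [h1 a ha]
        by_cases ha' : a ∈ J
        · rw [map_letters (fun b hb => h1 b fun hbI => h hbI hb) (h4 a ha')]
        · rw [h3 a ha', h1 a ha]
    | one => exact Commute.one_right _
    | mul x y _ _ hx hy => exact hx.mul_right hy
    | inv x _ hx => exact hx.inv_right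
  | one => exact Commute.one_left _
  | mul x y _ _ hx hy => exact hx.mul_left hy
  | inv x _ hx => exact hx.inv_left

theorem permAut_conj_localized (σ : Equiv.Perm α) {I J : Finset α} (h : ∀ a ∈ I, σ a ∈ J)
    {φ : MulAut (FreeGroup α)} (hφ : φ ∈ localized I) :
    permAut σ * φ * (permAut σ)⁻¹ ∈ localized J := by
  suffices localized I ≤ (localized J).comap (MulAut.conj (permAut σ)).toMonoidHom from this hφ
  rw [localized, Subgroup.closure_le]
  rintro φ ⟨h1, h2⟩
  have hinv : ∀ a, (permAut σ)⁻¹ (of a) = of (σ.symm a) := fun a => by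
    rw [← map_inv, permAut_of]; rfl
  have hw : ∀ w ∈ letters I, permAut σ w ∈ letters J := by
    intro w hw
    induction hw using Subgroup.closure_induction with
    | mem x hx =>
      obtain ⟨a, ha, rfl⟩ := hx
      rw [permAut_of]
      exact of_mem_letters (h a ha)
    | one => rw [map_one]; exact one_mem _
    | mul x y _ _ hx hy => rw [map_mul]; exact mul_mem hx hy
    | inv x _ hx => rw [map_inv]; exact inv_mem hx
  have hval : ∀ a, (permAut σ * φ * (permAut σ)⁻¹) (of a) = permAut σ (φ (of (σ.symm a))) := by
    intro a
    rw [MulAut.mul_apply, MulAut.mul_apply, hinv]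
  refine Subgroup.subset_closure ⟨fun a ha => ?_, fun a ha => ?_⟩
  · have : σ.symm a ∉ I := fun hs => ha (by simpa using h _ hs)
    refine (hval a).trans ?_
    rw [h1 _ this, permAut_of, Equiv.apply_symm_apply]
  · have e : (MulAut.conj (permAut σ)).toMonoidHom φ (of a) = permAut σ (φ (of (σ.symm a))) :=
      hval a
    rw [e]
    by_cases hs : σ.symm a ∈ I
    · exact hw _ (h2 _ hs)
    · rw [h1 _ hs, permAut_of, Equiv.apply_symm_apply]
      exact of_mem_letters ha

theorem inversion_conj_localized (i : α) {I : Finset α} {φ : MulAut (FreeGroup α)}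
    (hφ : φ ∈ localized I) : inversion i * φ * (inversion i)⁻¹ ∈ localized I := by
  suffices localized I ≤ (localized I).comap (MulAut.conj (inversion i)).toMonoidHom from this hφ
  rw [localized, Subgroup.closure_le]
  rintro φ ⟨h1, h2⟩
  have hw : ∀ w ∈ letters I, inversion i w ∈ letters I := by
    intro w hw
    induction hw using Subgroup.closure_induction with
    | mem x hx =>
      obtain ⟨a, ha, rfl⟩ := hx
      by_cases hai : a = i
      · subst hai; rw [inversion_self]; exact inv_mem (of_mem_letters ha)
      · rw [inversion_of_ne hai]; exact of_mem_letters ha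
    | one => rw [map_one]; exact one_mem _
    | mul x y _ _ hx hy => rw [map_mul]; exact mul_mem hx hy
    | inv x _ hx => rw [map_inv]; exact inv_mem hx
  have hval : ∀ a, (MulAut.conj (inversion i)).toMonoidHom φ (of a) =
      inversion i (φ (inversion i (of a))) := by
    intro a
    change (inversion i * φ * (inversion i)⁻¹) (of a) = _
    rw [inversion_inv, MulAut.mul_apply, MulAut.mul_apply]
  have hinv : ∀ a, inversion i (inversion i (of a)) = of a := fun a => by
    rw [← MulAut.mul_apply, inversion_mul_self, MulAut.one_apply]
  refine Subgroup.subset_closure ⟨fun a ha => ?_, fun a ha => ?_⟩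
  · rw [hval]
    by_cases hai : a = i
    · subst hai
      rw [inversion_self, map_inv, h1 a ha, map_inv, inversion_self, inv_inv]
    · rw [inversion_of_ne hai, h1 a ha, inversion_of_ne hai]
  · rw [hval]
    refine hw _ ?_
    by_cases hai : a = i
    · subst hai
      rw [inversion_self, map_inv]
      exact inv_mem (h2 a ha)
    · rw [inversion_of_ne hai]
      exact h2 a ha

theorem signs_conj_localized {ε : MulAut (FreeGroup α)}
    (hε : ε ∈ Subgroup.closure (Set.range (inversion (α := α)))) {I : Finset α}
    {φ : MulAut (FreeGroup α)} (hφ : φ ∈ localized I) : ε * φ * ε⁻¹ ∈ localized I := by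
  induction hε using Subgroup.closure_induction_left with
  | one => simpa using hφ
  | mul_left x hx y _ ih =>
    obtain ⟨i, rfl⟩ := hx
    have := inversion_conj_localized i ih
    convert this using 1
    group
  | inv_mul_cancel x hx y _ ih =>
    obtain ⟨i, rfl⟩ := hx
    have := inversion_conj_localized i ih
    rw [inversion_inv]
    convert this using 1
    group

theorem transv_mem_localized {I : Finset α} {a : α} (ha : a ∈ I) {u v : FreeGroup α}
    (hu : u ∈ away a) (hv : v ∈ away a) (hu' : u ∈ letters I) (hv' : v ∈ letters I) :
    transv a u v ∈ localized I := by
  refine Subgroup.subset_closure ⟨fun b hb => transv_of_ne (by rintro rfl; exact hb ha) _ _,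
    fun b hb => ?_⟩
  by_cases hba : b = a
  · subst hba
    rw [transv_self hu hv]
    exact mul_mem (mul_mem hu' (of_mem_letters ha)) hv'
  · rw [transv_of_ne hba]
    exact of_mem_letters hb

theorem exists_localized_of_mem_magnusGens {φ : MulAut (FreeGroup α)} (h : φ ∈ magnusGens α) :
    ∃ I : Finset α, I.card ≤ 3 ∧ φ ∈ localized I := by
  rcases h with ⟨a, b, hba, rfl⟩ | ⟨a, b, c, hba, hca, -, rfl⟩
  · refine ⟨{a, b}, Finset.card_le_two.trans (by norm_num), ?_⟩
    have hb := of_mem_away hba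
    have hb' : of b ∈ letters {a, b} := of_mem_letters (by simp)
    exact transv_mem_localized (by simp) (inv_mem hb) hb (inv_mem hb') hb'
  · refine ⟨{a, b, c}, Finset.card_le_three, ?_⟩
    have hb' : of b ∈ letters {a, b, c} := of_mem_letters (by simp)
    have hc' : of c ∈ letters {a, b, c} := of_mem_letters (by simp)
    refine transv_mem_localized (by simp) (one_mem _)
      (commutator_mem_away (of_mem_away hba) (of_mem_away hca)) (one_mem _) ?_
    exact mul_mem (mul_mem (mul_mem hb' hc') (inv_mem hb')) (inv_mem hc')

/-- The Nielsen transvections. -/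
def transvections (α : Type*) [DecidableEq α] : Set (MulAut (FreeGroup α)) :=
  {φ | ∃ i j, i ≠ j ∧ φ = nielsen i j}

variable [Fintype α]

/-- Modulo sign changes, every automorphism is a product of transvections and elements of the
Torelli subgroup. -/
theorem exists_mul_signs (g : MulAut (FreeGroup α)) :
    ∃ p ∈ Subgroup.closure (transvections α ∪ (magnusSubgroup α : Set _)),
      ∃ ε ∈ Subgroup.closure (Set.range (inversion (α := α))), g = p * ε := by
  set P := Subgroup.closure (transvections α ∪ (magnusSubgroup α : Set _)) with hP
  have hT : ∀ {i j : α}, i ≠ j → nielsen i j ∈ P := fun {i j} h =>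
    Subgroup.subset_closure (Or.inl ⟨i, j, h, rfl⟩)
  have hH : ∀ {x}, x ∈ magnusSubgroup α → x ∈ P := fun h => Subgroup.subset_closure (Or.inr h)
  have hconj : ∀ k, ∀ p ∈ P, inversion k * p * inversion k ∈ P := by
    intro k p hp
    suffices P ≤ P.comap (MulAut.conj (inversion k)).toMonoidHom by
      have h1 : inversion k * p * (inversion k)⁻¹ ∈ P := this hp
      rwa [inversion_inv] at h1
    conv_lhs => rw [hP]
    rw [Subgroup.closure_le]
    rintro _ (⟨i, j, hij, rfl⟩ | h)
    · change inversion k * nielsen i j * (inversion k)⁻¹ ∈ P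
      rw [inversion_inv]
      by_cases hki : k = i
      · subst hki
        have hj := of_mem_away hij.symm
        have h1 := inversion_mul_rightMul hj
        rw [rightMul_inv hj] at h1
        change inversion k * rightMul k (of j) * inversion k ∈ P
        rw [h1]
        exact mul_mem (hH (partialConj_mem hj)) (inv_mem (hT hij))
      · by_cases hkj : k = j
        · subst hkj
          rw [inversion_conj_nielsen hij.symm]
          exact inv_mem (hT hij)
        · rw [inversion_comm_nielsen hij hki hkj, mul_assoc, inversion_mul_self, mul_one]
          exact hT hij
    · have hN : (magnusSubgroup α).Normal := magnusSubgroup_normal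
      exact hH (hN.conj_mem _ h _)
  have hg : g ∈ nielsenSubgroup α := by
    rw [nielsenSubgroup_eq_top]
    exact Subgroup.mem_top g
  have hsign : ∀ k y, (∃ p ∈ P, ∃ ε ∈ Subgroup.closure (Set.range (inversion (α := α))),
      y = p * ε) → ∃ p ∈ P, ∃ ε ∈ Subgroup.closure (Set.range (inversion (α := α))),
      inversion k * y = p * ε := by
    rintro k _ ⟨p, hp, ε, hε, rfl⟩
    refine ⟨_, hconj k p hp, inversion k * ε,
      mul_mem (Subgroup.subset_closure ⟨k, rfl⟩) hε, ?_⟩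
    rw [mul_assoc _ (inversion k), ← mul_assoc (inversion k) (inversion k), inversion_mul_self,
      one_mul, mul_assoc]
  induction hg using Subgroup.closure_induction_left with
  | one => exact ⟨1, one_mem _, 1, one_mem _, (mul_one 1).symm⟩
  | mul_left x hx y _ ih =>
    rcases hx with ⟨i, j, hij, rfl⟩ | ⟨k, rfl⟩
    · obtain ⟨p, hp, ε, hε, rfl⟩ := ih
      exact ⟨_, mul_mem (hT hij) hp, ε, hε, (mul_assoc _ _ _).symm⟩
    · exact hsign k y ih
  | inv_mul_cancel x hx y _ ih =>
    rcases hx with ⟨i, j, hij, rfl⟩ | ⟨k, rfl⟩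
    · obtain ⟨p, hp, ε, hε, rfl⟩ := ih
      exact ⟨_, mul_mem (inv_mem (hT hij)) hp, ε, hε, (mul_assoc _ _ _).symm⟩
    · rw [inversion_inv]
      exact hsign k y ih

theorem exists_perm_map {I J : Finset α} (h : I.card = J.card) :
    ∃ σ : Equiv.Perm α, ∀ a ∈ I, σ a ∈ J :=
  ⟨(Finset.equivOfCardEq h).extendSubtype, fun a ha =>
    (Finset.equivOfCardEq h).extendSubtype_mem a ha⟩

open Relation in
/-- Every nonzero character of a term of the lower central series of the Torelli subgroup is
nonzero on a large family of commuting elements. -/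
theorem exists_commuting_family (j : ℕ) (hn : 6 * j + 7 ≤ Fintype.card α)
    {χ : MulAut (FreeGroup α) → ℝ} (hχ : IsLcsChar (magnusSubgroup α) j χ)
    (h0 : ∃ x ∈ (magnusSubgroup α).lowerCentralSeries j, χ x ≠ 0) :
    ∃ X : Set (MulAut (FreeGroup α)), Subgroup.closure X = magnusSubgroup α ∧
      ∃ Z : Set (MulAut (FreeGroup α)), Z.Finite ∧ Z.Nonempty ∧
        Z ⊆ (magnusSubgroup α).lowerCentralSeries j ∧ (∀ z ∈ Z, χ z ≠ 0) ∧
        (∀ z ∈ Z, ∀ z' ∈ Z, ReflTransGen (fun a b => a ∈ Z ∧ b ∈ Z ∧ Commute a b) z z') ∧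
        ∀ x ∈ X, ∃ z ∈ Z, Commute x z := by
  set H := magnusSubgroup α with hHdef
  -- A left normed commutator of `j + 1` Magnus generators involves at most three letters per
  -- generator. The hypothesis on the rank is exactly `2 * m + 1 ≤ Fintype.card α`.
  set m := 3 * (j + 1) with hm
  have hHn : H.Normal := magnusSubgroup_normal
  have hLn : ∀ j, (H.lowerCentralSeries j).Normal := fun j => H.lowerCentralSeries_normal j
  obtain ⟨z, ⟨I, hI, hzI⟩, hzL, hz0⟩ := hχ.exists_ne_zero (S := magnusGens α) rfl
    (fun j => {x | ∃ I : Finset α, I.card ≤ 3 * (j + 1) ∧ x ∈ localized I})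
    (fun x hx => by
      obtain ⟨I, hI, hx⟩ := exists_localized_of_mem_magnusGens hx
      exact ⟨I, by omega, hx⟩)
    (by
      rintro j x ⟨I, hI, hx⟩ y hy
      obtain ⟨I', hI', hy⟩ := exists_localized_of_mem_magnusGens hy
      refine ⟨I ∪ I', (Finset.card_union_le _ _).trans (by omega), ?_⟩
      have hx' := localized_mono (Finset.subset_union_left (s₂ := I')) hx
      have hy' := localized_mono (Finset.subset_union_right (s₁ := I)) hy
      exact mul_mem (mul_mem (mul_mem hx' hy') (inv_mem hx')) (inv_mem hy'))
    j χ h0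
  obtain ⟨I', hII', -, hI'⟩ := Finset.exists_subsuperset_card_eq (Finset.subset_univ I)
    (n := m) hI (by rw [Finset.card_univ]; omega)
  have hz' := localized_mono hII' hzI
  have hex : ∀ J : Finset α, J.card = m → ∃ y ∈ H.lowerCentralSeries j, y ∈ localized J ∧
      ∃ a ∈ Subgroup.closure (transvections α ∪ (H : Set _)), χ (a * y * a⁻¹) ≠ 0 := by
    intro J hJ
    obtain ⟨σ, hσ⟩ := exists_perm_map (hI'.trans hJ.symm)
    -- Sign changes are not reached by transvections and the Torelli group, but they preserve the
    -- set of letters involved, so they are absorbed into the element localized at `J`. Conjugating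
    -- that element by `p` gives back `z`.
    obtain ⟨p, hp, ε, hε, e⟩ := exists_mul_signs (permAut σ)⁻¹
    refine ⟨ε * (permAut σ * z * (permAut σ)⁻¹) * ε⁻¹,
      (hLn j).conj_mem _ ((hLn j).conj_mem z hzL _) _,
      signs_conj_localized hε (permAut_conj_localized σ hσ hz'), p, hp, ?_⟩
    have e2 : p * (ε * (permAut σ * z * (permAut σ)⁻¹) * ε⁻¹) * p⁻¹ =
        (p * ε) * permAut σ * z * ((p * ε) * permAut σ)⁻¹ := by group
    rw [e2, ← e, inv_mul_cancel, one_mul, inv_one, mul_one]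
    exact hz0
  choose! y hyL hyJ hy using hex
  -- One conjugator `g` serves all sets `J` at once; using the same `g` throughout preserves the
  -- commutation relations.
  obtain ⟨g, -, hg⟩ := PolynomialAlong.exists_ne_zero (U := transvections α) (H := H)
    (Finset.powersetCard m Finset.univ) (fun J g => χ (g * y J * g⁻¹))
    (fun J hJ => by
      refine hχ.polynomialAlong ?_ (hyL J (Finset.mem_powersetCard.1 hJ).2)
      rintro _ ⟨i, k, hik, rfl⟩
      exact unipotentOn_nielsen hik.symm)
    (fun J hJ => hy J (Finset.mem_powersetCard.1 hJ).2)
  have hmem : ∀ J : Finset α, J.card = m → J ∈ Finset.powersetCard m (Finset.univ : Finset α) :=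
    fun J hJ => Finset.mem_powersetCard.2 ⟨Finset.subset_univ J, hJ⟩
  have hcomm : ∀ a b : MulAut (FreeGroup α), Commute a b →
      Commute (g * a * g⁻¹) (g * b * g⁻¹) := by
    intro a b h
    have e : ∀ a b, g * a * g⁻¹ * (g * b * g⁻¹) = g * (a * b) * g⁻¹ := fun a b => by group
    change _ * _ = _ * _
    rw [e, e, h.eq]
  refine ⟨MulAut.conj g '' magnusGens α, ?_, (fun J => g * y J * g⁻¹) '' {J | J.card = m},
    ?_, ?_, ?_, ?_, ?_, ?_⟩
  · have := MonoidHom.map_closure (MulAut.conj g).toMonoidHom (magnusGens α)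
    exact this.symm.trans (Subgroup.normal_iff_map_conj_eq.1 hHn g)
  · exact (Set.toFinite _).image _
  · exact ⟨_, I', hI', rfl⟩
  · rintro _ ⟨J, hJ, rfl⟩
    exact (hLn j).conj_mem _ (hyL J hJ) g
  · rintro _ ⟨J, hJ, rfl⟩
    exact hg J (hmem J hJ)
  · rintro _ ⟨J, hJ, rfl⟩ _ ⟨J', hJ', rfl⟩
    refine ReflTransGen.lift (fun J => g * y J * g⁻¹) ?_ _ _
      (kneser_connected (m := m) (by omega) hJ hJ')
    rintro A B ⟨hA, hB, hAB⟩
    exact ⟨⟨A, hA, rfl⟩, ⟨B, hB, rfl⟩, hcomm _ _ (localized_commute hAB (hyJ A hA) (hyJ B hB))⟩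
  · rintro _ ⟨x, hx, rfl⟩
    obtain ⟨K, hK, hxK⟩ := exists_localized_of_mem_magnusGens hx
    -- A Magnus generator occupies at most three letters, which leaves room for a disjoint set of
    -- size `m`.
    obtain ⟨J, hJK, hJ⟩ := Finset.exists_subset_card_eq (s := Kᶜ) (n := m) (by
      rw [Finset.card_compl]; omega)
    refine ⟨_, ⟨J, hJ, rfl⟩, ?_⟩
    have hd : Disjoint K J := (Finset.disjoint_of_subset_left hJK disjoint_compl_left).symm
    exact hcomm _ _ (localized_commute hd hxK (hyJ J hJ))

end Localized

end AutFree


/-! ### Subgroups containing a term of the lower central series -/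

theorem Subgroup.FG.map_hom {G G' : Type*} [Group G] [Group G'] {P : Subgroup G} (h : P.FG)
    (f : G →* G') : (P.map f).FG := by
  rw [Subgroup.fg_iff_submonoid_fg] at h ⊢
  exact h.map f

theorem Subgroup.fg_of_commGroup {Q : Type*} [CommGroup Q] [hQ : Group.FG Q] (P : Subgroup Q) :
    P.FG := by
  have h1 : AddGroup.FG (Additive Q) := GroupFG.iff_add_fg.1 hQ
  have : Module.Finite ℤ (Additive Q) := Module.Finite.iff_addGroup_fg.2 h1
  rw [Subgroup.fg_iff_add_fg, ← AddSubgroup.toIntSubmodule_toAddSubgroup (Subgroup.toAddSubgroup P),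
    ← Submodule.fg_iff_addSubgroup_fg]
  exact IsNoetherian.noetherian _

/-- A subgroup is finitely generated if its image and its intersection with the kernel are. -/
theorem Subgroup.fg_of_map_of_inf_ker {G Q : Type*} [Group G] [Group Q] (f : G →* Q)
    {P : Subgroup G} (h1 : (P.map f).FG) (h2 : (P ⊓ f.ker).FG) : P.FG := by
  classical
  obtain ⟨T, hT, hTf⟩ := (Subgroup.fg_iff _).1 h1
  have hlift : ∀ t ∈ T, ∃ x ∈ P, f x = t := fun t ht =>
    Subgroup.mem_map.1 (hT ▸ Subgroup.subset_closure ht)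
  choose! s hsP hs using hlift
  have hle : Subgroup.closure (s '' T) ≤ P := by
    rw [Subgroup.closure_le]
    rintro _ ⟨t, ht, rfl⟩
    exact hsP t ht
  have e : P = Subgroup.closure (s '' T) ⊔ (P ⊓ f.ker) := by
    refine le_antisymm (fun x hx => ?_) (sup_le hle inf_le_left)
    have hfx : f x ∈ (Subgroup.closure (s '' T)).map f := by
      have hcongr : f ∘ s '' T = T := (Set.image_congr (g := id) hs).trans (Set.image_id T)
      rw [MonoidHom.map_closure, ← Set.image_comp, hcongr, hT]
      exact ⟨x, hx, rfl⟩
    obtain ⟨y, hy, hyx⟩ := hfx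
    have h3 : y⁻¹ * x ∈ P ⊓ f.ker := by
      refine Subgroup.mem_inf.2 ⟨mul_mem (inv_mem (hle hy)) hx, ?_⟩
      rw [MonoidHom.mem_ker, map_mul, map_inv, hyx, inv_mul_cancel]
    have := mul_mem ((le_sup_left : _ ≤ Subgroup.closure (s '' T) ⊔ (P ⊓ f.ker)) hy)
      ((le_sup_right : _ ≤ Subgroup.closure (s '' T) ⊔ (P ⊓ f.ker)) h3)
    rwa [mul_inv_cancel_left] at this
  rw [e]
  exact Subgroup.FG.sup ((Subgroup.fg_iff _).2 ⟨_, rfl, hTf.image s⟩) h2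

open scoped commutatorElement in
/-- Let `N` be a finitely generated group and `M` a subgroup with `⁅N, N⁆ ≤ M`. Then a subgroup of
`N` is finitely generated if its intersection with `M` is. -/
theorem Subgroup.fg_of_inf_fg {N : Type*} [Group N] [Group.FG N] (M : Subgroup N)
    (hM : ⁅(⊤ : Subgroup N), (⊤ : Subgroup N)⁆ ≤ M) (P : Subgroup N) (h : (P ⊓ M).FG) : P.FG := by
  have hMn : M.Normal := by
    refine ⟨fun x hx g => ?_⟩
    have h1 : ⁅g, x⁆ ∈ M := hM (Subgroup.commutator_mem_commutator (Subgroup.mem_top g)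
      (Subgroup.mem_top x))
    have := mul_mem h1 hx
    rwa [commutatorElement_def, inv_mul_cancel_right] at this
  let _ : CommGroup (N ⧸ M) :=
    { (inferInstance : Group (N ⧸ M)) with
      mul_comm := by
        rintro ⟨x⟩ ⟨y⟩
        change QuotientGroup.mk' M x * QuotientGroup.mk' M y = QuotientGroup.mk' M y *
          QuotientGroup.mk' M x
        rw [← map_mul, ← map_mul]
        refine QuotientGroup.eq.2 ?_
        have h1 : ⁅y⁻¹, x⁻¹⁆ ∈ M := hM (Subgroup.commutator_mem_commutator (Subgroup.mem_top _)
          (Subgroup.mem_top _))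
        have e : (x * y)⁻¹ * (y * x) = ⁅y⁻¹, x⁻¹⁆ := by
          rw [commutatorElement_def]; group
        rwa [e] }
  have hQ : Group.FG (N ⧸ M) := QuotientGroup.fg M
  refine Subgroup.fg_of_map_of_inf_ker (QuotientGroup.mk' M) (Subgroup.fg_of_commGroup _) ?_
  rwa [QuotientGroup.ker_mk']

/-- If the terms of the lower central series are finitely generated up to the `r`-th one, then so
is every subgroup containing the latter. -/
theorem Subgroup.fg_of_lowerCentralSeries_le {G : Type*} [Group G] {r : ℕ}
    (h : ∀ i ≤ r, ((⊤ : Subgroup G).lowerCentralSeries i).FG) {K : Subgroup G}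
    (hK : (⊤ : Subgroup G).lowerCentralSeries r ≤ K) : K.FG := by
  suffices ∀ d ≤ r, (K ⊓ (⊤ : Subgroup G).lowerCentralSeries (r - d)).FG by
    have h1 := this r le_rfl
    rwa [Nat.sub_self, Subgroup.lowerCentralSeries_zero, inf_top_eq] at h1
  -- Ascending the series from its `r`-th term: each step adds the image of `K` in an abelian
  -- quotient of two consecutive terms, which is finitely generated.
  intro d hd
  induction d with
  | zero =>
    rw [Nat.sub_zero, inf_eq_right.2 hK]
    exact h r le_rfl
  | succ d ih =>
    have ih' := ih (by omega)
    set i := r - (d + 1) with hi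
    have hi1 : r - d = i + 1 := by omega
    rw [hi1] at ih'
    set N := (⊤ : Subgroup G).lowerCentralSeries i with hN
    set L := (⊤ : Subgroup G).lowerCentralSeries (i + 1) with hL
    have hLN : L ≤ N := (⊤ : Subgroup G).lowerCentralSeries_antitone i.le_succ
    have : Group.FG N := (Group.fg_iff_subgroup_fg N).2 (h i (by omega))
    have hfg : (K.subgroupOf N).FG := by
      refine Subgroup.fg_of_inf_fg (L.subgroupOf N) ?_ _ ?_
      · rw [Subgroup.commutator_le]
        intro x _ y _
        exact Subgroup.commutator_mem_commutator x.2 (Subgroup.mem_top _)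
      · have e : K.subgroupOf N ⊓ L.subgroupOf N = (K ⊓ L).subgroupOf N := rfl
        rw [e]
        have hle : K ⊓ L ≤ N := inf_le_right.trans hLN
        have h1 : Group.FG (K ⊓ L : Subgroup G) := (Group.fg_iff_subgroup_fg _).2 ih'
        have h2 : Group.FG ((K ⊓ L).subgroupOf N) :=
          Group.fg_of_surjective (f := (Subgroup.subgroupOfEquivOfLe hle).symm.toMonoidHom)
            (Subgroup.subgroupOfEquivOfLe hle).symm.surjective
        exact (Group.fg_iff_subgroup_fg _).1 h2
    have := hfg.map_hom N.subtype
    rwa [Subgroup.subgroupOf_map_subtype] at this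

/-! ### Conclusion for the Torelli group -/

namespace AutFree

theorem magnusSubgroup_fg (α : Type*) [DecidableEq α] [Fintype α] : (magnusSubgroup α).FG :=
  (Subgroup.fg_iff _).2 ⟨magnusGens α, rfl, magnusGens_finite⟩

-- The rank bound for `j + 1` is `6 * j + 7`, just what the commuting family for characters of the
-- `j`-th term requires.
open Relation in
theorem lowerCentralSeries_fg (α : Type*) [DecidableEq α] [Fintype α] (j : ℕ)
    (hn : 6 * j + 1 ≤ Fintype.card α) :
    ((⊤ : Subgroup (magnusSubgroup α)).lowerCentralSeries j).FG := by
  induction j with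
  | zero =>
    rw [Subgroup.lowerCentralSeries_zero, ← Group.fg_def, Group.fg_iff_subgroup_fg]
    exact magnusSubgroup_fg α
  | succ j ih =>
    set H := magnusSubgroup α with hH
    set N := (⊤ : Subgroup H).lowerCentralSeries j with hN
    rw [Subgroup.lowerCentralSeries_succ]
    have hmap : ∀ j, ∀ x ∈ H.lowerCentralSeries j,
        ∃ y ∈ (⊤ : Subgroup H).lowerCentralSeries j, (y : MulAut (FreeGroup α)) = x := by
      intro j x hx
      rw [← Subgroup.top_subtype_lowerCentralSeries] at hx
      exact hx
    have hmap' : ∀ j, ∀ y ∈ (⊤ : Subgroup H).lowerCentralSeries j,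
        (y : MulAut (FreeGroup α)) ∈ H.lowerCentralSeries j := by
      intro j y hy
      rw [← Subgroup.top_subtype_lowerCentralSeries]
      exact ⟨y, hy, rfl⟩
    refine Pushing.fg_commutator N (ih (by omega)) fun χ hχ hχ0 ⟨x₀, hx₀⟩ => ?_
    let v : N → MulAut (FreeGroup α) := fun y => ((y : H) : MulAut (FreeGroup α))
    have hv : Function.Injective v := fun a b h => Subtype.ext (Subtype.ext h)
    -- The commuting family is built by conjugation in the whole automorphism group, so the
    -- character is extended by zero; its values off the `j`-th term are never used.
    let χ' : MulAut (FreeGroup α) → ℝ := Function.extend v χ 0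
    have hχ' : ∀ y, χ' (v y) = χ y := fun y => hv.extend_apply χ 0 y
    have hvj : ∀ x ∈ H.lowerCentralSeries j, ∃ y, v y = x := by
      intro x hx
      obtain ⟨y, hy, e⟩ := hmap j x hx
      exact ⟨⟨y, hy⟩, e⟩
    have hchar : IsLcsChar H j χ' := by
      constructor
      · intro x hx y hy
        obtain ⟨a, rfl⟩ := hvj x hx
        obtain ⟨b, rfl⟩ := hvj y hy
        have e : v a * v b = v (a * b) := rfl
        rw [e, hχ', hχ', hχ', hχ]
      · intro x hx
        obtain ⟨y, hy, rfl⟩ := hmap (j + 1) x hx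
        have hyN : y ∈ N := (⊤ : Subgroup H).lowerCentralSeries_antitone j.le_succ hy
        exact (hχ' ⟨y, hyN⟩).trans (hχ0 ⟨y, hyN⟩ hy)
    obtain ⟨X, hX, Z, hZf, hZne, hZL, hZ0, hZc, hXZ⟩ := exists_commuting_family j (by omega) hchar
      ⟨v x₀, hmap' j x₀ x₀.2, by rwa [hχ']⟩
    have hZv : ∀ z ∈ Z, ∃ y, v y = z := fun z hz => hvj z (hZL hz)
    refine ⟨H.subtype ⁻¹' X, ?_, v ⁻¹' Z, hZf.preimage hv.injOn, ?_, ?_, ?_, ?_⟩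
    · have hXH : X ⊆ H := by
        rw [hH, ← hX]
        exact Subgroup.subset_closure
      have h1 : (Subgroup.closure (H.subtype ⁻¹' X)).map H.subtype =
          (⊤ : Subgroup H).map H.subtype := by
        rw [MonoidHom.map_closure, Set.image_preimage_eq_of_subset, hX, ← MonoidHom.range_eq_map,
          Subgroup.range_subtype]
        intro x hx
        exact ⟨⟨x, hXH hx⟩, rfl⟩
      exact Subgroup.map_injective H.subtype_injective h1
    · obtain ⟨z, hz⟩ := hZne
      obtain ⟨y, rfl⟩ := hZv z hz
      exact ⟨y, hz⟩
    · intro z hz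
      rw [← hχ']
      exact hZ0 _ hz
    · have key : ∀ a b, ReflTransGen (fun a b => a ∈ Z ∧ b ∈ Z ∧ Commute a b) a b → ∀ z, v z = a →
          ∃ z', v z' = b ∧ ReflTransGen (fun a b : N => a ∈ v ⁻¹' Z ∧ b ∈ v ⁻¹' Z ∧
            Commute (a : H) b) z z' := by
        intro a b hab z hz
        induction hab with
        | refl => exact ⟨z, hz, ReflTransGen.refl⟩
        | @tail b c _ hbc ih =>
          obtain ⟨hb, hc, hcomm⟩ := hbc
          obtain ⟨z', rfl, hz'⟩ := ih
          obtain ⟨w, rfl⟩ := hZv c hc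
          exact ⟨w, rfl, hz'.tail ⟨hb, hc, Subtype.ext hcomm⟩⟩
      intro z hz z' hz'
      obtain ⟨w, hw, h⟩ := key _ _ (hZc _ hz _ hz') z rfl
      rwa [hv hw] at h
    · intro x hx
      obtain ⟨z, hz, hc⟩ := hXZ _ hx
      obtain ⟨y, rfl⟩ := hZv z hz
      exact ⟨y, hz, Subtype.ext hc⟩

end AutFree

theorem theoremC (k n : ℕ) (hk : 2 ≤ k) (hn : 6 * k - 4 ≤ n) :
    (∀ K : Subgroup (IA n), lcsTerm (IA n) k ≤ K → K.FG) ∧ (lcsTerm (IA n) k).FG := by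
  have hIA : IA n = AutFree.magnusSubgroup (Fin n) := AutFree.ker_autAbelianization_eq
  have hall : ∀ i ≤ k - 1, ((⊤ : Subgroup (IA n)).lowerCentralSeries i).FG := by
    rw [hIA]
    intro i hi
    -- The shift between the two numberings gives `6 * (k - 1) + 1 = 6 * k - 5`, one less than the
    -- assumed bound.
    exact AutFree.lowerCentralSeries_fg (Fin n) i (by rw [Fintype.card_fin]; omega)
  exact ⟨fun K hK => Subgroup.fg_of_lowerCentralSeries_le hall hK, hall (k - 1) le_rfl⟩
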